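/- **Setting.** Let $I$ be a finite or countably infinite set and let $A=(a_{ij})_{i,j\in I}$ be an integer matrix with $a_{ii}\in\{2,0,-2,-4,\dots\}$, $a_{ij}\le 0$ for $i\neq j$, $a_{ij}=0$ if and only if $a_{ji}=0$, and positive integers $s_i$ such that $s_ia_{ij}=s_ja_{ji}$. Call $i$ real if $a_{ii}=2$ and imaginary if $a_{ii}\le 0$, and in the latter case put $c_i=-\frac12a_{ii}$. Let $P^\vee$ be a free abelian group, $\mathfrak h=\mathbb Q\otimes P^\vee$, $P=\{\lambda\in\mathfrak h^*:\lambda(P^\vee)\subset\mathbb Z\}$, and let $h_i\in P^\vee$, $\alpha_i\in P$ ($i\in I$) satisfy $\alpha_i(h_j)=a_{ji}$. Assume that the $\alpha_i$ are linearly independent, that there are $\Lambda_i\in P$ with $\Lambda_i(h_j)=\delta_{ij}$, and that there is a non-degenerate symmetric bilinear form on $\mathfrak h^*$ with $(\alpha_i|\lambda)=s_i\lambda(h_i)$ for all $\lambda\in\mathfrak h^*$. Put $Q_+=\sum_i\mathbb Z_{\ge0}\alpha_i$, $q_i=q^{s_i}$, $[n]_i=\frac{q_i^n-q_i^{-n}}{q_i-q_i^{-1}}$,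 $[n]_i!=\prod_{k=1}^n[k]_i$ and $\left[{m\atop n}\right]_i=\frac{[m]_i!}{[m-n]_i!\,[n]_i!}$. Let $U=U_q(\mathfrak g)$ be the associative unital $\mathbb Q(q)$-algebra generated by $e_i,f_i$ $(i\in I)$ and $q^h$ $(h\in P^\vee)$ with relations $q^0=1$, $q^hq^{h'}=q^{h+h'}$, $q^he_iq^{-h}=q^{\alpha_i(h)}e_i$, $q^hf_iq^{-h}=q^{-\alpha_i(h)}f_i$, $e_if_j-f_je_i=\delta_{ij}\frac{K_i-K_i^{-1}}{q_i-q_i^{-1}}$ where $K_i=q^{s_ih_i}$; for $a_{ii}=2$, $i\ne j$, the relations $\sum_{r=0}^{1-a_{ij}}(-1)^r\left[{1-a_{ij}\atop r}\right]_i x_i^{1-a_{ij}-r}x_jx_i^r=0$ for $x=e$ and $x=f$; and $e_ie_j=e_je_i$, $f_if_j=f_jf_i$ if $a_{ij}=0$. The tensor product of two $U$-modules is a $U$-module through the comultiplication $\Delta(q^h)=q^h\otimes q^h$, $\Delta(e_i)=e_i\otimes K_i^{-1}+1\otimes e_i$, $\Delta(f_i)=f_i\otimes1+K_i\otimes f_i$.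 For a $U$-module $M$ and $\mu\in P$ let $M_\mu=\{v:q^hv=q^{\mu(h)}v\ \text{for all } h\in P^\vee\}$. The category $\mathcal O_{int}$ consists of the $U$-modules $M=\bigoplus_{\mu\in P}M_\mu$ such that: all $M_\mu$ are finite-dimensional; the weights (those $\mu$ with $M_\mu\neq0$) lie in $\bigcup_{j=1}^s(\lambda_j-Q_+)$ for finitely many $\lambda_1,\dots,\lambda_s\in P$; $f_i$ is locally nilpotent on $M$ for $i$ real; and, for $i$ imaginary, $\mu(h_i)\ge0$ for every weight $\mu$, $f_iM_\mu=0$ if $\mu(h_i)=0$, and $e_iM_\mu=0$ if $\mu(h_i)=2c_i$. Let $f_i^{(n)}=f_i^n/[n]_i!$ for $i$ real and $f_i^{(n)}=f_i^n$ for $i$ imaginary. If $M\in\mathcal O_{int}$, each $u\in M_\lambda$ is uniquely $u=\sum_{n\ge0}f_i^{(n)}u_n$ with $u_n\in\ker e_i\cap M_{\lambda+n\alpha_i}$, where $u_n=0$ if $i$ is real and $(\lambda+n\alpha_i)(h_i)<n$, and $u_n=0$ if $i$ is imaginary, $n>0$ and $(\lambda+n\alpha_i)(h_i)=0$. The Kashiwara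 operators are the linear maps on $M$ with $\tilde e_iu=\sum_{n\ge1}f_i^{(n-1)}u_n$ and $\tilde f_iu=\sum_{n\ge0}f_i^{(n+1)}u_n$ for such $u$. Let $\mathbf A_0=\{f/g: f,g\in\mathbb Q[q],\ g(0)\neq0\}$. A crystal lattice of $M\in\mathcal O_{int}$ is a free $\mathbf A_0$-submodule $L$ of $M$ that spans $M$ over $\mathbb Q(q)$, with $L=\bigoplus_{\lambda\in P} L_\lambda$ for $L_\lambda=L\cap M_\lambda$, and with $\tilde e_iL\subset L$, $\tilde f_iL\subset L$ for all $i$. A crystal basis of $M$ is a pair $(L,B)$ where $L$ is a crystal lattice and $B$ is a $\mathbb Q$-basis of $L/qL$ such that $B=\bigsqcup_\lambda (B\cap L_\lambda/qL_\lambda)$, $\tilde e_iB\subset B\cup\{0\}$, $\tilde f_iB\subset B\cup\{0\}$, and, for $b,b'\in B$, $\tilde f_ib=b'$ if and only if $b=\tilde e_ib'$. For $b\in B$ put $\varepsilon_i(b)=\max\{l\ge0:\tilde e_i^{\,l}b\in B\}$ and $\varphi_i(b)=\max\{l\ge0:\tilde f_i^{\,l}b\in B\}\in\mathbb Z_{\ge0}\cup\{\infty\}$.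 **Theorem (tensor product rule).** Let $M_1,M_2\in\mathcal O_{int}$ and let $(L_j,B_j)$ be a crystal basis of $M_j$ ($j=1,2$). Put $M=M_1\otimes_{\mathbb Q(q)}M_2$, $L=L_1\otimes_{\mathbf A_0}L_2\subset M$ and $B=B_1\otimes B_2=\{b_1\otimes b_2: b_j\in B_j\}\subset L/qL$. Then $M\in\mathcal O_{int}$, $(L,B)$ is a crystal basis of $M$, and for all $i\in I$, $b_1\in B_1$, $b_2\in B_2$ $$\tilde e_i(b_1\otimes b_2)=\begin{cases}\tilde e_ib_1\otimes b_2&\text{if }\varphi_i(b_1)\ge\varepsilon_i(b_2),\\ b_1\otimes\tilde e_ib_2&\text{if }\varphi_i(b_1)<\varepsilon_i(b_2),\end{cases}\qquad \tilde f_i(b_1\otimes b_2)=\begin{cases}\tilde f_ib_1\otimes b_2&\text{if }\varphi_i(b_1)>\varepsilon_i(b_2),\\ b_1\otimes\tilde f_ib_2&\text{if }\varphi_i(b_1)\le\varepsilon_i(b_2).\end{cases}$$ -/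

import Mathlib

open scoped TensorProduct

noncomputable section

namespace QGKM

/-- The field `ℚ(q)` of rational functions. -/
abbrev K : Type := RatFunc ℚ

/-- The indeterminate `q` of `ℚ(q)`. -/
def q : K := RatFunc.X

/-! ### Quantum integers -/

/-- `[n]_t = (t ^ n - t ^ (-n)) / (t - t⁻¹)`. -/
def qInt (t : K) (n : ℕ) : K := (t ^ n - (t ^ n)⁻¹) / (t - t⁻¹)

/-- `[n]_t! = [1]_t [2]_t ⋯ [n]_t`. -/
def qFact (t : K) (n : ℕ) : K := ∏ k ∈ Finset.range n, qInt t (k + 1)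

/-- The Gaussian binomial coefficient, to be used for `n ≤ m`. -/
def qBinom (t : K) (m n : ℕ) : K := qFact t m / (qFact t (m - n) * qFact t n)

/-- The quantum Serre expression `∑_{r = 0}^{N} (-1)^r [N; r]_t x^{N - r} y x^r`. -/
def serre {A : Type*} [Ring A] [Algebra K A] (t : K) (N : ℕ) (x y : A) : A :=
  ∑ r ∈ Finset.range (N + 1), ((-1) ^ r * qBinom t N r) • (x ^ (N - r) * y * x ^ r)

/-! ### Borcherds-Cartan data -/

/-- A Borcherds-Cartan datum with co-weight lattice `Pv`, for a symmetrizable integral matrix `a`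
with even diagonal.  As `Pv` is free, the Cartan subalgebra `ℚ ⊗ Pv` has dual `Hom_ℤ(Pv, ℚ)`, and
the weight lattice is `P = Hom_ℤ(Pv, ℤ)`. -/
structure BorcherdsCartanDatum (I : Type*) (Pv : Type*) [AddCommGroup Pv] where
  /-- the Borcherds-Cartan matrix -/
  a : I → I → ℤ
  diag : ∀ i, a i i = 2 ∨ a i i ≤ 0
  diag_even : ∀ i, Even (a i i)
  off_diag : ∀ i j, i ≠ j → a i j ≤ 0
  zero_iff : ∀ i j, a i j = 0 ↔ a j i = 0
  /-- the symmetrizing diagonal matrix -/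
  s : I → ℕ
  s_pos : ∀ i, 0 < s i
  symm : ∀ i j, (s i : ℤ) * a i j = s j * a j i
  /-- the simple coroots -/
  h : I → Pv
  /-- the simple roots -/
  α : I → Module.Dual ℤ Pv
  α_h : ∀ i j, α i (h j) = a j i
  α_indep : LinearIndependent ℤ α
  /-- existence of fundamental weights -/
  fundamental : ∃ Λ : I → Module.Dual ℤ Pv, ∀ i, Λ i (h i) = 1 ∧ ∀ j, j ≠ i → Λ i (h j) = 0
  /-- existence of the non-degenerate symmetric form on the dual of the Cartan subalgebra -/
  form : ∃ F : LinearMap.BilinForm ℚ (Pv →ₗ[ℤ] ℚ), F.IsSymm ∧ F.Nondegenerate ∧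
    ∀ (i : I) (l : Pv →ₗ[ℤ] ℚ),
      F ((Int.castAddHom ℚ).toIntLinearMap ∘ₗ α i) l = (s i : ℚ) * l (h i)

variable {I Pv : Type*} [AddCommGroup Pv]

/-- `q_i = q ^ {s_i}`. -/
def BorcherdsCartanDatum.qi (D : BorcherdsCartanDatum I Pv) (i : I) : K := q ^ D.s i

/-- `Q₊`, the non-negative integral combinations of simple roots. -/
def BorcherdsCartanDatum.Qplus (D : BorcherdsCartanDatum I Pv) :
    AddSubmonoid (Module.Dual ℤ Pv) :=
  AddSubmonoid.closure (Set.range D.α)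

/-! ### The quantum generalized Kac-Moody algebra -/

/-- Generators `e_i`, `f_i`, `q^h`. -/
inductive Gen (I Pv : Type*) where
  | e : I → Gen I Pv
  | f : I → Gen I Pv
  | k : Pv → Gen I Pv

/-- The generators in the free algebra. -/
abbrev gen (x : Gen I Pv) : FreeAlgebra K (Gen I Pv) := FreeAlgebra.ι K x

open Gen in
/-- The defining relations, with `K_i = q^{s_i h_i}`. -/
inductive Rel (D : BorcherdsCartanDatum I Pv) :
    FreeAlgebra K (Gen I Pv) → FreeAlgebra K (Gen I Pv) → Prop
  | k_zero : Rel D (gen (k 0)) 1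
  | k_add (x y : Pv) : Rel D (gen (k x) * gen (k y)) (gen (k (x + y)))
  | k_e (x : Pv) (i : I) :
      Rel D (gen (k x) * gen (e i) * gen (k (-x))) (q ^ (D.α i x) • gen (e i))
  | k_f (x : Pv) (i : I) :
      Rel D (gen (k x) * gen (f i) * gen (k (-x))) (q ^ (-(D.α i x)) • gen (f i))
  | e_f_same (i : I) :
      Rel D (gen (e i) * gen (f i) - gen (f i) * gen (e i))
        ((D.qi i - (D.qi i)⁻¹)⁻¹ • (gen (k (D.s i • D.h i)) - gen (k (-(D.s i • D.h i)))))
  | e_f_ne (i j : I) : i ≠ j → Rel D (gen (e i) * gen (f j) - gen (f j) * gen (e i)) 0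
  | serre_e (i j : I) : D.a i i = 2 → i ≠ j →
      Rel D (serre (D.qi i) (1 - D.a i j).toNat (gen (e i)) (gen (e j))) 0
  | serre_f (i j : I) : D.a i i = 2 → i ≠ j →
      Rel D (serre (D.qi i) (1 - D.a i j).toNat (gen (f i)) (gen (f j))) 0
  | comm_e (i j : I) : D.a i j = 0 → Rel D (gen (e i) * gen (e j) - gen (e j) * gen (e i)) 0
  | comm_f (i j : I) : D.a i j = 0 → Rel D (gen (f i) * gen (f j) - gen (f j) * gen (f i)) 0

/-- The quantum generalized Kac-Moody algebra `U_q(𝔤)`. -/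
abbrev Uq (D : BorcherdsCartanDatum I Pv) : Type _ := RingQuot (Rel D)

section generators
variable (D : BorcherdsCartanDatum I Pv)

/-- The image of a generator in `U_q(𝔤)`. -/
def uGen (x : Gen I Pv) : Uq D := RingQuot.mkAlgHom K (Rel D) (gen x)

/-- The generator `e_i`. -/
def uE (i : I) : Uq D := uGen D (.e i)

/-- The generator `f_i`. -/
def uF (i : I) : Uq D := uGen D (.f i)

/-- The generator `q^h`. -/
def uQ (x : Pv) : Uq D := uGen D (.k x)

/-- `K_i = q^{s_i h_i}`. -/
def uK (i : I) : Uq D := uQ D (D.s i • D.h i)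

/-- `K_i⁻¹ = q^{- s_i h_i}`. -/
def uKinv (i : I) : Uq D := uQ D (-(D.s i • D.h i))

/-- The value of the comultiplication on generators:
`Δ(q^h) = q^h ⊗ q^h`, `Δ(e_i) = e_i ⊗ K_i⁻¹ + 1 ⊗ e_i`, `Δ(f_i) = f_i ⊗ 1 + K_i ⊗ f_i`. -/
def comulGen : Gen I Pv → Uq D ⊗[K] Uq D
  | .e i => uE D i ⊗ₜ uKinv D i + 1 ⊗ₜ uE D i
  | .f i => uF D i ⊗ₜ 1 + uK D i ⊗ₜ uF D i
  | .k x => uQ D x ⊗ₜ uQ D x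

end generators

/-! ### Compatibility of the comultiplication with the relations -/

theorem q_ne_zero : q ≠ 0 := RatFunc.X_ne_zero

theorem q_pow_ne_one {n : ℕ} (hn : 0 < n) : q ^ n ≠ 1 := by
  intro h
  have h1 : algebraMap (Polynomial ℚ) K (Polynomial.X ^ n) = algebraMap (Polynomial ℚ) K 1 := by
    rw [map_pow, RatFunc.algebraMap_X, map_one]; exact h
  have h2 := RatFunc.algebraMap_injective ℚ h1
  have h3 := congrArg Polynomial.natDegree h2
  rw [Polynomial.natDegree_X_pow, Polynomial.natDegree_one] at h3
  omega

theorem qInt_inv (t : K) (n : ℕ) : qInt t⁻¹ n = qInt t n := by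
  unfold qInt
  rw [inv_pow, inv_inv, inv_inv, ← neg_sub (t ^ n), ← neg_sub t, neg_div_neg_eq]

theorem serre_inv {A : Type*} [Ring A] [Algebra K A] (t : K) (N : ℕ) (x y : A) :
    serre t⁻¹ N x y = serre t N x y := by
  simp only [serre, qBinom, qFact, qInt_inv]

theorem map_serre {A B : Type*} [Ring A] [Algebra K A] [Ring B] [Algebra K B] (φ : A →ₐ[K] B)
    (t : K) (N : ℕ) (x y : A) : φ (serre t N x y) = serre t N (φ x) (φ y) := by
  simp [serre, map_sum, map_smul, map_mul, map_pow]

theorem serre_add_right {A : Type*} [Ring A] [Algebra K A] (t : K) (N : ℕ) (x y z : A) :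
    serre t N x (y + z) = serre t N x y + serre t N x z := by
  simp only [serre, mul_add, add_mul, smul_add, Finset.sum_add_distrib]

/-- `t` is a non-root of unity. -/
def Generic (t : K) : Prop := t ≠ 0 ∧ ∀ n : ℕ, 0 < n → t ^ n ≠ 1

theorem Generic.inv {t : K} (h : Generic t) : Generic t⁻¹ :=
  ⟨inv_ne_zero h.1, fun n hn e => h.2 n hn (by rwa [inv_pow, inv_eq_one] at e)⟩

theorem Generic.sub_inv {t : K} (h : Generic t) {n : ℕ} (hn : 0 < n) :
    t ^ n - (t ^ n)⁻¹ ≠ 0 := by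
  intro e
  have h0 : t ^ n ≠ 0 := pow_ne_zero _ h.1
  apply h.2 (n + n) (by omega)
  rw [pow_add]
  nth_rewrite 2 [sub_eq_zero.mp e]
  exact mul_inv_cancel₀ h0

theorem Generic.qInt_ne {t : K} (h : Generic t) {n : ℕ} (hn : 0 < n) : qInt t n ≠ 0 :=
  div_ne_zero (h.sub_inv hn) (by simpa using h.sub_inv one_pos)

theorem Generic.qFact_ne {t : K} (h : Generic t) (n : ℕ) : qFact t n ≠ 0 :=
  Finset.prod_ne_zero_iff.mpr fun _ _ => h.qInt_ne (Nat.succ_pos _)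

theorem qFact_succ (t : K) (n : ℕ) : qFact t (n + 1) = qFact t n * qInt t (n + 1) :=
  Finset.prod_range_succ _ _

theorem qBinom_zero {t : K} (h : Generic t) (n : ℕ) : qBinom t n 0 = 1 := by
  have := h.qFact_ne n
  unfold qBinom
  simp [show qFact t 0 = 1 from rfl, div_self this]

theorem qBinom_self {t : K} (h : Generic t) (n : ℕ) : qBinom t n n = 1 := by
  have := h.qFact_ne n
  unfold qBinom
  simp [show qFact t 0 = 1 from rfl, div_self this]

theorem qInt_add {t : K} (h : Generic t) (m r : ℕ) :
    qInt t (m + r) = t ^ r * qInt t m + (t ^ m)⁻¹ * qInt t r := by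
  have h0 := h.1
  have h1 : t - t⁻¹ ≠ 0 := by simpa using h.sub_inv one_pos
  have hm : t ^ m ≠ 0 := pow_ne_zero _ h0
  have hr : t ^ r ≠ 0 := pow_ne_zero _ h0
  unfold qInt
  rw [mul_div_assoc', mul_div_assoc', ← add_div]
  congr 1
  rw [pow_add]
  field_simp
  ring

theorem qBinom_pascal {t : K} (h : Generic t) (m r : ℕ) :
    qBinom t (m + r + 2) (r + 1) =
      t ^ (r + 1) * qBinom t (m + r + 1) (r + 1) + (t ^ (m + 1))⁻¹ * qBinom t (m + r + 1) r := by
  have e1 : m + r + 2 - (r + 1) = m + 1 := by omega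
  have e2 : m + r + 1 - (r + 1) = m := by omega
  have e3 : m + r + 1 - r = m + 1 := by omega
  have e4 : m + r + 2 = (m + 1) + (r + 1) := by omega
  unfold qBinom
  rw [e1, e2, e3, qFact_succ t (m + r + 1), show m + r + 1 + 1 = (m + 1) + (r + 1) by omega,
    qInt_add h, qFact_succ t m, qFact_succ t r]
  have a1 := h.qFact_ne m
  have a2 := h.qFact_ne r
  have a3 := h.qInt_ne (Nat.succ_pos m)
  have a4 := h.qInt_ne (Nat.succ_pos r)
  have a5 : t ^ (m + 1) ≠ 0 := pow_ne_zero _ h.1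
  simp only [Nat.succ_eq_add_one] at a3 a4
  field_simp

/-- Iterated `q`-commutators. -/
def qComm {A : Type*} [Ring A] [Algebra K A] (t : K) (p : ℤ) (x y : A) : ℕ → A
  | 0 => y
  | n + 1 => x * qComm t p x y n - t ^ (p - 2 * n) • (qComm t p x y n * x)

theorem qComm_eq {A : Type*} [Ring A] [Algebra K A] {t : K} (h : Generic t) (p : ℤ) (x y : A)
    (n : ℕ) : qComm t p x y n = ∑ r ∈ Finset.range (n + 1),
      ((-1) ^ r * qBinom t n r * t ^ ((r : ℤ) * (p - n + 1))) • (x ^ (n - r) * y * x ^ r) := by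
  induction n with
  | zero => simp [qComm, qBinom_zero h]
  | succ n ih =>
    have hL : x * qComm t p x y n = ∑ r ∈ Finset.range (n + 1),
        ((-1) ^ r * qBinom t n r * t ^ ((r : ℤ) * (p - n + 1))) •
          (x ^ (n + 1 - r) * y * x ^ r) := by
      rw [ih, Finset.mul_sum]
      refine Finset.sum_congr rfl fun r hr => ?_
      have : n + 1 - r = n - r + 1 := by have := Finset.mem_range.mp hr; omega
      rw [mul_smul_comm, this, pow_succ' x (n - r)]
      simp only [mul_assoc]
    have hR : t ^ (p - 2 * n) • (qComm t p x y n * x) = ∑ r ∈ Finset.range (n + 1),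
        (t ^ (p - 2 * n) * ((-1) ^ r * qBinom t n r * t ^ ((r : ℤ) * (p - n + 1)))) •
          (x ^ (n + 1 - (r + 1)) * y * x ^ (r + 1)) := by
      rw [ih, Finset.sum_mul, Finset.smul_sum]
      refine Finset.sum_congr rfl fun r hr => ?_
      have : n + 1 - (r + 1) = n - r := by omega
      rw [smul_mul_assoc, smul_smul, this, pow_succ x r]
      simp only [mul_assoc]
    rw [qComm, hL, hR, Finset.sum_range_succ', Finset.sum_range_succ _ n,
      Finset.sum_range_succ' _ (n + 1), Finset.sum_range_succ _ n]
    have key : ∀ r ∈ Finset.range n,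
        ((-1) ^ (r + 1) * qBinom t n (r + 1) * t ^ (((r + 1 : ℕ) : ℤ) * (p - n + 1))) •
          (x ^ (n + 1 - (r + 1)) * y * x ^ (r + 1)) -
        (t ^ (p - 2 * n) * ((-1) ^ r * qBinom t n r * t ^ ((r : ℤ) * (p - n + 1)))) •
          (x ^ (n + 1 - (r + 1)) * y * x ^ (r + 1)) =
        ((-1) ^ (r + 1) * qBinom t (n + 1) (r + 1) *
          t ^ (((r + 1 : ℕ) : ℤ) * (p - (n + 1 : ℕ) + 1))) •
          (x ^ (n + 1 - (r + 1)) * y * x ^ (r + 1)) := by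
      intro r hr
      rw [← sub_smul]
      congr 1
      obtain ⟨m, rfl⟩ : ∃ m, n = m + r + 1 :=
        ⟨n - r - 1, by have := Finset.mem_range.mp hr; omega⟩
      have h0 := h.1
      rw [show m + r + 1 + 1 = m + r + 2 by omega, qBinom_pascal h]
      have e1 : t ^ (((r + 1 : ℕ) : ℤ) * (p - (m + r + 1 : ℕ) + 1)) =
          t ^ (((r + 1 : ℕ) : ℤ) * (p - (m + r + 2 : ℕ) + 1)) * t ^ (r + 1) := by
        rw [← zpow_natCast t (r + 1), ← zpow_add₀ h0]
        congr 1; push_cast; ring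
      have e2 : t ^ (p - 2 * (m + r + 1 : ℕ)) * t ^ ((r : ℤ) * (p - (m + r + 1 : ℕ) + 1)) =
          t ^ (((r + 1 : ℕ) : ℤ) * (p - (m + r + 2 : ℕ) + 1)) * (t ^ (m + 1))⁻¹ := by
        rw [← zpow_natCast t (m + 1), ← zpow_neg, ← zpow_add₀ h0, ← zpow_add₀ h0]
        congr 1; push_cast; ring
      rw [e1, show ∀ u v w z : K, u * (v * w * z) = v * w * (u * z) from fun u v w z => by ring,
        e2, pow_succ (-1 : K) r]
      ring
    rw [← Finset.sum_congr rfl key, Finset.sum_sub_distrib]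
    have k0 : ((-1 : K) ^ 0 * qBinom t n 0 * t ^ (((0 : ℕ) : ℤ) * (p - n + 1))) =
        ((-1) ^ 0 * qBinom t (n + 1) 0 * t ^ (((0 : ℕ) : ℤ) * (p - (n + 1 : ℕ) + 1))) := by
      simp [qBinom_zero h]
    have kn : (t ^ (p - 2 * n) * ((-1) ^ n * qBinom t n n * t ^ ((n : ℤ) * (p - n + 1)))) =
        - ((-1) ^ (n + 1) * qBinom t (n + 1) (n + 1) *
          t ^ (((n + 1 : ℕ) : ℤ) * (p - (n + 1 : ℕ) + 1))) := by
      have e : t ^ (((n + 1 : ℕ) : ℤ) * (p - (n + 1 : ℕ) + 1)) =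
          t ^ (p - 2 * n) * t ^ ((n : ℤ) * (p - n + 1)) := by
        rw [← zpow_add₀ h.1]; congr 1; push_cast; ring
      rw [qBinom_self h, qBinom_self h, e, pow_succ (-1 : K) n]
      ring
    rw [k0, kn, neg_smul]
    abel

theorem qComm_serre {A : Type*} [Ring A] [Algebra K A] {t : K} (h : Generic t) (x y : A)
    (N : ℕ) : qComm t (N - 1) x y N = serre t N x y := by
  rw [qComm_eq h, serre]
  refine Finset.sum_congr rfl fun r _ => ?_
  simp

theorem serre_add_left {A : Type*} [Ring A] [Algebra K A] {t : K} (h : Generic t) (x z y : A)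
    (N : ℕ) (h1 : z * x = t ^ (2 : ℤ) • (x * z)) (h2 : z * y = t ^ (1 - N : ℤ) • (y * z)) :
    serre t N (x + z) y = serre t N x y := by
  have h0 := h.1
  rw [← serre_inv t, ← serre_inv t, ← qComm_serre h.inv, ← qComm_serre h.inv]
  have hz : ∀ k, z * qComm t⁻¹ (N - 1) x y k =
      t ^ (1 - N + 2 * k : ℤ) • (qComm t⁻¹ (N - 1) x y k * z) := by
    intro k
    induction k with
    | zero => simpa [qComm] using h2
    | succ k ih =>
      have a1 : z * (x * qComm t⁻¹ (N - 1) x y k) =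
          t ^ (1 - N + 2 * (k + 1 : ℕ) : ℤ) • (x * qComm t⁻¹ (N - 1) x y k * z) := by
        rw [← mul_assoc, h1, smul_mul_assoc, mul_assoc, ih, mul_smul_comm, smul_smul,
          ← zpow_add₀ h0, ← mul_assoc]
        congr 2; push_cast; ring
      have a2 : z * (qComm t⁻¹ (N - 1) x y k * x) =
          t ^ (1 - N + 2 * (k + 1 : ℕ) : ℤ) • (qComm t⁻¹ (N - 1) x y k * x * z) := by
        rw [← mul_assoc, ih, smul_mul_assoc, mul_assoc, h1, mul_smul_comm, smul_smul,
          ← zpow_add₀ h0, ← mul_assoc]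
        congr 2; push_cast; ring
      rw [qComm, mul_sub, mul_smul_comm, a1, a2, sub_mul, smul_mul_assoc, smul_sub, smul_comm]
  have key : ∀ k, qComm t⁻¹ (N - 1) (x + z) y k = qComm t⁻¹ (N - 1) x y k := by
    intro k
    induction k with
    | zero => rfl
    | succ k ih =>
      rw [qComm, ih, add_mul, mul_add, hz k, smul_add, qComm, inv_zpow, ← zpow_neg]
      rw [show -((N : ℤ) - 1 - 2 * k) = 1 - N + 2 * k by ring]
      abel
  exact key N

theorem serre_add {A : Type*} [Ring A] [Algebra K A] {t : K} (h : Generic t) (x z y w : A)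
    (N : ℕ) (h1 : z * x = t ^ (2 : ℤ) • (x * z)) (h2 : z * y = t ^ (1 - N : ℤ) • (y * z))
    (h3 : w * x = t ^ (1 - N : ℤ) • (x * w)) :
    serre t N (x + z) (y + w) = serre t N x y + serre t N z w := by
  have h0 := h.1
  rw [serre_add_right, serre_add_left h x z y N h1 h2, add_comm x z, ← serre_inv t N (z + x),
    serre_add_left h.inv z x w N, serre_inv]
  · rw [h1, smul_smul, inv_zpow, inv_mul_cancel₀ (zpow_ne_zero _ h0), one_smul]
  · rw [h3, smul_smul, inv_zpow, inv_mul_cancel₀ (zpow_ne_zero _ h0), one_smul]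

section relations
variable (D : BorcherdsCartanDatum I Pv)

theorem rel_eq {x y : FreeAlgebra K (Gen I Pv)} (h : Rel D x y) :
    RingQuot.mkAlgHom K (Rel D) x = RingQuot.mkAlgHom K (Rel D) y :=
  RingQuot.mkAlgHom_rel K h

theorem uQ_zero : uQ D 0 = 1 := by
  simpa [uQ, uGen] using rel_eq D Rel.k_zero

theorem uQ_mul (x y : Pv) : uQ D x * uQ D y = uQ D (x + y) := by
  simpa [uQ, uGen] using rel_eq D (Rel.k_add x y)

theorem uQ_comm (x y : Pv) : uQ D x * uQ D y = uQ D y * uQ D x := by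
  rw [uQ_mul, uQ_mul, add_comm]

theorem uQ_uE (x : Pv) (i : I) : uQ D x * uE D i = q ^ (D.α i x) • (uE D i * uQ D x) := by
  have h : uQ D x * uE D i * uQ D (-x) = q ^ (D.α i x) • uE D i := by
    simpa [uQ, uGen, uE] using rel_eq D (Rel.k_e x i)
  have h2 := congrArg (· * uQ D x) h
  simpa [mul_assoc, uQ_mul, uQ_zero] using h2

theorem uQ_uF (x : Pv) (i : I) : uQ D x * uF D i = q ^ (-(D.α i x)) • (uF D i * uQ D x) := by
  have h : uQ D x * uF D i * uQ D (-x) = q ^ (-(D.α i x)) • uF D i := by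
    simpa [uQ, uGen, uF] using rel_eq D (Rel.k_f x i)
  have h2 := congrArg (· * uQ D x) h
  simpa [mul_assoc, uQ_mul, uQ_zero] using h2

theorem generic_qi (i : I) : Generic (D.qi i) := by
  refine ⟨pow_ne_zero _ q_ne_zero, fun n hn => ?_⟩
  rw [BorcherdsCartanDatum.qi, ← pow_mul]
  exact q_pow_ne_one (Nat.mul_pos (D.s_pos i) hn)

theorem qi_zpow (i : I) (n : ℤ) : D.qi i ^ n = q ^ ((D.s i : ℤ) * n) := by
  rw [BorcherdsCartanDatum.qi, zpow_mul, zpow_natCast]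

theorem α_sh (i j : I) : D.α j (D.s i • D.h i) = D.s i * D.a i j := by
  rw [map_nsmul, D.α_h, nsmul_eq_mul]

theorem α_sh' (i j : I) : D.α i (D.s j • D.h j) = D.s i * D.a i j := by
  rw [α_sh, D.symm]

theorem serre_tmul {A B : Type*} [Ring A] [Algebra K A] [Ring B] [Algebra K B] (x y : A) (u v : B)
    (huv : Commute u v) (t : K) (N : ℕ) :
    serre t N (x ⊗ₜ[K] u) (y ⊗ₜ[K] v) = serre t N x y ⊗ₜ[K] (u ^ N * v) := by
  rw [serre, serre, TensorProduct.sum_tmul]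
  refine Finset.sum_congr rfl fun r hr => ?_
  have hr' : r ≤ N := by have := Finset.mem_range.mp hr; omega
  rw [Algebra.TensorProduct.tmul_pow, Algebra.TensorProduct.tmul_pow,
    Algebra.TensorProduct.tmul_mul_tmul, Algebra.TensorProduct.tmul_mul_tmul,
    ← TensorProduct.smul_tmul', mul_assoc (u ^ (N - r)), (huv.symm.pow_right r).eq, ← mul_assoc,
    ← pow_add, Nat.sub_add_cancel hr']

theorem serre_tmul' {A B : Type*} [Ring A] [Algebra K A] [Ring B] [Algebra K B] (x y : A)
    (u v : B) (huv : Commute u v) (t : K) (N : ℕ) :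
    serre t N (u ⊗ₜ[K] x) (v ⊗ₜ[K] y) = (u ^ N * v) ⊗ₜ[K] serre t N x y := by
  rw [serre, serre, TensorProduct.tmul_sum]
  refine Finset.sum_congr rfl fun r hr => ?_
  have hr' : r ≤ N := by have := Finset.mem_range.mp hr; omega
  rw [Algebra.TensorProduct.tmul_pow, Algebra.TensorProduct.tmul_pow,
    Algebra.TensorProduct.tmul_mul_tmul, Algebra.TensorProduct.tmul_mul_tmul,
    TensorProduct.tmul_smul, mul_assoc (u ^ (N - r)), (huv.symm.pow_right r).eq, ← mul_assoc,
    ← pow_add, Nat.sub_add_cancel hr']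

theorem uK_comm (i j : I) : uK D i * uK D j = uK D j * uK D i := uQ_comm D _ _

theorem uKinv_comm (i j : I) : uKinv D i * uKinv D j = uKinv D j * uKinv D i := uQ_comm D _ _

theorem uK_uE (i j : I) : uK D i * uE D j = q ^ (D.s i * D.a i j) • (uE D j * uK D i) := by
  rw [uK, uQ_uE, α_sh]

theorem uK_uF (i j : I) : uK D i * uF D j = q ^ (-(D.s i * D.a i j)) • (uF D j * uK D i) := by
  rw [uK, uQ_uF, α_sh]

theorem uKinv_uE (i j : I) :
    uKinv D i * uE D j = q ^ (-(D.s i * D.a i j)) • (uE D j * uKinv D i) := by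
  rw [uKinv, uQ_uE, map_neg, α_sh]

theorem uKinv_uF (i j : I) :
    uKinv D i * uF D j = q ^ (D.s i * D.a i j) • (uF D j * uKinv D i) := by
  rw [uKinv, uQ_uF, map_neg, α_sh, neg_neg]

theorem e_f_comm (i : I) : uE D i * uF D i - uF D i * uE D i =
    (D.qi i - (D.qi i)⁻¹)⁻¹ • (uK D i - uKinv D i) := by
  simpa only [uE, uF, uK, uKinv, uQ, uGen, map_sub, map_mul, map_smul]
    using rel_eq D (Rel.e_f_same i)

theorem comul_ef (i j : I) :
    (uE D i ⊗ₜ[K] uKinv D i + 1 ⊗ₜ[K] uE D i) * (uF D j ⊗ₜ[K] 1 + uK D j ⊗ₜ[K] uF D j) -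
      (uF D j ⊗ₜ[K] 1 + uK D j ⊗ₜ[K] uF D j) * (uE D i ⊗ₜ[K] uKinv D i + 1 ⊗ₜ[K] uE D i) =
    (uE D i * uF D j - uF D j * uE D i) ⊗ₜ[K] uKinv D i +
      uK D j ⊗ₜ[K] (uE D i * uF D j - uF D j * uE D i) := by
  have cross : (uE D i * uK D j) ⊗ₜ[K] (uKinv D i * uF D j) =
      (uK D j * uE D i) ⊗ₜ[K] (uF D j * uKinv D i) := by
    rw [uK_uE, uKinv_uF, ← D.symm, TensorProduct.tmul_smul, TensorProduct.smul_tmul']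
  simp only [mul_add, add_mul, Algebra.TensorProduct.tmul_mul_tmul, mul_one, one_mul, cross,
    TensorProduct.sub_tmul, TensorProduct.tmul_sub]
  abel

theorem comulGen_rel ⦃x y : FreeAlgebra K (Gen I Pv)⦄ (h : Rel D x y) :
    FreeAlgebra.lift K (comulGen D) x = FreeAlgebra.lift K (comulGen D) y := by
  have tm := fun (a b c d : Uq D) => Algebra.TensorProduct.tmul_mul_tmul (R := K) a c b d
  induction h with
  | k_zero => simp [comulGen, uQ_zero, Algebra.TensorProduct.one_def]
  | k_add x y => simp [comulGen, uQ_mul]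
  | k_e x i =>
    simp only [map_mul, map_smul, FreeAlgebra.lift_ι_apply, comulGen, mul_add, add_mul, tm,
      smul_add]
    have c1 : uQ D x * uKinv D i * uQ D (-x) = uKinv D i := by
      rw [uKinv, uQ_comm, mul_assoc, uQ_mul, add_neg_cancel, uQ_zero, mul_one]
    have c2 : uQ D x * uE D i * uQ D (-x) = q ^ (D.α i x) • uE D i := by
      rw [uQ_uE, smul_mul_assoc, mul_assoc, uQ_mul, add_neg_cancel, uQ_zero, mul_one]
    rw [c1, c2, mul_one, uQ_mul, add_neg_cancel, uQ_zero, TensorProduct.tmul_smul,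
      ← TensorProduct.smul_tmul']
  | k_f x i =>
    simp only [map_mul, map_smul, FreeAlgebra.lift_ι_apply, comulGen, mul_add, add_mul, tm,
      smul_add]
    have c1 : uQ D x * uK D i * uQ D (-x) = uK D i := by
      rw [uK, uQ_comm, mul_assoc, uQ_mul, add_neg_cancel, uQ_zero, mul_one]
    have c2 : uQ D x * uF D i * uQ D (-x) = q ^ (-(D.α i x)) • uF D i := by
      rw [uQ_uF, smul_mul_assoc, mul_assoc, uQ_mul, add_neg_cancel, uQ_zero, mul_one]
    rw [c1, c2, mul_one, uQ_mul, add_neg_cancel, uQ_zero, TensorProduct.tmul_smul,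
      ← TensorProduct.smul_tmul']
  | e_f_same i =>
    simp only [map_sub, map_mul, map_smul, FreeAlgebra.lift_ι_apply, comulGen]
    rw [comul_ef, e_f_comm]
    simp only [← TensorProduct.smul_tmul', TensorProduct.tmul_smul, TensorProduct.sub_tmul,
      TensorProduct.tmul_sub, smul_sub, uK, uKinv]
    abel
  | e_f_ne i j hij =>
    simp only [map_sub, map_mul, map_zero, FreeAlgebra.lift_ι_apply, comulGen]
    have h0 : uE D i * uF D j - uF D j * uE D i = 0 := by
      simpa [uE, uF, uGen] using rel_eq D (Rel.e_f_ne i j hij)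
    rw [comul_ef, h0, TensorProduct.zero_tmul, TensorProduct.tmul_zero, add_zero]
  | serre_e i j hi hij =>
    have hN : (1 - ((1 - D.a i j).toNat : ℤ)) = D.a i j := by
      have := D.off_diag i j hij; omega
    have h0 : serre (D.qi i) (1 - D.a i j).toNat (uE D i) (uE D j) = 0 := by
      have := rel_eq D (Rel.serre_e i j hi hij)
      rwa [map_serre, map_zero] at this
    rw [map_zero]
    refine (map_serre (FreeAlgebra.lift K (comulGen D)) _ _ _ _).trans ?_
    rw [FreeAlgebra.lift_ι_apply, FreeAlgebra.lift_ι_apply]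
    simp only [comulGen]
    rw [add_comm (uE D i ⊗ₜ[K] uKinv D i), add_comm (uE D j ⊗ₜ[K] uKinv D j),
      ← serre_inv, serre_add (generic_qi D i).inv, serre_inv, serre_inv,
      serre_tmul _ _ _ _ (uKinv_comm D i j), serre_tmul' _ _ _ _ (Commute.refl _), h0,
      TensorProduct.zero_tmul, TensorProduct.tmul_zero, add_zero]
    all_goals
      simp only [tm, uKinv_uE, mul_one, one_mul, inv_zpow', qi_zpow, hN, hi,
        TensorProduct.tmul_smul, D.symm j i]
      try simp
  | serre_f i j hi hij =>
    have hN : (1 - ((1 - D.a i j).toNat : ℤ)) = D.a i j := by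
      have := D.off_diag i j hij; omega
    have h0 : serre (D.qi i) (1 - D.a i j).toNat (uF D i) (uF D j) = 0 := by
      have := rel_eq D (Rel.serre_f i j hi hij)
      rwa [map_serre, map_zero] at this
    rw [map_zero]
    refine (map_serre (FreeAlgebra.lift K (comulGen D)) _ _ _ _).trans ?_
    rw [FreeAlgebra.lift_ι_apply, FreeAlgebra.lift_ι_apply]
    simp only [comulGen]
    rw [← serre_inv, serre_add (generic_qi D i).inv, serre_inv, serre_inv,
      serre_tmul _ _ _ _ (Commute.refl _), serre_tmul' _ _ _ _ (uK_comm D i j), h0,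
      TensorProduct.zero_tmul, TensorProduct.tmul_zero, add_zero]
    all_goals
      simp only [tm, uK_uF, mul_one, one_mul, inv_zpow', qi_zpow, hN, hi,
        ← TensorProduct.smul_tmul', D.symm j i]
      try simp
  | comm_e i j hij =>
    have h0 : uE D i * uE D j - uE D j * uE D i = 0 := by
      simpa [uE, uGen] using rel_eq D (Rel.comm_e i j hij)
    have hji : D.a j i = 0 := (D.zero_iff i j).mp hij
    simp only [map_sub, map_mul, map_zero, FreeAlgebra.lift_ι_apply, comulGen, mul_add, add_mul,
      tm, uKinv_uE, hij, hji, mul_zero, neg_zero, zpow_zero, one_smul, mul_one, one_mul,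
      sub_eq_zero.mp h0, uKinv_comm D i j]
    abel
  | comm_f i j hij =>
    have h0 : uF D i * uF D j - uF D j * uF D i = 0 := by
      simpa [uF, uGen] using rel_eq D (Rel.comm_f i j hij)
    have hji : D.a j i = 0 := (D.zero_iff i j).mp hij
    simp only [map_sub, map_mul, map_zero, FreeAlgebra.lift_ι_apply, comulGen, mul_add, add_mul,
      tm, uK_uF, hij, hji, mul_zero, neg_zero, zpow_zero, one_smul, mul_one, one_mul,
      sub_eq_zero.mp h0, uK_comm D i j]
    abel

/-- The comultiplication of `U_q(𝔤)`. -/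
def comul : Uq D →ₐ[K] Uq D ⊗[K] Uq D :=
  RingQuot.liftAlgHom K ⟨FreeAlgebra.lift K (comulGen D), comulGen_rel D⟩

theorem comul_uGen (x : Gen I Pv) : comul D (uGen D x) = comulGen D x := by
  rw [comul, uGen, RingQuot.liftAlgHom_mkAlgHom_apply, FreeAlgebra.lift_ι_apply]

end relations

/-! ### Modules, weight spaces and the category `O_int` -/

/-- A `U_q(𝔤)`-module structure on the `ℚ(q)`-vector space `M`. -/
abbrev Rep (D : BorcherdsCartanDatum I Pv) (M : Type*) [AddCommGroup M] [Module K M] : Type _ :=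
  Uq D →ₐ[K] Module.End K M

section modules
variable {D : BorcherdsCartanDatum I Pv} {M : Type*} [AddCommGroup M] [Module K M] (ρ : Rep D M)

/-- The weight space `M_μ = {v ∣ q^h v = q^{μ(h)} v for all h}`. -/
def weightSpace (μ : Module.Dual ℤ Pv) : Submodule K M :=
  ⨅ x : Pv, LinearMap.ker (ρ (uQ D x) - q ^ (μ x) • (1 : Module.End K M))

/-- `L` is the (internal) direct sum of the family `N` of submodules. -/
def IsDirectSum {R V ι : Type*} [Ring R] [AddCommGroup V] [Module R V]
    (L : Submodule R V) (N : ι → Submodule R V) : Prop :=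
  iSupIndep N ∧ ⨆ j, N j = L

/-- The category `O_int`. -/
structure IsOInt : Prop where
  weight : IsDirectSum ⊤ (weightSpace ρ)
  finite : ∀ μ, Module.Finite K (weightSpace ρ μ)
  bounded : ∃ S : Finset (Module.Dual ℤ Pv), ∀ μ, weightSpace ρ μ ≠ ⊥ →
    ∃ l ∈ S, l - μ ∈ D.Qplus
  nilp : ∀ i, D.a i i = 2 → ∀ v : M, ∃ n : ℕ, (ρ (uF D i) ^ n) v = 0
  nonneg : ∀ i, D.a i i ≤ 0 → ∀ μ, weightSpace ρ μ ≠ ⊥ → 0 ≤ μ (D.h i)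
  f_zero : ∀ i, D.a i i ≤ 0 → ∀ μ : Module.Dual ℤ Pv, μ (D.h i) = 0 →
    ∀ v ∈ weightSpace ρ μ, ρ (uF D i) v = 0
  /-- here `2 c_i = - a_{ii}` -/
  e_zero : ∀ i, D.a i i ≤ 0 → ∀ μ : Module.Dual ℤ Pv, μ (D.h i) = -D.a i i →
    ∀ v ∈ weightSpace ρ μ, ρ (uE D i) v = 0

/-! ### Kashiwara operators -/

/-- The divided power `f_i^{(n)}`: `f_i^n / [n]_i!` for real `i` and `f_i^n` for imaginary `i`. -/
def fDiv (i : I) (n : ℕ) : Module.End K M :=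
  if D.a i i = 2 then (qFact (D.qi i) n)⁻¹ • ρ (uF D i) ^ n else ρ (uF D i) ^ n

/-- `w` is the `i`-string decomposition `u = ∑ f_i^{(n)} w_n` of the vector `u` of weight `μ`. -/
structure IsStringDecomposition (i : I) (μ : Module.Dual ℤ Pv) (u : M) (w : ℕ →₀ M) : Prop where
  ker : ∀ n, ρ (uE D i) (w n) = 0
  weight : ∀ n, w n ∈ weightSpace ρ (μ + n • D.α i)
  sum : u = w.sum fun n v => fDiv ρ i n v
  real : D.a i i = 2 → ∀ n : ℕ, (μ + n • D.α i) (D.h i) < n → w n = 0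
  imag : D.a i i ≤ 0 → ∀ n : ℕ, 0 < n → (μ + n • D.α i) (D.h i) = 0 → w n = 0

/-- `T` sends each weight vector `u = ∑ f_i^{(n)} u_n` to `∑_{n ≥ 1} f_i^{(n - 1)} u_n`. -/
def IsKashiwaraE (i : I) (T : M →ₗ[K] M) : Prop :=
  ∀ μ, ∀ u ∈ weightSpace ρ μ, ∀ w : ℕ →₀ M, IsStringDecomposition ρ i μ u w →
    T u = w.sum fun n v => if n = 0 then 0 else fDiv ρ i (n - 1) v

/-- `T` sends each weight vector `u = ∑ f_i^{(n)} u_n` to `∑ f_i^{(n + 1)} u_n`. -/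
def IsKashiwaraF (i : I) (T : M →ₗ[K] M) : Prop :=
  ∀ μ, ∀ u ∈ weightSpace ρ μ, ∀ w : ℕ →₀ M, IsStringDecomposition ρ i μ u w →
    T u = w.sum fun n v => fDiv ρ i (n + 1) v

open Classical in
/-- The Kashiwara operator `ẽ_i`.  On a module in `O_int` the weight vectors span and each of them
has exactly one `i`-string decomposition, so that there is exactly one map as described; the
value `0` is used only outside `O_int`. -/
def kashE (i : I) : M →ₗ[K] M :=
  if H : ∃ T, IsKashiwaraE ρ i T then H.choose else 0

open Classical in
/-- The Kashiwara operator `f̃_i`, see `kashE`. -/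
def kashF (i : I) : M →ₗ[K] M :=
  if H : ∃ T, IsKashiwaraF ρ i T then H.choose else 0

end modules

/-! ### Crystal bases -/

/-- The subalgebra `{f / g ∣ f, g ∈ ℚ[q], g(0) ≠ 0}` of `ℚ(q)`. -/
def A0sub : Subalgebra ℚ K where
  carrier := {x | ∃ f g : Polynomial ℚ, g.eval 0 ≠ 0 ∧
    x = algebraMap (Polynomial ℚ) K f / algebraMap (Polynomial ℚ) K g}
  mul_mem' := by
    rintro _ _ ⟨f, g, hg, rfl⟩ ⟨f', g', hg', rfl⟩
    exact ⟨f * f', g * g', by rw [Polynomial.eval_mul]; exact mul_ne_zero hg hg',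
      by rw [map_mul, map_mul, div_mul_div_comm]⟩
  add_mem' := by
    rintro _ _ ⟨f, g, hg, rfl⟩ ⟨f', g', hg', rfl⟩
    have n : ∀ p : Polynomial ℚ, p.eval 0 ≠ 0 → algebraMap (Polynomial ℚ) K p ≠ 0 := by
      intro p hp h
      rw [map_eq_zero_iff _ (RatFunc.algebraMap_injective ℚ)] at h
      exact hp (by rw [h, Polynomial.eval_zero])
    exact ⟨f * g' + g * f', g * g', by rw [Polynomial.eval_mul]; exact mul_ne_zero hg hg',
      by rw [map_add, map_mul, map_mul, map_mul, div_add_div _ _ (n g hg) (n g' hg')]⟩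
  algebraMap_mem' r := ⟨Polynomial.C r, 1, by simp, by
    rw [map_one, div_one]
    exact (IsScalarTower.algebraMap_apply ℚ (Polynomial ℚ) K r)⟩

/-- The local ring `A₀ = {f / g ∣ f, g ∈ ℚ[q], g(0) ≠ 0}`. -/
def A0 : Type := A0sub

instance : CommRing A0 := inferInstanceAs (CommRing A0sub)

instance : Algebra ℚ A0 := inferInstanceAs (Algebra ℚ A0sub)

instance : Algebra A0 K := inferInstanceAs (Algebra A0sub K)

/-- Restriction of scalars from `ℚ(q)` to `A₀`. -/
instance (priority := low) {M : Type*} [AddCommGroup M] [Module K M] : Module A0 M :=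
  Module.compHom M (algebraMap A0 K)

instance {M : Type*} [AddCommGroup M] [Module K M] : IsScalarTower A0 K M where
  smul_assoc c x v := by
    rw [Algebra.smul_def, mul_smul]
    rfl

/-- The element `q` of `A₀`. -/
def q0 : A0 := (⟨q, Polynomial.X, 1, by simp, by simp [q]⟩ : A0sub)

/-- `A₀`-submodules of a `ℚ(q)`-vector space. -/
abbrev QLattice (M : Type*) [AddCommGroup M] [Module K M] : Type _ := Submodule A0 M

section crystal
variable {M : Type*} [AddCommGroup M] [Module K M]

/-- The submodule `qL` of `L`. -/
def qSub (L : QLattice M) : Submodule A0 L where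
  carrier := {x | ∃ y : L, q0 • y = x}
  zero_mem' := ⟨0, smul_zero _⟩
  add_mem' := by
    rintro _ _ ⟨y, rfl⟩ ⟨z, rfl⟩
    exact ⟨y + z, smul_add _ _ _⟩
  smul_mem' := by
    rintro c _ ⟨y, rfl⟩
    exact ⟨c • y, smul_comm _ _ _⟩

/-- The crystal limit `L / qL`. -/
abbrev CrystalLimit (L : QLattice M) : Type _ := L ⧸ qSub L

/-- The `ℚ`-vector space structure on `L / qL`, through `ℚ ⊆ A₀`. -/
instance (L : QLattice M) : Module ℚ (CrystalLimit L) :=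
  Module.compHom _ (algebraMap ℚ A0)

/-- The class in `L / qL` of an element of `L`. -/
abbrev toLimit (L : QLattice M) : L →ₗ[A0] CrystalLimit L := (qSub L).mkQ

/-- The operator on `L / qL` induced by an operator `T` on `M` that preserves `L`. -/
def limitMap (L : QLattice M) (T : M →ₗ[K] M) (hT : ∀ x ∈ L, T x ∈ L) :
    CrystalLimit L →ₗ[A0] CrystalLimit L :=
  (qSub L).mapQ (qSub L) ((T.restrictScalars A0).restrict hT) (by
    rintro _ ⟨y, rfl⟩
    exact ⟨(T.restrictScalars A0).restrict hT y, by simp⟩)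

variable {D : BorcherdsCartanDatum I Pv} (ρ : Rep D M)

/-- `L_μ = L ∩ M_μ`. -/
def latticeWeight (L : QLattice M) (μ : Module.Dual ℤ Pv) : QLattice M :=
  L ⊓ (weightSpace ρ μ).restrictScalars A0

/-- Crystal lattices (of a module in `O_int`). -/
structure IsCrystalLattice (L : QLattice M) : Prop where
  free : Module.Free A0 L
  span : Submodule.span K (L : Set M) = ⊤
  weight : IsDirectSum L (latticeWeight ρ L)
  kashE_mem : ∀ i, ∀ x ∈ L, kashE ρ i x ∈ L
  kashF_mem : ∀ i, ∀ x ∈ L, kashF ρ i x ∈ L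

variable {ρ} {L : QLattice M} (hL : IsCrystalLattice ρ L)

/-- The operator `ẽ_i` on `L / qL`. -/
def limE (i : I) : CrystalLimit L →ₗ[A0] CrystalLimit L :=
  limitMap L (kashE ρ i) (hL.kashE_mem i)

/-- The operator `f̃_i` on `L / qL`. -/
def limF (i : I) : CrystalLimit L →ₗ[A0] CrystalLimit L :=
  limitMap L (kashF ρ i) (hL.kashF_mem i)

variable (ρ L) in
/-- `L_μ / q L_μ` as a subspace of `L / qL`. -/
def limitWeight (μ : Module.Dual ℤ Pv) : Submodule A0 (CrystalLimit L) :=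
  ((latticeWeight ρ L μ).comap L.subtype).map (toLimit L)

variable (ρ) in
/-- `(L, B)` is a crystal basis (of a module in `O_int`). -/
structure IsCrystalBasis (L : QLattice M) (B : Set (CrystalLimit L)) : Prop where
  lattice : IsCrystalLattice ρ L
  linearIndependent : LinearIndependent ℚ (Subtype.val : B → CrystalLimit L)
  span : Submodule.span ℚ B = ⊤
  weight : ∀ b ∈ B, ∃! μ, b ∈ limitWeight ρ L μ
  limE_mem : ∀ i, ∀ b ∈ B, limE lattice i b ∈ B ∪ {0}
  limF_mem : ∀ i, ∀ b ∈ B, limF lattice i b ∈ B ∪ {0}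
  limF_iff : ∀ i, ∀ b ∈ B, ∀ b' ∈ B, limF lattice i b = b' ↔ b = limE lattice i b'

/-- `ε_i(b) = max {l ≥ 0 ∣ ẽ_i^l b ∈ B}`. -/
def eps (i : I) (B : Set (CrystalLimit L)) (b : CrystalLimit L) : ℕ∞ :=
  ⨆ l ∈ {l : ℕ | (limE hL i ^ l) b ∈ B}, (l : ℕ∞)

/-- `φ_i(b) = max {l ≥ 0 ∣ f̃_i^l b ∈ B}`, which may be `∞`. -/
def phi (i : I) (B : Set (CrystalLimit L)) (b : CrystalLimit L) : ℕ∞ :=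
  ⨆ l ∈ {l : ℕ | (limF hL i ^ l) b ∈ B}, (l : ℕ∞)

end crystal

/-! ### Tensor products -/

section tensor
variable {M₁ M₂ : Type*} [AddCommGroup M₁] [Module K M₁] [AddCommGroup M₂] [Module K M₂]

/-- The `U_q(𝔤)`-module `M₁ ⊗ M₂`, through the comultiplication. -/
def tensorRep {D : BorcherdsCartanDatum I Pv} (ρ₁ : Rep D M₁) (ρ₂ : Rep D M₂) :
    Rep D (M₁ ⊗[K] M₂) :=
  ((Module.endTensorEndAlgHom (R := K) (S := K) (A := K) (M := M₁) (N := M₂)).comp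
    (Algebra.TensorProduct.map ρ₁ ρ₂)).comp (comul D)

/-- The bilinear map on quotients induced by a bilinear map `β`. -/
def bilinLift {R U V W : Type*} [CommRing R] [AddCommGroup U] [Module R U] [AddCommGroup V]
    [Module R V] [AddCommGroup W] [Module R W] (p : Submodule R U) (r : Submodule R V)
    (t : Submodule R W) (β : U →ₗ[R] V →ₗ[R] W) (hp : ∀ x ∈ p, ∀ y, β x y ∈ t)
    (hr : ∀ x, ∀ y ∈ r, β x y ∈ t) : (U ⧸ p) →ₗ[R] (V ⧸ r) →ₗ[R] (W ⧸ t) :=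
  p.liftQ
    (LinearMap.flip (r.liftQ (LinearMap.flip (β.compr₂ t.mkQ)) fun y hy =>
      LinearMap.mem_ker.mpr (LinearMap.ext fun x =>
        (Submodule.Quotient.mk_eq_zero t).mpr (hr x y hy))))
    fun x hx => LinearMap.mem_ker.mpr (LinearMap.ext fun y => by
      obtain ⟨y, rfl⟩ := Submodule.mkQ_surjective _ y
      exact (Submodule.Quotient.mk_eq_zero t).mpr (hp x hx y))

/-- The lattice `L₁ ⊗_{A₀} L₂` in `M₁ ⊗ M₂`. -/
def tensorLattice (L₁ : QLattice M₁) (L₂ : QLattice M₂) : QLattice (M₁ ⊗[K] M₂) :=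
  Submodule.span A0 (Set.image2 (fun x y => x ⊗ₜ[K] y) (L₁ : Set M₁) (L₂ : Set M₂))

/-- The bilinear map `L₁ × L₂ → L₁ ⊗ L₂`. -/
def latticeTmul (L₁ : QLattice M₁) (L₂ : QLattice M₂) :
    L₁ →ₗ[A0] L₂ →ₗ[A0] tensorLattice L₁ L₂ :=
  LinearMap.mk₂ A0
    (fun x y => ⟨(x : M₁) ⊗ₜ[K] (y : M₂), Submodule.subset_span ⟨x, x.2, y, y.2, rfl⟩⟩)
    (fun _ _ _ => Subtype.ext (TensorProduct.add_tmul _ _ _))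
    (fun c x y => Subtype.ext (TensorProduct.smul_tmul' (algebraMap A0 K c) (x : M₁) (y : M₂)).symm)
    (fun _ _ _ => Subtype.ext (TensorProduct.tmul_add _ _ _))
    (fun c x y => Subtype.ext (TensorProduct.tmul_smul (algebraMap A0 K c) (x : M₁) (y : M₂)))

/-- The induced bilinear map `(b₁, b₂) ↦ b₁ ⊗ b₂` from `L₁ / qL₁ × L₂ / qL₂` to
`(L₁ ⊗ L₂) / q(L₁ ⊗ L₂)`. -/
def limitTmul (L₁ : QLattice M₁) (L₂ : QLattice M₂) :
    CrystalLimit L₁ →ₗ[A0] CrystalLimit L₂ →ₗ[A0] CrystalLimit (tensorLattice L₁ L₂) :=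
  bilinLift (qSub L₁) (qSub L₂) (qSub (tensorLattice L₁ L₂)) (latticeTmul L₁ L₂)
    (by
      rintro _ ⟨x, rfl⟩ y
      exact ⟨latticeTmul L₁ L₂ x y, by rw [map_smul, LinearMap.smul_apply]⟩)
    (by
      rintro x _ ⟨y, rfl⟩
      exact ⟨latticeTmul L₁ L₂ x y, by rw [map_smul]⟩)

theorem limitTmul_mk (L₁ : QLattice M₁) (L₂ : QLattice M₂) (x : L₁) (y : L₂) :
    limitTmul L₁ L₂ (toLimit L₁ x) (toLimit L₂ y) = toLimit _ (latticeTmul L₁ L₂ x y) := rfl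

/-- `B₁ ⊗ B₂ = {b₁ ⊗ b₂ ∣ b₁ ∈ B₁, b₂ ∈ B₂}`. -/
def tensorBasis {L₁ : QLattice M₁} {L₂ : QLattice M₂} (B₁ : Set (CrystalLimit L₁))
    (B₂ : Set (CrystalLimit L₂)) : Set (CrystalLimit (tensorLattice L₁ L₂)) :=
  Set.image2 (fun b₁ b₂ => limitTmul L₁ L₂ b₁ b₂) B₁ B₂

end tensor

end QGKM

end

open scoped TensorProduct

noncomputable section

namespace QGKM

/-! ### The local ring `A₀` -/

/-! The statement concerns one index `i` at a time. Under `e_i` and `f_i` a module of `O_int` splits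
into strings `f_i^{(n)} u` with `e_i u = 0`. A crystal lattice is spanned over `A₀` by the string
members whose primitive vector it contains (`IsCrystalLattice.eq_span_stringSet`), and each element
of a crystal basis is the class of a single such member (`IsCrystalBasis.exists_stringClass`); its
`ε_i` is its position in the string and its `φ_i` the number of steps left. Everything thus reduces
to the tensor product of two strings, with primitive vectors `u`, `v` whose weights at `h_i` are
`m`, `n`.

There the primitive vector `w_p` of level `p` is explicit, and `w_p ≡ u ⊗ f^{(p)} v` modulo `q`. If
`i` is imaginary and `m > 0`, the power of `q_i` by which `K_i` acts on the first factor vanishes at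
`q = 0`, so that `f_i` moves only the first factor: `f^k w_p ≡ f^k u ⊗ f^p v` (`stringCoef_imag`).
If `m = 0`, then `f_i u = 0` and `f_i` moves only the second factor.

If `i` is real, the recursion for the coefficients of `f^{(k)} w_p` has poles at `q = 0`. It is
controlled by a bilinear form for which `f_i` is adjoint to a power of `q_i` times `e_i`. The norm
of `f^{(k)} w_p` has value `1` at `q = 0` (`stringCoef_norm`) and is a sum of squares with weights
of value `1`. A sum of rational squares is anisotropic, so the coefficients are regular
(`mem_A0sub_of_sum_sq`), and as soon as one of them has value `1` all others vanish at `q = 0`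
(`hasVal_of_sum_sq`). Following a single leading coefficient then gives `stringCoef_real`.

This determines `ẽ_i` and `f̃_i` on vectors congruent modulo `q` to the products `f^{(a)} u ⊗
f^{(b)} v`. Nakayama's lemma, applied to the finitely many products of one level, carries the result
over to the products themselves without presupposing a stable lattice (`apply_sub_mem_qMul`,
`kash_strTensor`). Stability of `L₁ ⊗ L₂` and the tensor product rule both follow, and the remaining
axioms are formal. -/

/-- `x ∈ A₀` takes the value `r` at `q = 0`. -/
def HasVal (x : K) (r : ℚ) : Prop :=
  ∃ f g : Polynomial ℚ, g.eval 0 ≠ 0 ∧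
    x = algebraMap (Polynomial ℚ) K f / algebraMap (Polynomial ℚ) K g ∧
    r = f.eval 0 / g.eval 0

theorem algebraMap_poly_ne_zero {p : Polynomial ℚ} (hp : p.eval 0 ≠ 0) :
    algebraMap (Polynomial ℚ) K p ≠ 0 := by
  intro h
  rw [map_eq_zero_iff _ (RatFunc.algebraMap_injective ℚ)] at h
  exact hp (by rw [h, Polynomial.eval_zero])

theorem HasVal.unique {x : K} {r s : ℚ} (h : HasVal x r) (h' : HasVal x s) : r = s := by
  obtain ⟨f, g, hg, rfl, rfl⟩ := h
  obtain ⟨f', g', hg', e, rfl⟩ := h'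
  rw [div_eq_div_iff (algebraMap_poly_ne_zero hg) (algebraMap_poly_ne_zero hg'), ← map_mul,
    ← map_mul] at e
  have := congrArg (Polynomial.eval 0) (RatFunc.algebraMap_injective ℚ e)
  rw [Polynomial.eval_mul, Polynomial.eval_mul] at this
  rwa [div_eq_div_iff hg hg']

theorem HasVal.add {x y : K} {r s : ℚ} (h : HasVal x r) (h' : HasVal y s) :
    HasVal (x + y) (r + s) := by
  obtain ⟨f, g, hg, rfl, rfl⟩ := h
  obtain ⟨f', g', hg', rfl, rfl⟩ := h'
  refine ⟨f * g' + g * f', g * g', ?_, ?_, ?_⟩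
  · rw [Polynomial.eval_mul]; exact mul_ne_zero hg hg'
  · rw [map_add, map_mul, map_mul, map_mul,
      div_add_div _ _ (algebraMap_poly_ne_zero hg) (algebraMap_poly_ne_zero hg')]
  · rw [Polynomial.eval_add, Polynomial.eval_mul, Polynomial.eval_mul, Polynomial.eval_mul,
      div_add_div _ _ hg hg']

theorem HasVal.mul {x y : K} {r s : ℚ} (h : HasVal x r) (h' : HasVal y s) :
    HasVal (x * y) (r * s) := by
  obtain ⟨f, g, hg, rfl, rfl⟩ := h
  obtain ⟨f', g', hg', rfl, rfl⟩ := h'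
  refine ⟨f * f', g * g', ?_, ?_, ?_⟩
  · rw [Polynomial.eval_mul]; exact mul_ne_zero hg hg'
  · rw [map_mul, map_mul, div_mul_div_comm]
  · rw [Polynomial.eval_mul, Polynomial.eval_mul, div_mul_div_comm]

theorem hasVal_algebraMap (p : Polynomial ℚ) :
    HasVal (algebraMap (Polynomial ℚ) K p) (p.eval 0) :=
  ⟨p, 1, by simp, by simp, by simp⟩

theorem hasVal_zero : HasVal 0 0 := by simpa using hasVal_algebraMap 0

theorem hasVal_one : HasVal 1 1 := by simpa using hasVal_algebraMap 1

theorem hasVal_q : HasVal q 0 := by simpa [q] using hasVal_algebraMap Polynomial.X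

theorem hasVal_rat (r : ℚ) : HasVal (algebraMap ℚ K r) r := by
  have := hasVal_algebraMap (Polynomial.C r)
  rw [Polynomial.eval_C] at this
  rwa [IsScalarTower.algebraMap_apply ℚ (Polynomial ℚ) K r]

theorem HasVal.neg {x : K} {r : ℚ} (h : HasVal x r) : HasVal (-x) (-r) := by
  simpa using (hasVal_rat (-1)).mul h

theorem HasVal.sub {x y : K} {r s : ℚ} (h : HasVal x r) (h' : HasVal y s) :
    HasVal (x - y) (r - s) := by
  simpa [sub_eq_add_neg] using h.add h'.neg

theorem HasVal.inv {x : K} {r : ℚ} (h : HasVal x r) (hr : r ≠ 0) : HasVal x⁻¹ r⁻¹ := by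
  obtain ⟨f, g, hg, rfl, rfl⟩ := h
  exact ⟨g, f, fun h0 => hr (by rw [h0, zero_div]), by rw [inv_div], by rw [inv_div]⟩

theorem HasVal.ne_zero {x : K} {r : ℚ} (h : HasVal x r) (hr : r ≠ 0) : x ≠ 0 := by
  rintro rfl
  exact hr (h.unique hasVal_zero)

theorem HasVal.div {x y : K} {r s : ℚ} (h : HasVal x r) (h' : HasVal y s) (hs : s ≠ 0) :
    HasVal (x / y) (r / s) := by
  simpa [div_eq_mul_inv] using h.mul (h'.inv hs)

theorem HasVal.pow {x : K} {r : ℚ} (h : HasVal x r) (n : ℕ) : HasVal (x ^ n) (r ^ n) := by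
  induction n with
  | zero => simpa using hasVal_one
  | succ n ih => rw [pow_succ, pow_succ]; exact ih.mul h

theorem HasVal.sum {ι : Type*} (s : Finset ι) {x : ι → K} {r : ι → ℚ}
    (h : ∀ i ∈ s, HasVal (x i) (r i)) : HasVal (∑ i ∈ s, x i) (∑ i ∈ s, r i) := by
  classical
  induction s using Finset.induction_on with
  | empty => simpa using hasVal_zero
  | insert a s ha ih =>
    rw [Finset.sum_insert ha, Finset.sum_insert ha]
    exact (h a (Finset.mem_insert_self _ _)).add
      (ih fun i hi => h i (Finset.mem_insert_of_mem hi))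

theorem HasVal.of_eq {x : K} {r s : ℚ} (h : HasVal x r) (e : r = s) : HasVal x s := e ▸ h

theorem mem_A0sub_iff {x : K} : x ∈ A0sub ↔ ∃ r, HasVal x r :=
  ⟨fun ⟨f, g, hg, e⟩ => ⟨_, f, g, hg, e, rfl⟩, fun ⟨_, f, g, hg, e, _⟩ => ⟨f, g, hg, e⟩⟩

theorem HasVal.mem {x : K} {r : ℚ} (h : HasVal x r) : x ∈ A0sub := mem_A0sub_iff.mpr ⟨r, h⟩

/-- An element vanishing at `0` is divisible by `q`. -/
theorem HasVal.exists_q_mul {x : K} (h : HasVal x 0) : ∃ y ∈ A0sub, x = q * y := by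
  obtain ⟨f, g, hg, rfl, e⟩ := h
  have hf : f.eval 0 = 0 := by
    rcases div_eq_zero_iff.mp e.symm with h | h
    · exact h
    · exact absurd h hg
  obtain ⟨f', rfl⟩ : Polynomial.X ∣ f :=
    Polynomial.X_dvd_iff.mpr (by rwa [Polynomial.coeff_zero_eq_eval_zero])
  exact ⟨_, ⟨f', g, hg, rfl⟩, by rw [map_mul, RatFunc.algebraMap_X, mul_div_assoc]; rfl⟩

/-- Every rational function becomes regular at `0` after multiplication by a power of `q`. -/
theorem exists_q_pow_mul_mem (x : K) : ∃ n : ℕ, q ^ n * x ∈ A0sub := by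
  induction x using RatFunc.induction_on with
  | f f g hg =>
    obtain ⟨n, g', e, hg'⟩ : ∃ (n : ℕ) (g' : Polynomial ℚ), g = Polynomial.X ^ n * g' ∧
        g'.eval 0 ≠ 0 := by
      obtain ⟨g', e, h⟩ := Polynomial.exists_eq_pow_rootMultiplicity_mul_and_not_dvd g hg 0
      rw [Polynomial.dvd_iff_isRoot] at h
      exact ⟨_, g', by simpa using e, h⟩
    refine ⟨n, f, g', hg', ?_⟩
    have h1 : (RatFunc.X : K) ^ n ≠ 0 := pow_ne_zero _ RatFunc.X_ne_zero
    rw [e, map_mul, map_pow, RatFunc.algebraMap_X, q]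
    field_simp

/-- A sum of squares with weights close to `1` detects poles at `0`. -/
theorem mem_A0sub_of_sum_sq {ι : Type*} (s : Finset ι) (N c : ι → K)
    (hN : ∀ i ∈ s, HasVal (N i) 1) (h : ∑ i ∈ s, N i * c i ^ 2 ∈ A0sub) :
    ∀ i ∈ s, c i ∈ A0sub := by
  classical
  -- One power of `q` clears the poles of all `c i`; the least such exponent is shown to be `0`.
  have ex : ∃ n : ℕ, ∀ i ∈ s, q ^ n * c i ∈ A0sub := by
    choose n hn using fun i => exists_q_pow_mul_mem (c i)
    refine ⟨∑ i ∈ s, n i, fun i hi => ?_⟩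
    rw [← Finset.sum_erase_add _ _ hi, pow_add, mul_assoc]
    exact A0sub.mul_mem (A0sub.pow_mem hasVal_q.mem _) (hn i)
  have hmin := @Nat.find_min _ _ ex
  have hspec := Nat.find_spec ex
  rcases hn : Nat.find ex with _ | n
  · rw [hn] at hspec
    simpa using hspec
  · exfalso
    rw [hn] at hspec hmin
    refine hmin (Nat.lt_succ_self n) fun i hi => ?_
    have hr : ∀ j, ∃ r, j ∈ s → HasVal (q ^ (n + 1) * c j) r := fun j => by
      by_cases hj : j ∈ s
      · obtain ⟨r, h⟩ := mem_A0sub_iff.mp (hspec j hj); exact ⟨r, fun _ => h⟩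
      · exact ⟨0, fun h => absurd h hj⟩
    choose r hr using hr
    have h1 : HasVal (∑ j ∈ s, N j * (q ^ (n + 1) * c j) ^ 2) (∑ j ∈ s, 1 * r j ^ 2) :=
      HasVal.sum s fun j hj => (hN j hj).mul ((hr j hj).pow 2)
    obtain ⟨v, hv⟩ := mem_A0sub_iff.mp h
    -- The positive power of `q` makes the regular sum vanish at `0`. Hence the squares of the
    -- rational values `r j` add up to `0`, each `r j` is `0`, and one factor `q` can be removed,
    -- against minimality.
    have h2 : HasVal (∑ j ∈ s, N j * (q ^ (n + 1) * c j) ^ 2) 0 := by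
      have := ((hasVal_q.pow (n + 1)).pow 2).mul hv
      rw [Finset.mul_sum] at this
      refine (this.of_eq (by simp) : HasVal _ 0) |> fun h => ?_
      convert h using 1
      exact Finset.sum_congr rfl fun j _ => by ring
    have h3 := h1.unique h2
    rw [Finset.sum_eq_zero_iff_of_nonneg fun j _ => by positivity] at h3
    have h4 : r i = 0 := by simpa using h3 i hi
    have h5 := hr i hi
    rw [h4] at h5
    obtain ⟨y, hy, e⟩ := h5.exists_q_mul
    rw [pow_succ', mul_assoc] at e
    rwa [mul_left_cancel₀ q_ne_zero e]

theorem A0_algebraMap_injective : Function.Injective (algebraMap A0 K) := Subtype.val_injective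

instance : IsDomain A0 := inferInstanceAs (IsDomain A0sub)

theorem A0_algebraMap_q0 : algebraMap A0 K q0 = q := rfl

theorem exists_algebraMap_eq {x : K} (hx : x ∈ A0sub) : ∃ a : A0, algebraMap A0 K a = x :=
  ⟨(⟨x, hx⟩ : A0sub), rfl⟩

theorem A0_exists_hasVal (x : A0) : ∃ r, HasVal (algebraMap A0 K x) r :=
  mem_A0sub_iff.mp (show A0sub from x).2

/-- Evaluation at `q = 0`. -/
def ev0 : A0 →+* ℚ where
  toFun x := (A0_exists_hasVal x).choose
  map_one' := (A0_exists_hasVal 1).choose_spec.unique (by rw [map_one]; exact hasVal_one)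
  map_zero' := (A0_exists_hasVal 0).choose_spec.unique (by rw [map_zero]; exact hasVal_zero)
  map_add' x y := (A0_exists_hasVal (x + y)).choose_spec.unique (by
    rw [map_add]; exact (A0_exists_hasVal x).choose_spec.add (A0_exists_hasVal y).choose_spec)
  map_mul' x y := (A0_exists_hasVal (x * y)).choose_spec.unique (by
    rw [map_mul]; exact (A0_exists_hasVal x).choose_spec.mul (A0_exists_hasVal y).choose_spec)

theorem hasVal_ev0 (x : A0) : HasVal (algebraMap A0 K x) (ev0 x) :=
  (A0_exists_hasVal x).choose_spec

theorem ev0_eq {x : A0} {r : ℚ} (h : HasVal (algebraMap A0 K x) r) : ev0 x = r :=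
  (hasVal_ev0 x).unique h

theorem ev0_q0 : ev0 q0 = 0 := ev0_eq hasVal_q

theorem algebraMap_rat_A0 (r : ℚ) : algebraMap A0 K (algebraMap ℚ A0 r) = algebraMap ℚ K r := rfl

theorem ev0_algebraMap (r : ℚ) : ev0 (algebraMap ℚ A0 r) = r :=
  ev0_eq (by rw [algebraMap_rat_A0]; exact hasVal_rat r)

theorem isUnit_of_ev0_ne_zero {x : A0} (h : ev0 x ≠ 0) : IsUnit x := by
  have h1 := (hasVal_ev0 x).inv h
  obtain ⟨y, hy⟩ := exists_algebraMap_eq h1.mem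
  refine IsUnit.of_mul_eq_one y (A0_algebraMap_injective ?_)
  rw [map_mul, hy, map_one, mul_inv_cancel₀ ((hasVal_ev0 x).ne_zero h)]

theorem ev0_eq_zero_iff {x : A0} : ev0 x = 0 ↔ ∃ y, x = q0 * y := by
  constructor
  · intro h
    have h1 := hasVal_ev0 x
    rw [h] at h1
    obtain ⟨y, hy, e⟩ := h1.exists_q_mul
    obtain ⟨y, rfl⟩ := exists_algebraMap_eq hy
    exact ⟨y, A0_algebraMap_injective (by rw [e, map_mul, A0_algebraMap_q0])⟩
  · rintro ⟨y, rfl⟩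
    rw [map_mul, ev0_q0, zero_mul]

/-- Elements `1 + q y` have value `1` at `0` and are therefore units. This is the input for
Nakayama's lemma. -/
theorem q0_span_le_jacobson : Ideal.span {q0} ≤ Ideal.jacobson (⊥ : Ideal A0) := by
  rw [Ideal.span_singleton_le_iff_mem, Ideal.mem_jacobson_bot]
  exact fun y => isUnit_of_ev0_ne_zero (by simp [ev0_q0])

theorem exists_eq_add_q0_mul (x : A0) : ∃ y, x = algebraMap ℚ A0 (ev0 x) + q0 * y := by
  obtain ⟨y, hy⟩ := ev0_eq_zero_iff.mp
    (show ev0 (x - algebraMap ℚ A0 (ev0 x)) = 0 by rw [map_sub, ev0_algebraMap, sub_self])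
  exact ⟨y, by rw [← hy]; ring⟩

/-- Allows linear independence to pass between `A₀` and `ℚ(q)`. -/
instance : IsFractionRing A0 K where
  map_units y := by
    exact isUnit_iff_ne_zero.mpr fun h => nonZeroDivisors.ne_zero y.2
      (A0_algebraMap_injective (by rw [h, map_zero]))
  surj z := by
    obtain ⟨n, hn⟩ := exists_q_pow_mul_mem z
    obtain ⟨a, ha⟩ := exists_algebraMap_eq hn
    have h0 : q0 ^ n ≠ 0 := pow_ne_zero _ fun h => q_ne_zero (by
      rw [← A0_algebraMap_q0, h, map_zero])
    exact ⟨(a, ⟨q0 ^ n, mem_nonZeroDivisors_of_ne_zero h0⟩), by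
      simp only [map_pow, A0_algebraMap_q0, ha]; ring⟩
  exists_of_eq {x y} h := ⟨1, by rw [A0_algebraMap_injective h]⟩

/-! ### Lattices modulo `q` and Nakayama's lemma -/

section modules
variable {M : Type*} [AddCommGroup M] [Module K M]

theorem A0_smul_def (c : A0) (v : M) : c • v = algebraMap A0 K c • v :=
  (algebraMap_smul K c v).symm

theorem q0_smul_def (v : M) : q0 • v = q • v := A0_smul_def q0 v

theorem smul_mem_of_mem_A0sub {c : K} (hc : c ∈ A0sub) (L : QLattice M) {v : M} (hv : v ∈ L) :
    c • v ∈ L := by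
  obtain ⟨a, rfl⟩ := exists_algebraMap_eq hc
  rw [← A0_smul_def]
  exact L.smul_mem a hv

/-- `qL` as a submodule of the ambient space. -/
def qMul (L : QLattice M) : QLattice M where
  carrier := {x | ∃ y ∈ L, x = q • y}
  zero_mem' := ⟨0, L.zero_mem, by simp⟩
  add_mem' := by
    rintro _ _ ⟨y, hy, rfl⟩ ⟨z, hz, rfl⟩
    exact ⟨y + z, L.add_mem hy hz, by rw [smul_add]⟩
  smul_mem' := by
    rintro c _ ⟨y, hy, rfl⟩
    exact ⟨c • y, L.smul_mem c hy, by
      rw [A0_smul_def, A0_smul_def, smul_smul, smul_smul, mul_comm]⟩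

theorem qMul_le (L : QLattice M) : qMul L ≤ L := by
  rintro _ ⟨y, hy, rfl⟩
  exact smul_mem_of_mem_A0sub hasVal_q.mem L hy

theorem qMul_mono {L L' : QLattice M} (h : L ≤ L') : qMul L ≤ qMul L' := by
  rintro _ ⟨y, hy, rfl⟩
  exact ⟨y, h hy, rfl⟩

theorem HasVal.smul_mem_qMul {c : K} (hc : HasVal c 0) {L : QLattice M} {v : M} (hv : v ∈ L) :
    c • v ∈ qMul L := by
  obtain ⟨y, hy, rfl⟩ := hc.exists_q_mul
  exact ⟨y • v, smul_mem_of_mem_A0sub hy L hv, by rw [smul_smul]⟩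

theorem mem_qSub_iff {L : QLattice M} {x : L} : x ∈ qSub L ↔ (x : M) ∈ qMul L := by
  constructor
  · rintro ⟨y, rfl⟩
    exact ⟨y, y.2, by rw [← q0_smul_def]; rfl⟩
  · rintro ⟨y, hy, e⟩
    exact ⟨⟨y, hy⟩, Subtype.ext (by rw [e, ← q0_smul_def]; rfl)⟩

theorem qMul_le_smul (L : QLattice M) : qMul L ≤ Ideal.span {q0} • L := by
  rintro _ ⟨y, hy, rfl⟩
  rw [← q0_smul_def]
  exact Submodule.smul_mem_smul (Ideal.mem_span_singleton_self _) hy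

/-- Nakayama's lemma for the local ring `A₀`. -/
theorem le_of_le_sup_qMul {W X : QLattice M} (hW : W.FG) (h : W ≤ X ⊔ qMul W) : W ≤ X :=
  Submodule.le_of_le_smul_of_le_jacobson_bot hW q0_span_le_jacobson
    (h.trans (sup_le_sup_left (qMul_le_smul W) X))

/-- If finitely many vectors `z j` are congruent modulo `q` to vectors `x j`, and an operator
maps `x j` to `z' j` modulo `q`, then it also maps `z j` to `z' j` modulo `q`. -/
theorem apply_sub_mem_qMul {S : Type*} [Finite S] (z x z' : S → M) (T : M →ₗ[K] M)
    (W' : QLattice M) (hz' : ∀ j, z' j ∈ W')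
    (hx : ∀ j, x j - z j ∈ qMul (Submodule.span A0 (Set.range z)))
    (hT : ∀ j, T (x j) - z' j ∈ qMul W') (j : S) : T (z j) - z' j ∈ qMul W' := by
  set W := Submodule.span A0 (Set.range z) with hWdef
  set X := Submodule.span A0 (Set.range x) with hXdef
  -- The `x j` generate `W` modulo `qW`, so Nakayama's lemma puts `W` inside their span `X`. On `X`
  -- the operator is under control, whereas on `W` nothing is known yet.
  have hWX : W ≤ X := by
    refine le_of_le_sup_qMul (Submodule.fg_span (Set.finite_range z)) ?_
    rw [hWdef, Submodule.span_le]
    rintro _ ⟨j, rfl⟩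
    have : z j = x j - (x j - z j) := by abel
    rw [SetLike.mem_coe, this]
    exact Submodule.sub_mem _ (Submodule.mem_sup_left (Submodule.subset_span ⟨j, rfl⟩))
      (Submodule.mem_sup_right (hx j))
  have hTX : X ≤ W'.comap (T.restrictScalars A0) := by
    rw [hXdef, Submodule.span_le]
    rintro _ ⟨j, rfl⟩
    have : T (x j) = (T (x j) - z' j) + z' j := by abel
    change T (x j) ∈ W'
    rw [this]
    exact W'.add_mem (qMul_le _ (hT j)) (hz' j)
  -- The error `x j - z j` is `q • y` with `y ∈ W ≤ X`, and `T` maps `X` into `W'`; so `T` maps the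
  -- error into `qW'`.
  obtain ⟨y, hy, e⟩ := hx j
  have h1 : T (z j) - z' j = (T (x j) - z' j) - q • T y := by
    rw [← map_smul, ← e, map_sub]; abel
  rw [h1]
  exact Submodule.sub_mem _ (hT j) ⟨T y, hTX (hWX hy), rfl⟩

end modules

/-! ### Quantum integers for integral arguments -/

/-- `[k]_t` for an integer `k`. -/
def zInt (t : K) (k : ℤ) : K := (t ^ k - t ^ (-k)) / (t - t⁻¹)

theorem zInt_natCast (t : K) (n : ℕ) : zInt t n = qInt t n := by
  simp [zInt, qInt, zpow_neg]

theorem zInt_zero (t : K) : zInt t 0 = 0 := by simp [zInt]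

theorem zInt_neg (t : K) (k : ℤ) : zInt t (-k) = -zInt t k := by
  rw [zInt, zInt, neg_neg, ← neg_div, neg_sub]

theorem Generic.sub_inv_ne {t : K} (ht : Generic t) : t - t⁻¹ ≠ 0 := by
  simpa using ht.sub_inv one_pos

theorem Generic.zInt_ne_zero {t : K} (ht : Generic t) {k : ℤ} (hk : k ≠ 0) : zInt t k ≠ 0 := by
  have pos : ∀ n : ℕ, 0 < n → zInt t n ≠ 0 := fun n hn => by
    rw [zInt_natCast]; exact ht.qInt_ne hn
  obtain ⟨n, rfl | rfl⟩ := k.eq_nat_or_neg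
  · exact pos n (by omega)
  · rw [zInt_neg]; exact neg_ne_zero.mpr (pos n (by omega))

/-- `[n] [m - n + 1] + [m - 2 n] = [n + 1] [m - n]`. -/
theorem Generic.zInt_mul_add {t : K} (ht : Generic t) (m n : ℤ) :
    zInt t n * zInt t (m - n + 1) + zInt t (m - 2 * n) = zInt t (n + 1) * zInt t (m - n) := by
  have h0 := ht.1
  have h1 := ht.sub_inv_ne
  have e : ∀ x y z w : K, x / (t - t⁻¹) * (y / (t - t⁻¹)) + z / (t - t⁻¹) =
      (x * y + z * (t - t⁻¹)) / ((t - t⁻¹) * (t - t⁻¹)) := by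
    intro x y z w; field_simp
  rw [zInt, zInt, zInt, zInt, zInt, e _ _ _ 0, div_mul_div_comm]
  congr 1
  have hn : t ^ n ≠ 0 := zpow_ne_zero _ h0
  have hm : t ^ m ≠ 0 := zpow_ne_zero _ h0
  simp only [zpow_neg, zpow_add₀ h0, zpow_sub₀ h0, zpow_one, two_mul]
  field_simp
  ring

/-- `[x + y] = t^y [x] + t^(-x) [y]`. -/
theorem Generic.zInt_add {t : K} (ht : Generic t) (x y : ℤ) :
    zInt t (x + y) = t ^ y * zInt t x + t ^ (-x) * zInt t y := by
  have h0 := ht.1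
  have hx : t ^ x ≠ 0 := zpow_ne_zero _ h0
  have hy : t ^ y ≠ 0 := zpow_ne_zero _ h0
  rw [zInt, zInt, zInt, mul_div_assoc', mul_div_assoc', ← add_div]
  congr 1
  simp only [zpow_neg, zpow_add₀ h0]
  field_simp
  ring

/-- `∑_{j < n} [m - a j]`. -/
def sumInt (t : K) (a m : ℤ) (n : ℕ) : K := ∑ j ∈ Finset.range n, zInt t (m - a * j)

theorem sumInt_succ (t : K) (a m : ℤ) (n : ℕ) :
    sumInt t a m (n + 1) = sumInt t a m n + zInt t (m - a * n) := Finset.sum_range_succ _ _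

/-- The sum telescopes by `zInt_mul_add`. This is the usual `sl₂` constant for `e f ^ n` on a
primitive vector. -/
theorem Generic.sumInt_two {t : K} (ht : Generic t) (m : ℤ) (n : ℕ) :
    sumInt t 2 m n = zInt t n * zInt t (m - n + 1) := by
  induction n with
  | zero => simp [sumInt, zInt_zero]
  | succ n ih =>
    rw [sumInt_succ, ih, ht.zInt_mul_add]
    push_cast
    rw [show m - (n + 1 : ℤ) + 1 = m - n by ring]

/-! ### Strings -/

section strings
variable {M : Type*} [AddCommGroup M] [Module K M]

/-- A string of weight spaces for a pair of operators `e`, `f` whose commutator acts by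
`[d + a k]` on the `k`-th space. -/
structure IsString (t : K) (a d : ℤ) (W : ℤ → Submodule K M) (e f : Module.End K M) : Prop where
  e_mem : ∀ k, ∀ v ∈ W k, e v ∈ W (k + 1)
  f_mem : ∀ k, ∀ v ∈ W k, f v ∈ W (k - 1)
  comm : ∀ k, ∀ v ∈ W k, e (f v) - f (e v) = zInt t (d + a * k) • v

namespace IsString
variable {t : K} {a d : ℤ} {W : ℤ → Submodule K M} {e f : Module.End K M}

/-- Exchanging `e` and `f` changes the sign of the commutator; reversing the grading and negating
`d` absorbs it. -/
theorem swap (h : IsString t a d W e f) : IsString t a (-d) (fun k => W (-k)) f e where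
  e_mem k v hv := by
    rw [show -(k + 1) = -k - 1 by ring]
    exact h.f_mem _ v hv
  f_mem k v hv := by
    rw [show -(k - 1) = -k + 1 by ring]
    exact h.e_mem _ v hv
  comm k v hv := by
    rw [← neg_sub, h.comm _ v hv, show d + a * -k = -(-d + a * k) by ring, zInt_neg, neg_smul,
      neg_neg]

theorem e_pow_mem (h : IsString t a d W e f) {k : ℤ} {v : M} (hv : v ∈ W k) (n : ℕ) :
    (e ^ n) v ∈ W (k + n) := by
  induction n with
  | zero => simpa using hv
  | succ n ih =>
    rw [pow_succ', Module.End.mul_apply]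
    have := h.e_mem _ _ ih
    rwa [add_assoc] at this

theorem f_pow_mem (h : IsString t a d W e f) {k : ℤ} {v : M} (hv : v ∈ W k) (n : ℕ) :
    (f ^ n) v ∈ W (k - n) := by
  induction n with
  | zero => simpa using hv
  | succ n ih =>
    rw [pow_succ', Module.End.mul_apply]
    have := h.f_mem _ _ ih
    rwa [show k - (n : ℤ) - 1 = k - (n + 1 : ℕ) by push_cast; ring] at this

/-- Moving `e` past each factor `f` contributes the eigenvalue of the commutator at one position;
together they form `sumInt`. -/
theorem e_f_pow (h : IsString t a d W e f) {k : ℤ} {w : M} (hw : w ∈ W k) (hew : e w = 0)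
    (n : ℕ) : e ((f ^ (n + 1)) w) = sumInt t a (d + a * k) (n + 1) • (f ^ n) w := by
  induction n with
  | zero =>
    have := h.comm k w hw
    rw [hew, map_zero, sub_zero] at this
    simpa [sumInt] using this
  | succ n ih =>
    have h1 := h.comm _ _ (h.f_pow_mem hw (n + 1))
    rw [ih, map_smul] at h1
    rw [pow_succ' f (n + 1), Module.End.mul_apply, sub_eq_iff_eq_add.mp h1,
      sumInt_succ t a _ (n + 1), add_smul, pow_succ' f n, Module.End.mul_apply, add_comm]
    congr 3
    push_cast; ring

theorem e_pow_f_pow (h : IsString t a d W e f) {k : ℤ} {w : M} (hw : w ∈ W k) (hew : e w = 0)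
    (n j : ℕ) : (e ^ n) ((f ^ (n + j)) w) =
      (∏ x ∈ Finset.range n, sumInt t a (d + a * k) (j + x + 1)) • (f ^ j) w := by
  induction n with
  | zero => simp
  | succ n ih =>
    rw [pow_succ, Module.End.mul_apply, show n + 1 + j = (n + j) + 1 by ring, h.e_f_pow hw hew,
      map_smul, ih, smul_smul, Finset.prod_range_succ, mul_comm, show n + j = j + n by ring]

/-- If the relevant structure constants do not vanish, then every `e`-nilpotent vector is a sum
of vectors `f ^ n w` with `e w = 0`. -/
theorem mem_iSup (h : IsString t a d W e f) (k : ℤ)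
    (hS : ∀ N : ℕ, ∀ v ∈ W k, e ((e ^ N) v) = 0 → (e ^ N) v ≠ 0 → ∀ n < N,
      sumInt t a (d + a * (k + N)) (n + 1) ≠ 0)
    (N : ℕ) : ∀ v ∈ W k, (e ^ N) v = 0 →
      v ∈ ⨆ n : ℕ, (LinearMap.ker e ⊓ W (k + n)).map (f ^ n) := by
  induction N with
  | zero =>
    intro v _ h0
    rw [show v = 0 by simpa using h0]
    exact Submodule.zero_mem _
  | succ N ih =>
    intro v hv h0
    rw [pow_succ', Module.End.mul_apply] at h0
    by_cases hw : (e ^ N) v = 0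
    · exact ih v hv hw
    · have hwk := h.e_pow_mem hv N
      have h1 := h.e_pow_f_pow hwk h0 N 0
      set c := ∏ x ∈ Finset.range N, sumInt t a (d + a * (k + N)) (0 + x + 1) with hc
      have hc0 : c ≠ 0 := Finset.prod_ne_zero_iff.mpr fun x hx => by
        rw [zero_add]
        exact hS N v hv h0 hw x (Finset.mem_range.mp hx)
      have hfm : (f ^ N) ((e ^ N) v) ∈ W k := by
        have := h.f_pow_mem hwk N
        rwa [add_sub_cancel_right] at this
      -- Subtracting this multiple of `f ^ N (e ^ N v)` leaves a vector killed already by `e ^ N`.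
      have h2 : v - c⁻¹ • (f ^ N) ((e ^ N) v) ∈
          ⨆ n : ℕ, (LinearMap.ker e ⊓ W (k + n)).map (f ^ n) := by
        refine ih _ (Submodule.sub_mem _ hv (Submodule.smul_mem _ _ hfm)) ?_
        rw [map_sub, map_smul]
        rw [add_zero, pow_zero, Module.End.one_apply] at h1
        rw [h1, smul_smul, inv_mul_cancel₀ hc0, one_smul, sub_self]
      have h3 : c⁻¹ • (f ^ N) ((e ^ N) v) ∈
          ⨆ n : ℕ, (LinearMap.ker e ⊓ W (k + n)).map (f ^ n) :=
        Submodule.smul_mem _ _ (Submodule.mem_iSup_of_mem N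
          (Submodule.mem_map_of_mem ⟨LinearMap.mem_ker.mpr h0, hwk⟩))
      simpa using Submodule.add_mem _ h2 h3

/-- In the `sl₂`-case a highest weight vector on which `f` is nilpotent has a natural number `m`
as weight, and is killed by `f ^ (m + 1)`. -/
theorem exists_weight (ht : Generic t) (h : IsString t 2 d W e f) {k : ℤ} {w : M} (hw : w ∈ W k)
    (hew : e w = 0) (hw0 : w ≠ 0) (hnil : ∃ n, (f ^ n) w = 0) :
    ∃ m : ℕ, d + 2 * k = m ∧ (f ^ (m + 1)) w = 0 := by
  classical
  have hmin := @Nat.find_min _ _ hnil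
  have hspec := Nat.find_spec hnil
  rcases hn : Nat.find hnil with _ | n
  · rw [hn] at hspec
    exact absurd (by simpa using hspec) hw0
  · rw [hn] at hspec hmin
    refine ⟨n, ?_, hspec⟩
    -- For the least `n` with `f ^ (n + 1) w = 0`, this says that `[n + 1] [d + 2 k - n]` kills the
    -- non-zero vector `f ^ n w`, so the weight is `n`.
    have h1 := h.e_f_pow hw hew n
    rw [hspec, map_zero, ht.sumInt_two] at h1
    rcases smul_eq_zero.mp h1.symm with h2 | h2
    · rcases mul_eq_zero.mp h2 with h3 | h3
      · exact absurd h3 (ht.zInt_ne_zero (by omega))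
      · by_contra hne
        refine ht.zInt_ne_zero (fun h4 => hne ?_) h3
        push_cast at h4
        linarith
    · exact absurd h2 (hmin (Nat.lt_succ_self n))

/-- From a weight `≥ 0` the vector `e ^ N v` has weight at least `2 N`, so no constant `[n + 1]
[weight - n]` with `n < N` is zero. -/
theorem mem_iSup_of_nonneg (ht : Generic t) (h : IsString t 2 d W e f) {k : ℤ}
    (hk : 0 ≤ d + 2 * k) {v : M} (hv : v ∈ W k) (hnil : ∃ n, (e ^ n) v = 0) :
    v ∈ ⨆ n : ℕ, (LinearMap.ker e ⊓ W (k + n)).map (f ^ n) := by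
  obtain ⟨N, hN⟩ := hnil
  refine h.mem_iSup k (fun N v _ _ _ n hn => ?_) N v hv hN
  rw [ht.sumInt_two]
  exact mul_ne_zero (ht.zInt_ne_zero (by omega)) (ht.zInt_ne_zero (by push_cast; omega))

/-- From a negative weight the constants might vanish. The vector is then first expressed through
lowest weight vectors, by the string with `e` and `f` exchanged, and each of those strings is reread
from its upper end. -/
theorem mem_iSup_of_nilpotent (ht : Generic t) (h : IsString t 2 d W e f)
    (he : ∀ k, ∀ v ∈ W k, ∃ n, (e ^ n) v = 0) (hf : ∀ k, ∀ v ∈ W k, ∃ n, (f ^ n) v = 0)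
    {k : ℤ} {v : M} (hv : v ∈ W k) :
    v ∈ ⨆ n : ℕ, (LinearMap.ker e ⊓ W (k + n)).map (f ^ n) := by
  by_cases hk : 0 ≤ d + 2 * k
  · exact h.mem_iSup_of_nonneg ht hk hv (he k v hv)
  · have h1 := h.swap.mem_iSup_of_nonneg ht (k := -k) (by omega) (by simpa using hv) (hf k v hv)
    refine iSup_le (a := ⨆ n : ℕ, (LinearMap.ker e ⊓ W (k + n)).map (f ^ n)) (fun n => ?_) h1
    rintro _ ⟨y, ⟨hy0, hy⟩, rfl⟩
    rw [SetLike.mem_coe, LinearMap.mem_ker] at hy0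
    by_cases hyz : y = 0
    · rw [hyz, map_zero]; exact Submodule.zero_mem _
    · obtain ⟨l, hl, hly⟩ := h.swap.exists_weight ht hy hy0 hyz (he _ y hy)
      by_cases hnl : n ≤ l
      · obtain ⟨j, rfl⟩ := Nat.exists_eq_add_of_le' hnl
        have h2 := h.swap.e_pow_f_pow hy hy0 j n
        set c := ∏ x ∈ Finset.range j, sumInt t 2 (-d + 2 * (-k + n)) (n + x + 1) with hc
        have hc0 : c ≠ 0 := Finset.prod_ne_zero_iff.mpr fun x hx => by
          have := Finset.mem_range.mp hx
          rw [ht.sumInt_two]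
          exact mul_ne_zero (ht.zInt_ne_zero (by omega)) (ht.zInt_ne_zero (by push_cast; omega))
        -- The lowest weight vector `y` has weight `-l` with `l = j + n`, so `e ^ l y` is primitive
        -- and `f ^ j` brings it back to a non-zero multiple of `e ^ n y`.
        have h3 : (e ^ n) y = c⁻¹ • (f ^ j) ((e ^ (j + n)) y) := by
          rw [h2, smul_smul, inv_mul_cancel₀ hc0, one_smul]
        rw [h3]
        refine Submodule.smul_mem _ _ (Submodule.mem_iSup_of_mem j (Submodule.mem_map_of_mem
          ⟨?_, ?_⟩))
        · rw [SetLike.mem_coe, LinearMap.mem_ker, ← Module.End.mul_apply, ← pow_succ']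
          exact hly
        · have := h.e_pow_mem (k := -(-k + n)) hy (j + n)
          rwa [show -(-k + (n : ℤ)) + (j + n : ℕ) = k + j by push_cast; ring] at this
      · have : (e ^ n) y = 0 := by
          obtain ⟨r, rfl⟩ : ∃ r, n = r + (l + 1) := ⟨n - (l + 1), by omega⟩
          rw [pow_add, Module.End.mul_apply, hly, map_zero]
        rw [this]; exact Submodule.zero_mem _

end IsString

end strings

/-! ### Weight spaces -/

section weights
variable {I Pv : Type*} [AddCommGroup Pv] {D : BorcherdsCartanDatum I Pv}
  {M : Type*} [AddCommGroup M] [Module K M] {ρ : Rep D M}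

theorem mem_weightSpace {μ : Module.Dual ℤ Pv} {v : M} :
    v ∈ weightSpace ρ μ ↔ ∀ x, ρ (uQ D x) v = q ^ (μ x) • v := by
  simp [weightSpace, Submodule.mem_iInf, sub_eq_zero]

theorem q_zpow_injective {k l : ℤ} (h : q ^ k = q ^ l) : k = l := by
  have key : ∀ n : ℕ, ∀ k : ℤ, q ^ (k + n) = q ^ k → n = 0 := fun n k h => by
    rw [zpow_add₀ q_ne_zero, mul_eq_left₀ (zpow_ne_zero _ q_ne_zero), zpow_natCast] at h
    by_contra hn
    exact q_pow_ne_one (Nat.pos_of_ne_zero hn) h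
  rcases le_total k l with hkl | hkl
  · obtain ⟨n, rfl⟩ := Int.le.dest hkl
    simp [key n k h.symm]
  · obtain ⟨n, rfl⟩ := Int.le.dest hkl
    simp [key n l h]

/-- Weight spaces lie in joint generalized eigenspaces of the commuting operators `q^h`. Distinct
weights give distinct eigenvalue functions because `q` is not a root of unity. -/
theorem weightSpace_indep (ρ : Rep D M) : iSupIndep (weightSpace ρ) := by
  have h1 := Module.End.independent_iInf_maxGenEigenspace_of_forall_mapsTo
    (fun x : Pv => ρ (uQ D x)) (fun x y φ => Module.End.mapsTo_maxGenEigenspace_of_comm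
      (by rw [commute_iff_eq, ← map_mul, ← map_mul, uQ_comm]) φ)
  have h2 := h1.comp (f := fun (μ : Module.Dual ℤ Pv) (x : Pv) => q ^ (μ x)) (by
    intro μ ν h
    exact LinearMap.ext fun x => q_zpow_injective (congrFun h x))
  refine h2.mono fun μ v hv => ?_
  rw [Function.comp_apply, Submodule.mem_iInf]
  intro x
  rw [Module.End.mem_maxGenEigenspace]
  exact ⟨1, by simp [mem_weightSpace.mp hv x]⟩

theorem uE_mem {μ : Module.Dual ℤ Pv} {v : M} (hv : v ∈ weightSpace ρ μ) (i : I) :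
    ρ (uE D i) v ∈ weightSpace ρ (μ + D.α i) := by
  rw [mem_weightSpace] at hv ⊢
  intro x
  rw [← Module.End.mul_apply, ← map_mul, uQ_uE, map_smul, map_mul, LinearMap.smul_apply,
    Module.End.mul_apply, hv, map_smul, smul_smul, ← zpow_add₀ q_ne_zero, LinearMap.add_apply,
    add_comm]

theorem uF_mem {μ : Module.Dual ℤ Pv} {v : M} (hv : v ∈ weightSpace ρ μ) (i : I) :
    ρ (uF D i) v ∈ weightSpace ρ (μ - D.α i) := by
  rw [mem_weightSpace] at hv ⊢
  intro x
  rw [← Module.End.mul_apply, ← map_mul, uQ_uF, map_smul, map_mul, LinearMap.smul_apply,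
    Module.End.mul_apply, hv, map_smul, smul_smul, ← zpow_add₀ q_ne_zero, LinearMap.sub_apply,
    add_comm, sub_eq_add_neg]

theorem uK_apply {μ : Module.Dual ℤ Pv} {v : M} (hv : v ∈ weightSpace ρ μ) (i : I) :
    ρ (uK D i) v = D.qi i ^ (μ (D.h i)) • v := by
  rw [uK, mem_weightSpace.mp hv, qi_zpow, map_nsmul, nsmul_eq_mul]

theorem uKinv_apply {μ : Module.Dual ℤ Pv} {v : M} (hv : v ∈ weightSpace ρ μ) (i : I) :
    ρ (uKinv D i) v = D.qi i ^ (-μ (D.h i)) • v := by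
  rw [uKinv, mem_weightSpace.mp hv, qi_zpow, map_neg, map_nsmul, nsmul_eq_mul, mul_neg]

theorem ef_comm_apply {μ : Module.Dual ℤ Pv} {v : M} (hv : v ∈ weightSpace ρ μ) (i : I) :
    ρ (uE D i) (ρ (uF D i) v) - ρ (uF D i) (ρ (uE D i) v) =
      zInt (D.qi i) (μ (D.h i)) • v := by
  have := congrArg (fun T => ρ T v) (e_f_comm D i)
  simp only [map_sub, map_mul, map_smul, LinearMap.sub_apply, Module.End.mul_apply,
    LinearMap.smul_apply, uK_apply hv, uKinv_apply hv] at this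
  rw [this, ← sub_smul, smul_smul, zInt, div_eq_inv_mul]

/-- The `i`-string through a weight `μ`. -/
theorem isString (ρ : Rep D M) (i : I) (μ : Module.Dual ℤ Pv) :
    IsString (D.qi i) (D.a i i) (μ (D.h i)) (fun k => weightSpace ρ (μ + k • D.α i))
      (ρ (uE D i)) (ρ (uF D i)) where
  e_mem k v hv := by
    have := uE_mem hv i
    rwa [add_assoc, ← add_one_zsmul] at this
  f_mem k v hv := by
    have := uF_mem hv i
    rwa [add_sub_assoc, sub_eq_add_neg, ← sub_one_zsmul] at this
  comm k v hv := by
    rw [ef_comm_apply hv, LinearMap.add_apply, LinearMap.smul_apply, D.α_h, smul_eq_mul, mul_comm]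

end weights

/-! ### Strings in modules of `O_int` -/

section strings
variable {I Pv : Type*} [AddCommGroup Pv] (D : BorcherdsCartanDatum I Pv)

/-- The condition for `f_i^{(n)} w` to be a non-zero member of the string of a primitive vector
`w ≠ 0` of weight `m` with respect to `h_i`. -/
def Adm (i : I) (m : ℤ) (n : ℕ) : Prop :=
  if D.a i i = 2 then (n : ℤ) ≤ m else n = 0 ∨ 0 < m

/-- The scalar with `f_i f_i^{(n - 1)} = strA n • f_i^{(n)}`, extended by `0` to `n = 0`. -/
def strA (i : I) (n : ℕ) : K :=
  if D.a i i = 2 then qInt (D.qi i) n else if n = 0 then 0 else 1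

/-- The scalar with `e_i f_i^{(n)} w = strG m n • f_i^{(n - 1)} w` for a primitive vector `w`
of weight `m` with respect to `h_i`. -/
def strG (i : I) (m : ℤ) (n : ℕ) : K :=
  if D.a i i = 2 then zInt (D.qi i) (m - n + 1) else sumInt (D.qi i) (D.a i i) m n

/-- The scalar with `f_i^n = divFac n • f_i^{(n)}`. -/
def divFac (i : I) (n : ℕ) : K := if D.a i i = 2 then qFact (D.qi i) n else 1

variable {D}

theorem divFac_ne_zero (i : I) (n : ℕ) : divFac D i n ≠ 0 := by
  unfold divFac
  split_ifs
  · exact (generic_qi D i).qFact_ne n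
  · exact one_ne_zero

theorem divFac_zero (i : I) : divFac D i 0 = 1 := by simp [divFac, qFact]

theorem divFac_succ (i : I) (n : ℕ) : divFac D i (n + 1) = divFac D i n * strA D i (n + 1) := by
  unfold divFac strA
  split_ifs
  · exact qFact_succ _ _
  · simp at *
  · simp

theorem strA_zero (i : I) : strA D i 0 = 0 := by simp [strA, qInt]

theorem strA_succ_ne_zero (i : I) (n : ℕ) : strA D i (n + 1) ≠ 0 := by
  intro h
  have := divFac_succ (D := D) i n
  rw [h, mul_zero] at this
  exact divFac_ne_zero i _ this

theorem strA_mul_strG (i : I) (m : ℤ) (n : ℕ) :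
    strA D i (n + 1) * strG D i m (n + 1) = sumInt (D.qi i) (D.a i i) m (n + 1) := by
  unfold strA strG
  split_ifs with h
  · rw [h, (generic_qi D i).sumInt_two, zInt_natCast]
  · simp at *
  · rw [one_mul]

theorem Adm.mono {i : I} {m : ℤ} {n n' : ℕ} (h : Adm D i m n) (hn : n' ≤ n) : Adm D i m n' := by
  unfold Adm at *
  split_ifs at * with hi
  · omega
  · omega

theorem diag_nonpos {i : I} (h : D.a i i ≠ 2) : D.a i i ≤ 0 := (D.diag i).resolve_left h

variable {M : Type*} [AddCommGroup M] [Module K M] (ρ : Rep D M)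

/-- The primitive vectors of weight `μ` with respect to `e_i`. -/
def prim (i : I) (μ : Module.Dual ℤ Pv) : Submodule K M :=
  LinearMap.ker (ρ (uE D i)) ⊓ weightSpace ρ μ

variable {ρ}

theorem mem_prim {i : I} {μ : Module.Dual ℤ Pv} {w : M} :
    w ∈ prim ρ i μ ↔ ρ (uE D i) w = 0 ∧ w ∈ weightSpace ρ μ := Iff.rfl

theorem fDiv_eq (i : I) (n : ℕ) : fDiv ρ i n = (divFac D i n)⁻¹ • ρ (uF D i) ^ n := by
  unfold fDiv divFac
  split_ifs <;> simp

theorem fDiv_zero (i : I) (w : M) : fDiv ρ i 0 w = w := by simp [fDiv_eq, divFac_zero]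

theorem f_fDiv (i : I) (n : ℕ) (w : M) :
    ρ (uF D i) (fDiv ρ i n w) = strA D i (n + 1) • fDiv ρ i (n + 1) w := by
  have h1 := strA_succ_ne_zero (D := D) i n
  have h2 := divFac_ne_zero (D := D) i n
  rw [fDiv_eq, fDiv_eq, LinearMap.smul_apply, LinearMap.smul_apply, map_smul, smul_smul,
    divFac_succ, pow_succ', Module.End.mul_apply]
  congr 1
  field_simp

theorem f_pow_mem_weightSpace {i : I} {μ : Module.Dual ℤ Pv} {w : M} (hw : w ∈ weightSpace ρ μ)
    (n : ℕ) : (ρ (uF D i) ^ n) w ∈ weightSpace ρ (μ - n • D.α i) := by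
  have := (isString ρ i μ).f_pow_mem (k := 0) (v := w) (by simpa using hw) n
  simpa [sub_eq_add_neg] using this

theorem e_pow_mem_weightSpace {i : I} {μ : Module.Dual ℤ Pv} {w : M} (hw : w ∈ weightSpace ρ μ)
    (n : ℕ) : (ρ (uE D i) ^ n) w ∈ weightSpace ρ (μ + n • D.α i) := by
  have := (isString ρ i μ).e_pow_mem (k := 0) (v := w) (by simpa using hw) n
  simpa using this

theorem fDiv_mem_weightSpace {i : I} {μ : Module.Dual ℤ Pv} {w : M} (hw : w ∈ weightSpace ρ μ)
    (n : ℕ) : fDiv ρ i n w ∈ weightSpace ρ (μ - n • D.α i) := by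
  rw [fDiv_eq]
  exact Submodule.smul_mem _ _ (f_pow_mem_weightSpace hw n)

theorem e_fDiv {i : I} {μ : Module.Dual ℤ Pv} {w : M} (hw : w ∈ prim ρ i μ) (n : ℕ) :
    ρ (uE D i) (fDiv ρ i (n + 1) w) = strG D i (μ (D.h i)) (n + 1) • fDiv ρ i n w := by
  have h1 := strA_succ_ne_zero (D := D) i n
  have h2 := divFac_ne_zero (D := D) i n
  have := (isString ρ i μ).e_f_pow (k := 0) (by simpa using (mem_prim.mp hw).2)
    (mem_prim.mp hw).1 n
  rw [fDiv_eq, fDiv_eq, LinearMap.smul_apply, LinearMap.smul_apply, map_smul, this, mul_zero,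
    add_zero, ← strA_mul_strG, divFac_succ, smul_smul, smul_smul]
  congr 1
  field_simp

/-! ### Orders at `q = 0` of the structure constants of strings -/

theorem qi_pow_hasVal (D : BorcherdsCartanDatum I Pv) (i : I) {n : ℕ} (hn : 0 < n) :
    HasVal (D.qi i ^ n) 0 := by
  rw [BorcherdsCartanDatum.qi, ← pow_mul]
  have := hasVal_q.pow (D.s i * n)
  rwa [zero_pow (Nat.mul_pos (D.s_pos i) hn).ne'] at this

theorem qi_zpow_hasVal (D : BorcherdsCartanDatum I Pv) (i : I) {k : ℤ} (hk : 0 < k) :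
    HasVal (D.qi i ^ k) 0 := by
  obtain ⟨n, rfl⟩ := Int.eq_ofNat_of_zero_le hk.le
  rw [zpow_natCast]
  exact qi_pow_hasVal D i (by simpa using hk)

theorem qi_zpow_hasVal' (D : BorcherdsCartanDatum I Pv) (i : I) {k : ℤ} (hk : 0 ≤ k) :
    HasVal (D.qi i ^ k) (if k = 0 then 1 else 0) := by
  split_ifs with h
  · rw [h, zpow_zero]; exact hasVal_one
  · exact qi_zpow_hasVal D i (lt_of_le_of_ne hk (Ne.symm h))

/-- `t ^ (k - 1) [k]` is a unit of `A₀`, with value `1` at `0`. -/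
theorem zInt_hasVal (D : BorcherdsCartanDatum I Pv) (i : I) {k : ℤ} (hk : 0 < k) :
    HasVal (D.qi i ^ (k - 1) * zInt (D.qi i) k) 1 := by
  obtain ⟨n, rfl⟩ : ∃ n : ℕ, k = n + 1 := ⟨(k - 1).toNat, by omega⟩
  clear hk
  rw [add_sub_cancel_right]
  have ht := generic_qi D i
  have h0 := ht.1
  have h1 := ht.sub_inv_ne
  have h2 : D.qi i ^ (n : ℤ) * zInt (D.qi i) (n + 1) =
      (1 - D.qi i ^ (2 * (n + 1))) / (1 - D.qi i ^ 2) := by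
    have h3 : 1 - D.qi i ^ 2 ≠ 0 := sub_ne_zero.mpr (Ne.symm (ht.2 2 two_pos))
    have h4 : D.qi i ^ (-((n : ℤ) + 1)) = (D.qi i ^ (n + 1))⁻¹ := by
      rw [zpow_neg]; norm_cast
    have h5 : D.qi i ^ ((n : ℤ) + 1) = D.qi i ^ (n + 1) := by norm_cast
    rw [zInt, h4, h5, zpow_natCast, eq_div_iff h3, mul_div_assoc', div_mul_eq_mul_div,
      div_eq_iff h1]
    field_simp
    ring
  rw [h2]
  have v1 : HasVal (1 - D.qi i ^ (2 * (n + 1))) 1 := by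
    simpa using hasVal_one.sub (qi_pow_hasVal D i (n := 2 * (n + 1)) (by omega))
  have v2 : HasVal (1 - D.qi i ^ 2) 1 := by
    simpa using hasVal_one.sub (qi_pow_hasVal D i (n := 2) (by omega))
  simpa using v1.div v2 one_ne_zero

/-- For `a ≤ 0 < m`, the element `∑_{j < n + 1} [m - a j]` becomes a unit of `A₀` after
multiplication by `t ^ (m - 1 - a n)`. -/
theorem sumInt_hasVal (D : BorcherdsCartanDatum I Pv) (i : I) {a m : ℤ} (ha : a ≤ 0) (hm : 0 < m)
    (n : ℕ) : ∃ r : ℚ, 0 < r ∧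
      HasVal (D.qi i ^ (m - 1 - a * n) * sumInt (D.qi i) a m (n + 1)) r := by
  have h0 := (generic_qi D i).1
  have key : ∀ j ∈ Finset.range (n + 1),
      HasVal (D.qi i ^ (m - 1 - a * n) * zInt (D.qi i) (m - a * j))
        ((if -a * (n - j) = 0 then 1 else 0) * 1) := by
    intro j hj
    have hj' : j ≤ n := Nat.lt_succ_iff.mp (Finset.mem_range.mp hj)
    -- Each term is a normalized quantum integer of value `1` times `t ^ (-a (n - j))`. Only terms
    -- with `a (n - j) = 0` survive at `q = 0`, and `j = n` is always one of them, so the value is a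
    -- positive count of terms.
    have e : D.qi i ^ (m - 1 - a * n) * zInt (D.qi i) (m - a * j) =
        D.qi i ^ (-a * (n - j)) * (D.qi i ^ ((m - a * j) - 1) * zInt (D.qi i) (m - a * j)) := by
      rw [← mul_assoc, ← zpow_add₀ h0]; congr 2; ring
    rw [e]
    have hnj : (0 : ℤ) ≤ n - j := by omega
    refine (qi_zpow_hasVal' D i (by nlinarith)).mul (zInt_hasVal D i ?_)
    have : (0 : ℤ) ≤ -a * j := mul_nonneg (by omega) (by omega)
    linarith
  refine ⟨_, ?_, by
    rw [sumInt, Finset.mul_sum]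
    exact HasVal.sum _ key⟩
  refine Finset.sum_pos' (fun j _ => by split_ifs <;> norm_num) ⟨n, by simp, by simp⟩

theorem strG_ne_zero {i : I} {m : ℤ} {n : ℕ} (h : Adm D i m (n + 1)) :
    strG D i m (n + 1) ≠ 0 := by
  unfold Adm at h
  unfold strG
  split_ifs at * with hi
  · exact (generic_qi D i).zInt_ne_zero (by push_cast at *; omega)
  · obtain ⟨r, hr, hv⟩ := sumInt_hasVal D i (diag_nonpos hi) (show 0 < m by simpa using h) n
    exact fun h0 => (hv.ne_zero hr.ne') (by rw [h0, mul_zero])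

/-! ### Existence and uniqueness of string decompositions -/

theorem α_indep_nat (D : BorcherdsCartanDatum I Pv) : LinearIndependent ℕ D.α :=
  D.α_indep.restrict_scalars' ℕ

theorem mem_Qplus_iff {x : Module.Dual ℤ Pv} :
    x ∈ D.Qplus ↔ ∃ c : I →₀ ℕ, Finsupp.linearCombination ℕ D.α c = x := by
  rw [BorcherdsCartanDatum.Qplus, ← Submodule.span_nat_eq_addSubmonoidClosure,
    Submodule.mem_toAddSubmonoid, Finsupp.mem_span_range_iff_exists_finsupp]
  rfl

/-- By linear independence of the simple roots each subtraction of `α_i` lowers the coefficient of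
`α_i` by one, and this coefficient cannot become negative. -/
theorem Qplus_eventually_notMem (D : BorcherdsCartanDatum I Pv) (i : I)
    (β : Module.Dual ℤ Pv) : ∃ N : ℕ, ∀ n ≥ N, β - n • D.α i ∉ D.Qplus := by
  by_cases h : ∃ n₀ : ℕ, β - n₀ • D.α i ∈ D.Qplus
  · obtain ⟨n₀, h⟩ := h
    obtain ⟨c, hc⟩ := mem_Qplus_iff.mp h
    refine ⟨n₀ + c i + 1, fun n hn hmem => ?_⟩
    obtain ⟨c', hc'⟩ := mem_Qplus_iff.mp hmem
    obtain ⟨r, rfl⟩ : ∃ r, n = n₀ + r := ⟨n - n₀, by omega⟩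
    have e : Finsupp.linearCombination ℕ D.α (c' + Finsupp.single i r) =
        Finsupp.linearCombination ℕ D.α c := by
      rw [map_add, Finsupp.linearCombination_single, hc, hc', add_smul]
      abel
    have := DFunLike.congr_fun (α_indep_nat D e) i
    simp at this
    omega
  · push Not at h
    exact ⟨0, fun n _ => h n⟩

theorem exists_e_pow_eq_zero (hO : IsOInt ρ) (i : I) {μ : Module.Dual ℤ Pv} {v : M}
    (hv : v ∈ weightSpace ρ μ) : ∃ n, (ρ (uE D i) ^ n) v = 0 := by
  obtain ⟨S, hS⟩ := hO.bounded
  choose N hN using fun l => Qplus_eventually_notMem D i (l - μ)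
  refine ⟨S.sup N, ?_⟩
  by_contra h
  have hmem := e_pow_mem_weightSpace hv (S.sup N) (i := i)
  obtain ⟨l, hl, hQ⟩ := hS _ fun hb => h (by rw [hb] at hmem; simpa using hmem)
  exact hN l _ (Finset.le_sup hl) (by rwa [sub_sub])

/-- For real `i` the weight of a non-zero primitive vector is a natural number at which its string
ends. For imaginary `i` weights are non-negative, so failure of admissibility means weight `0`,
where `f_i` acts by zero. -/
theorem fDiv_eq_zero (hO : IsOInt ρ) {i : I} {μ : Module.Dual ℤ Pv} {w : M}
    (hw : w ∈ prim ρ i μ) {n : ℕ} (h : ¬ Adm D i (μ (D.h i)) n) : fDiv ρ i n w = 0 := by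
  by_cases hw0 : w = 0
  · rw [hw0, map_zero]
  have suff : ∀ n', n' ≤ n → (ρ (uF D i) ^ n') w = 0 → fDiv ρ i n w = 0 := by
    intro n' hn' h0
    obtain ⟨r, rfl⟩ := Nat.exists_eq_add_of_le' hn'
    rw [fDiv_eq, LinearMap.smul_apply, pow_add, Module.End.mul_apply, h0, map_zero, smul_zero]
  rw [mem_prim] at hw
  unfold Adm at h
  split_ifs at h with hi
  · have hs := isString ρ i μ
    rw [hi] at hs
    obtain ⟨m, hm, hf⟩ := hs.exists_weight (generic_qi D i) (k := 0) (by simpa using hw.2) hw.1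
      hw0 (hO.nilp i hi w)
    exact suff (m + 1) (by push Not at h; omega) hf
  · push Not at h
    have h1 := hO.nonneg i (diag_nonpos hi) μ (fun hb => hw0 (by
      have := hw.2; rw [hb] at this; simpa using this))
    refine suff 1 (Nat.one_le_iff_ne_zero.mpr h.1) ?_
    rw [pow_one]
    exact hO.f_zero i (diag_nonpos hi) μ (by omega) w hw.2

/-- A decomposition `u = ∑_{n < N} f_i^{(n)} w_n` into members of `i`-strings. -/
structure IsDec (ρ : Rep D M) (i : I) (μ : Module.Dual ℤ Pv) (u : M) (N : ℕ) (w : ℕ → M) :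
    Prop where
  mem : ∀ n, w n ∈ prim ρ i (μ + n • D.α i)
  adm : ∀ n, w n ≠ 0 → Adm D i ((μ + n • D.α i) (D.h i)) n
  zero : ∀ n, N ≤ n → w n = 0
  sum : u = ∑ n ∈ Finset.range N, fDiv ρ i n (w n)

theorem IsDec.mono {i : I} {μ : Module.Dual ℤ Pv} {u : M} {N N' : ℕ} {w : ℕ → M}
    (h : IsDec ρ i μ u N w) (hN : N ≤ N') : IsDec ρ i μ u N' w where
  mem := h.mem
  adm := h.adm
  zero n hn := h.zero n (hN.trans hn)
  sum := by
    rw [h.sum]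
    refine Finset.sum_subset (Finset.range_subset_range.mpr hN) fun n _ hn => ?_
    rw [h.zero n (by simpa using hn), map_zero]

theorem IsDec.add {i : I} {μ : Module.Dual ℤ Pv} {u u' : M} {N N' : ℕ} {w w' : ℕ → M}
    (h : IsDec ρ i μ u N w) (h' : IsDec ρ i μ u' N' w') :
    IsDec ρ i μ (u + u') (max N N') (w + w') where
  mem n := Submodule.add_mem _ (h.mem n) (h'.mem n)
  adm n hn := by
    by_cases h0 : w n = 0
    · exact h'.adm n fun h1 => hn (by simp [h0, h1])
    · exact h.adm n h0
  zero n hn := by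
    simp [h.zero n ((le_max_left _ _).trans hn), h'.zero n ((le_max_right _ _).trans hn)]
  sum := by
    rw [(h.mono (le_max_left N N')).sum, (h'.mono (le_max_right N N')).sum,
      ← Finset.sum_add_distrib]
    simp

theorem IsDec.smul {i : I} {μ : Module.Dual ℤ Pv} {u : M} {N : ℕ} {w : ℕ → M}
    (h : IsDec ρ i μ u N w) (c : K) : IsDec ρ i μ (c • u) N (c • w) where
  mem n := Submodule.smul_mem _ _ (h.mem n)
  adm n hn := h.adm n fun h0 => hn (by simp [h0])
  zero n hn := by simp [h.zero n hn]
  sum := by rw [h.sum, Finset.smul_sum]; simp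

theorem isDec_zero (ρ : Rep D M) (i : I) (μ : Module.Dual ℤ Pv) : IsDec ρ i μ 0 0 0 where
  mem n := Submodule.zero_mem _
  adm n hn := absurd rfl hn
  zero n _ := rfl
  sum := by simp

theorem isDec_single {i : I} {μ : Module.Dual ℤ Pv} {n : ℕ} {w : M}
    (hw : w ∈ prim ρ i (μ + n • D.α i)) (ha : Adm D i ((μ + n • D.α i) (D.h i)) n) :
    IsDec ρ i μ (fDiv ρ i n w) (n + 1) (Pi.single n w) where
  mem k := by
    by_cases h : k = n
    · subst h; simpa using hw
    · rw [Pi.single_eq_of_ne h]; exact Submodule.zero_mem _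
  adm k hk := by
    by_cases h : k = n
    · subst h; exact ha
    · exact absurd (Pi.single_eq_of_ne h _) hk
  zero k hk := Pi.single_eq_of_ne (by omega) _
  sum := by
    rw [Finset.sum_eq_single n]
    · simp
    · intro k _ hk; rw [Pi.single_eq_of_ne hk, map_zero]
    · simp

/-- For real `i` this is integrability under `sl₂`. For imaginary `i` nilpotency of `e_i` suffices,
because the axioms of `O_int` force positive weights wherever a structure constant has to be
inverted. -/
theorem exists_isDec (hO : IsOInt ρ) (i : I) {μ : Module.Dual ℤ Pv} {u : M}
    (hu : u ∈ weightSpace ρ μ) : ∃ N w, IsDec ρ i μ u N w := by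
  have hs := isString ρ i μ
  have h1 : u ∈ ⨆ n : ℕ, (LinearMap.ker (ρ (uE D i)) ⊓
      weightSpace ρ (μ + ((0 : ℤ) + n) • D.α i)).map (ρ (uF D i) ^ n) := by
    by_cases hi : D.a i i = 2
    · rw [hi] at hs
      exact hs.mem_iSup_of_nilpotent (generic_qi D i)
        (fun k v hv => exists_e_pow_eq_zero hO i hv) (fun k v _ => hO.nilp i hi v)
        (by simpa using hu)
    · obtain ⟨N, hN⟩ := exists_e_pow_eq_zero hO i hu
      refine hs.mem_iSup 0 (fun N v hv h0 hne n hn => ?_) N u (by simpa using hu) hN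
      have hwt := hs.e_pow_mem (k := 0) hv N
      simp only [zero_add] at hwt ⊢
      have hpos : 0 < μ (D.h i) + D.a i i * N := by
        have e : (μ + (N : ℤ) • D.α i) (D.h i) = μ (D.h i) + D.a i i * N := by
          simp [D.α_h, mul_comm]
        rw [← e]
        refine lt_of_le_of_ne (hO.nonneg i (diag_nonpos hi) _ fun hb => hne ?_) fun h0 => hne ?_
        · rw [hb] at hwt; simpa using hwt
        -- Here `N > 0` as `n < N`. If the weight at `h_i` were `0`, the preceding vector in the
        -- chain would have weight `-a_ii`, where `e_i` vanishes.
        · obtain ⟨N, rfl⟩ : ∃ N', N = N' + 1 := ⟨N - 1, by omega⟩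
          have hwt' := hs.e_pow_mem (k := 0) hv N
          rw [pow_succ', Module.End.mul_apply]
          refine hO.e_zero i (diag_nonpos hi) _ ?_ _ hwt'
          simp only [LinearMap.add_apply, LinearMap.smul_apply, D.α_h, smul_eq_mul] at h0 ⊢
          push_cast at h0
          linarith
      obtain ⟨r, hr, hv⟩ := sumInt_hasVal D i (diag_nonpos hi) hpos n
      exact fun h0 => (hv.ne_zero hr.ne') (by rw [h0, mul_zero])
  refine Submodule.iSup_induction _ (motive := fun u => ∃ N w, IsDec ρ i μ u N w) h1 ?_ ?_ ?_
  · rintro n _ ⟨w, hw, rfl⟩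
    have hw' : w ∈ prim ρ i (μ + n • D.α i) := by simpa [prim] using hw
    have e : (ρ (uF D i) ^ n) w = divFac D i n • fDiv ρ i n w := by
      rw [fDiv_eq, LinearMap.smul_apply, smul_smul, mul_inv_cancel₀ (divFac_ne_zero i n),
        one_smul]
    by_cases ha : Adm D i ((μ + n • D.α i) (D.h i)) n
    · rw [e]
      exact ⟨_, _, (isDec_single hw' ha).smul _⟩
    · rw [e, fDiv_eq_zero hO hw' ha, smul_zero]
      exact ⟨0, 0, isDec_zero ρ i μ⟩
  · exact ⟨0, 0, isDec_zero ρ i μ⟩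
  · rintro u u' ⟨N, w, h⟩ ⟨N', w', h'⟩
    exact ⟨_, _, h.add h'⟩

/-- Applying `e_i` turns a decomposition of `0` into a shorter one, with members rescaled by the
constants `strG`, which do not vanish at admissible positions. Induction removes all members but `w
0`, which is then the whole sum. -/
theorem IsDec.eq_zero {i : I} {N : ℕ} : ∀ {μ : Module.Dual ℤ Pv} {w : ℕ → M},
    IsDec ρ i μ 0 N w → w = 0 := by
  induction N with
  | zero => exact fun h => funext fun n => h.zero n (Nat.zero_le n)
  | succ N ih =>
    intro μ w h
    have wt : ∀ n : ℕ, μ + D.α i + n • D.α i = μ + (n + 1) • D.α i := fun n => by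
      rw [succ_nsmul']; abel
    have h1 : IsDec ρ i (μ + D.α i) 0 N
        (fun n => strG D i ((μ + (n + 1) • D.α i) (D.h i)) (n + 1) • w (n + 1)) := by
      refine ⟨fun n => ?_, fun n hn => ?_, fun n hn => ?_, ?_⟩
      · rw [wt]; exact Submodule.smul_mem _ _ (h.mem (n + 1))
      · rw [wt]
        exact (h.adm (n + 1) fun h0 => hn (by simp [h0])).mono (Nat.le_succ n)
      · simp [h.zero (n + 1) (by omega)]
      · have h2 := congrArg (ρ (uE D i)) h.sum
        rw [map_zero, map_sum, Finset.sum_range_succ', fDiv_zero, (mem_prim.mp (h.mem 0)).1,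
          add_zero] at h2
        rw [h2]
        refine Finset.sum_congr rfl fun n _ => ?_
        rw [e_fDiv (h.mem (n + 1)), map_smul]
    have h2 : ∀ n, w (n + 1) = 0 := fun n => by
      by_contra hne
      rcases smul_eq_zero.mp (congrFun (ih h1) n) with h3 | h3
      · exact strG_ne_zero (h.adm (n + 1) hne) h3
      · exact hne h3
    have h3 := h.sum
    rw [Finset.sum_range_succ', Finset.sum_eq_zero fun n _ => by rw [h2, map_zero], zero_add,
      fDiv_zero] at h3
    funext n
    rcases n with _ | n
    · exact h3.symm
    · exact h2 n

/-! ### The Kashiwara operators -/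

/-- For imaginary `i` a string decomposition excludes only weight `0`; negative weights are excluded
by the axiom `nonneg`. -/
theorem adm_iff_of_isStringDecomposition (hO : IsOInt ρ) {i : I} {μ : Module.Dual ℤ Pv} {u : M}
    {w : ℕ →₀ M} (h : IsStringDecomposition ρ i μ u w) (n : ℕ) (hn : w n ≠ 0) :
    Adm D i ((μ + n • D.α i) (D.h i)) n := by
  unfold Adm
  split_ifs with hi
  · by_contra hlt
    exact hn (h.real hi n (by omega))
  · by_contra hlt
    push Not at hlt
    have := hO.nonneg i (diag_nonpos hi) _ (fun hb => hn (by
      have := h.weight n; rw [hb] at this; simpa using this))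
    exact hn (h.imag (diag_nonpos hi) n (Nat.pos_of_ne_zero hlt.1) (by omega))

theorem IsStringDecomposition.exists_isDec (hO : IsOInt ρ) {i : I} {μ : Module.Dual ℤ Pv} {u : M}
    {w : ℕ →₀ M} (h : IsStringDecomposition ρ i μ u w) : ∃ N, IsDec ρ i μ u N w := by
  obtain ⟨N, hN⟩ : ∃ N, w.support ⊆ Finset.range N :=
    ⟨w.support.sup id + 1, fun n hn => Finset.mem_range.mpr
      (Nat.lt_succ_of_le (Finset.le_sup (f := id) hn))⟩
  refine ⟨N, fun n => ⟨h.ker n, h.weight n⟩, adm_iff_of_isStringDecomposition hO h,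
    fun n hn => ?_, ?_⟩
  · by_contra hne
    have := Finset.mem_range.mp (hN (Finsupp.mem_support_iff.mpr hne))
    omega
  · rw [h.sum]
    exact Finsupp.sum_of_support_subset _ hN _ fun n _ => map_zero _

theorem IsDec.exists_isStringDecomposition {i : I} {μ : Module.Dual ℤ Pv} {u : M} {N : ℕ}
    {w : ℕ → M} (h : IsDec ρ i μ u N w) :
    ∃ w' : ℕ →₀ M, ⇑w' = w ∧ IsStringDecomposition ρ i μ u w' := by
  classical
  let w' : ℕ →₀ M := Finsupp.onFinset (Finset.range N) w fun n hn => by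
    by_contra hlt
    exact hn (h.zero n (by simpa using hlt))
  refine ⟨w', rfl, fun n => (h.mem n).1, fun n => (h.mem n).2, ?_, fun hi n hn => ?_,
    fun hi n hn h0 => ?_⟩
  · rw [h.sum]
    exact (Finsupp.onFinset_sum _ fun n => map_zero _).symm
  · by_contra hne
    have := h.adm n hne
    rw [Adm, if_pos hi] at this
    omega
  · by_contra hne
    have := h.adm n hne
    rw [Adm, if_neg (by omega)] at this
    omega

theorem IsStringDecomposition.unique (hO : IsOInt ρ) {i : I} {μ : Module.Dual ℤ Pv} {u : M}
    {w w' : ℕ →₀ M} (h : IsStringDecomposition ρ i μ u w)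
    (h' : IsStringDecomposition ρ i μ u w') : w = w' := by
  obtain ⟨N, hN⟩ := h.exists_isDec hO
  obtain ⟨N', hN'⟩ := h'.exists_isDec hO
  have := hN.add (hN'.smul (-1))
  rw [neg_one_smul, add_neg_cancel] at this
  have := this.eq_zero
  rw [neg_one_smul, ← sub_eq_add_neg, sub_eq_zero] at this
  exact DFunLike.coe_injective this

/-- Uniqueness makes the decomposition linear on each weight space, and the module is the direct sum
of these. Both Kashiwara operators are instances. -/
theorem exists_linear_of_strings (hO : IsOInt ρ) (i : I) (G : ℕ → Module.End K M) :
    ∃ T : M →ₗ[K] M, ∀ μ, ∀ u ∈ weightSpace ρ μ, ∀ w : ℕ →₀ M,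
      IsStringDecomposition ρ i μ u w → T u = w.sum fun n v => G n v := by
  classical
  have ex : ∀ μ (u : weightSpace ρ μ), ∃ w : ℕ →₀ M, IsStringDecomposition ρ i μ (u : M) w :=
    fun μ u => by
      obtain ⟨N, w, h⟩ := exists_isDec hO i u.2
      obtain ⟨w', -, h'⟩ := h.exists_isStringDecomposition
      exact ⟨w', h'⟩
  choose dec hdec using ex
  have dec_add : ∀ μ u u', dec μ (u + u') = dec μ u + dec μ u' := fun μ u u' => by
    obtain ⟨N, hN⟩ := (hdec μ u).exists_isDec hO
    obtain ⟨N', hN'⟩ := (hdec μ u').exists_isDec hO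
    obtain ⟨w, hw, h⟩ := (hN.add hN').exists_isStringDecomposition
    rw [(hdec μ (u + u')).unique hO h]
    exact DFunLike.coe_injective (by rw [hw, Finsupp.coe_add])
  have dec_smul : ∀ μ (c : K) u, dec μ (c • u) = c • dec μ u := fun μ c u => by
    obtain ⟨N, hN⟩ := (hdec μ u).exists_isDec hO
    obtain ⟨w, hw, h⟩ := (hN.smul c).exists_isStringDecomposition
    rw [(hdec μ (c • u)).unique hO h]
    exact DFunLike.coe_injective (by rw [hw, Finsupp.coe_smul])
  let decL : ∀ μ, weightSpace ρ μ →ₗ[K] (ℕ →₀ M) := fun μ =>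
    { toFun := dec μ, map_add' := dec_add μ, map_smul' := dec_smul μ }
  have hint : DirectSum.IsInternal (weightSpace ρ) :=
    DirectSum.isInternal_submodule_of_iSupIndep_of_iSup_eq_top hO.weight.1 hO.weight.2
  let e := LinearEquiv.ofBijective (DirectSum.coeLinearMap (weightSpace ρ)) hint
  let T' := DirectSum.toModule K (Module.Dual ℤ Pv) M fun μ =>
    (Finsupp.lsum K (G : ℕ → M →ₗ[K] M)) ∘ₗ decL μ
  refine ⟨T' ∘ₗ e.symm.toLinearMap, fun μ u hu w hw => ?_⟩
  have h1 : e.symm u = DirectSum.lof K _ (fun μ => weightSpace ρ μ) μ ⟨u, hu⟩ := by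
    rw [LinearEquiv.symm_apply_eq]
    exact (DirectSum.coeLinearMap_lof (weightSpace ρ) μ ⟨u, hu⟩).symm
  rw [LinearMap.comp_apply, LinearEquiv.coe_coe, h1, DirectSum.toModule_lof,
    LinearMap.comp_apply, Finsupp.lsum_apply]
  rw [show decL μ ⟨u, hu⟩ = w from (hdec μ ⟨u, hu⟩).unique hO hw]

theorem kashE_spec (hO : IsOInt ρ) (i : I) : IsKashiwaraE ρ i (kashE ρ i) := by
  have H : ∃ T, IsKashiwaraE ρ i T := by
    obtain ⟨T, hT⟩ := exists_linear_of_strings hO i fun n => if n = 0 then 0 else fDiv ρ i (n - 1)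
    refine ⟨T, fun μ u hu w hw => (hT μ u hu w hw).trans (Finsupp.sum_congr fun n _ => ?_)⟩
    split_ifs <;> rfl
  rw [kashE, dif_pos H]
  exact H.choose_spec

theorem kashF_spec (hO : IsOInt ρ) (i : I) : IsKashiwaraF ρ i (kashF ρ i) := by
  have H : ∃ T, IsKashiwaraF ρ i T := exists_linear_of_strings hO i fun n => fDiv ρ i (n + 1)
  rw [kashF, dif_pos H]
  exact H.choose_spec

theorem isStringDecomposition_single {i : I} {μ : Module.Dual ℤ Pv} {w : M}
    (hw : w ∈ prim ρ i μ) {n : ℕ} (ha : Adm D i (μ (D.h i)) n) :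
    IsStringDecomposition ρ i (μ - n • D.α i) (fDiv ρ i n w) (Finsupp.single n w) := by
  have e : μ - n • D.α i + n • D.α i = μ := sub_add_cancel _ _
  have h := isDec_single (ρ := ρ) (i := i) (μ := μ - n • D.α i) (n := n) (w := w)
    (by rwa [e]) (by rwa [e])
  obtain ⟨w', hw', h'⟩ := h.exists_isStringDecomposition
  rwa [show w' = Finsupp.single n w from DFunLike.coe_injective (by
    rw [hw', Finsupp.single_eq_pi_single])] at h'

theorem adm_zero (hO : IsOInt ρ) {i : I} {μ : Module.Dual ℤ Pv} {w : M}
    (hw : w ∈ prim ρ i μ) (hw0 : w ≠ 0) : Adm D i (μ (D.h i)) 0 := by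
  by_contra h
  exact hw0 (by rw [← fDiv_zero (ρ := ρ) i w, fDiv_eq_zero hO hw h])

theorem kashE_prim (hO : IsOInt ρ) {i : I} {μ : Module.Dual ℤ Pv} {w : M}
    (hw : w ∈ prim ρ i μ) : kashE ρ i w = 0 := by
  by_cases hw0 : w = 0
  · rw [hw0, map_zero]
  have h := isStringDecomposition_single hw (adm_zero hO hw hw0)
  have := kashE_spec hO i _ _ (fDiv_mem_weightSpace hw.2 0) _ h
  rw [fDiv_zero] at this
  rw [this, Finsupp.sum_single_index] <;> simp

theorem kashE_fDiv_succ (hO : IsOInt ρ) {i : I} {μ : Module.Dual ℤ Pv} {w : M}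
    (hw : w ∈ prim ρ i μ) {n : ℕ} (ha : Adm D i (μ (D.h i)) (n + 1)) :
    kashE ρ i (fDiv ρ i (n + 1) w) = fDiv ρ i n w := by
  have h := isStringDecomposition_single hw ha
  rw [kashE_spec hO i _ _ (fDiv_mem_weightSpace hw.2 _) _ h, Finsupp.sum_single_index] <;> simp

theorem kashF_fDiv (hO : IsOInt ρ) {i : I} {μ : Module.Dual ℤ Pv} {w : M}
    (hw : w ∈ prim ρ i μ) (n : ℕ) : kashF ρ i (fDiv ρ i n w) = fDiv ρ i (n + 1) w := by
  by_cases ha : Adm D i (μ (D.h i)) n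
  · have h := isStringDecomposition_single hw ha
    rw [kashF_spec hO i _ _ (fDiv_mem_weightSpace hw.2 _) _ h, Finsupp.sum_single_index] <;> simp
  · rw [fDiv_eq_zero hO hw ha, fDiv_eq_zero hO hw fun h => ha (h.mono (Nat.le_succ n)), map_zero]

end strings

/-! ### Coefficients of tensor products of two strings -/

section model
variable {I Pv : Type*} [AddCommGroup Pv] (D : BorcherdsCartanDatum I Pv) (i : I) (m n : ℤ)

/-- The operator `f_i` on a tensor product of two strings, in terms of coefficients. -/
def coefF : Module.End K (ℕ → ℕ → K) where
  -- The truncated subtractions at `a = 0` and `b = 0` are harmless, since `strA` vanishes at `0`.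
  toFun c a b := strA D i a * c (a - 1) b +
    D.qi i ^ (m - D.a i i * a) * strA D i b * c a (b - 1)
  map_add' c c' := by funext a b; simp only [Pi.add_apply]; ring
  map_smul' r c := by
    funext a b; simp only [Pi.smul_apply, smul_eq_mul, RingHom.id_apply]; ring

/-- The operator `e_i` on a tensor product of two strings, in terms of coefficients. -/
def coefE : Module.End K (ℕ → ℕ → K) where
  toFun c a b := D.qi i ^ (-(n - D.a i i * b)) * strG D i m (a + 1) * c (a + 1) b +
    strG D i n (b + 1) * c a (b + 1)
  map_add' c c' := by funext a b; simp only [Pi.add_apply]; ring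
  map_smul' r c := by
    funext a b; simp only [Pi.smul_apply, smul_eq_mul, RingHom.id_apply]; ring

variable {D i m n}

theorem coefF_apply (c : ℕ → ℕ → K) (a b : ℕ) : coefF D i m c a b =
    strA D i a * c (a - 1) b + D.qi i ^ (m - D.a i i * a) * strA D i b * c a (b - 1) := rfl

theorem coefE_apply (c : ℕ → ℕ → K) (a b : ℕ) : coefE D i m n c a b =
    D.qi i ^ (-(n - D.a i i * b)) * strG D i m (a + 1) * c (a + 1) b +
      strG D i n (b + 1) * c a (b + 1) := rfl

/-- The coefficient functions supported on the level `l`. -/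
def levelSub (l : ℤ) : Submodule K (ℕ → ℕ → K) where
  carrier := {c | ∀ a b : ℕ, (a + b : ℤ) ≠ l → c a b = 0}
  zero_mem' _ _ _ := rfl
  add_mem' h h' a b hab := by simp [h a b hab, h' a b hab]
  smul_mem' r c h a b hab := by simp [h a b hab]

variable (D i m n) in
/-- The coefficients of the primitive vector of level `p` in the tensor product of two strings. -/
def primSeq (p : ℕ) : ℕ → K
  | 0 => 1
  -- Solves `coefE c = 0` along the level `p`, starting from `a = 0`. Entries of index above `p`
  -- involve truncated subtraction, but `primCoef` never uses them.
  | j + 1 => -(primSeq p j * (strG D i n (p - j) * D.qi i ^ (n - D.a i i * (p - 1 - j : ℕ)) /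
      strG D i m (j + 1)))

variable (D i m n) in
/-- The primitive vector of level `p` in the tensor product of two strings. -/
def primCoef (p : ℕ) : ℕ → ℕ → K := fun a b => if a + b = p then primSeq D i m n p a else 0

theorem primCoef_mem (p : ℕ) : primCoef D i m n p ∈ levelSub p := fun a b h => by
  rw [primCoef, if_neg]
  exact_mod_cast h

theorem coefE_primCoef {p : ℕ} (hp : Adm D i m p) : coefE D i m n (primCoef D i m n p) = 0 := by
  funext a b
  simp only [coefE_apply, primCoef, Pi.zero_apply]
  by_cases h : a + 1 + b = p
  · have h1 : strG D i m (a + 1) ≠ 0 := strG_ne_zero (hp.mono (by omega))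
    have h2 : D.qi i ^ (n - D.a i i * b) ≠ 0 := zpow_ne_zero _ (generic_qi D i).1
    rw [if_pos h, if_pos (by omega), primSeq, show p - a = b + 1 by omega,
      show p - 1 - a = b by omega, zpow_neg]
    field_simp
    ring
  · rw [if_neg h, if_neg (by omega), mul_zero, mul_zero, add_zero]

variable (D i m n) in
/-- The coefficients of `f_i^{(k)} w` for the primitive vector `w` of level `p`. -/
def stringCoef (p k : ℕ) : ℕ → ℕ → K :=
  (divFac D i k)⁻¹ • (coefF D i m ^ k) (primCoef D i m n p)

theorem stringCoef_zero (p : ℕ) : stringCoef D i m n p 0 = primCoef D i m n p := by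
  simp [stringCoef, divFac_zero]

theorem coefF_stringCoef (p k : ℕ) : coefF D i m (stringCoef D i m n p k) =
    strA D i (k + 1) • stringCoef D i m n p (k + 1) := by
  have h1 := strA_succ_ne_zero (D := D) i k
  have h2 := divFac_ne_zero (D := D) i k
  rw [stringCoef, stringCoef, map_smul, smul_smul, divFac_succ, pow_succ', Module.End.mul_apply]
  congr 1
  field_simp

theorem stringCoef_succ (p k a b : ℕ) : stringCoef D i m n p (k + 1) a b =
    strA D i a / strA D i (k + 1) * stringCoef D i m n p k (a - 1) b +
      D.qi i ^ (m - D.a i i * a) * strA D i b / strA D i (k + 1) *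
        stringCoef D i m n p k a (b - 1) := by
  have h1 := strA_succ_ne_zero (D := D) i k
  have := congrFun (congrFun (coefF_stringCoef (D := D) (i := i) (m := m) (n := n) p k) a) b
  rw [coefF_apply, Pi.smul_apply, Pi.smul_apply, smul_eq_mul] at this
  rw [← mul_right_inj' h1, ← this]
  field_simp

/-! #### The imaginary case -/

/-- Each step of the recursion multiplies by `q_i ^ (m - a_ii j)`, of positive order, and by a
quotient of regular elements with positive values; so all entries after the first vanish at `q = 0`.
-/
theorem primSeq_imag (hi : D.a i i ≠ 2) (hm : 0 < m) {p : ℕ} (hp : Adm D i n p) (j : ℕ)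
    (hj : j ≤ p) : HasVal (primSeq D i m n p j) (if j = 0 then 1 else 0) := by
  have h0 := (generic_qi D i).1
  have hA := diag_nonpos hi
  induction j with
  | zero => simpa [primSeq] using hasVal_one
  | succ j ih =>
    have hn : 0 < n := by
      rw [Adm, if_neg hi] at hp
      exact hp.resolve_left (by omega)
    obtain ⟨b, hb⟩ : ∃ b, p - j = b + 1 := ⟨p - j - 1, by omega⟩
    obtain ⟨r, hr, hv⟩ := sumInt_hasVal D i hA hm j
    obtain ⟨s, hs, hv'⟩ := sumInt_hasVal D i hA hn b
    have hmne : (strG D i m (j + 1)) ≠ 0 :=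
      strG_ne_zero (by rw [Adm, if_neg hi]; exact Or.inr hm)
    have e : strG D i n (p - j) * D.qi i ^ (n - D.a i i * (p - 1 - j : ℕ)) /
        strG D i m (j + 1) = D.qi i ^ (m - D.a i i * j) *
        ((D.qi i ^ (n - 1 - D.a i i * b) * sumInt (D.qi i) (D.a i i) n (b + 1)) /
        (D.qi i ^ (m - 1 - D.a i i * j) * sumInt (D.qi i) (D.a i i) m (j + 1))) := by
      rw [strG, if_neg hi] at hmne
      have h1 : D.qi i ^ (m - 1 - D.a i i * j) ≠ 0 := zpow_ne_zero _ h0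
      have h2 : D.qi i ^ (n - D.a i i * b) * D.qi i ^ (m - 1 - D.a i i * j) =
          D.qi i ^ (m - D.a i i * j) * D.qi i ^ (n - 1 - D.a i i * b) := by
        rw [← zpow_add₀ h0, ← zpow_add₀ h0]; congr 1; ring
      rw [hb, show p - 1 - j = b by omega, strG, strG, if_neg hi, if_neg hi, div_eq_iff hmne]
      field_simp
      linear_combination (sumInt (D.qi i) (D.a i i) n (b + 1)) * h2
    rw [primSeq, e]
    have hmj : 0 < m - D.a i i * j := by
      have : 0 ≤ -D.a i i * j := mul_nonneg (by omega) (by omega)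
      linarith
    have := ((ih (by omega)).mul ((qi_zpow_hasVal D i hmj).mul (hv'.div hv hr.ne'))).neg
    refine this.of_eq ?_
    simp

/-- The term of the recursion in which `f_i` acts on the second factor carries `q_i ^ (m - a_ii a)`,
which vanishes at `q = 0`. Modulo `q` only the first factor moves. -/
theorem stringCoef_imag (hi : D.a i i ≠ 2) (hm : 0 < m) {p : ℕ} (hp : Adm D i n p) (k a b : ℕ) :
    HasVal (stringCoef D i m n p k a b) (if a = k ∧ b = p then 1 else 0) := by
  have hA := diag_nonpos hi
  have h1 : ∀ j, strA D i j = if j = 0 then 0 else 1 := fun j => by rw [strA, if_neg hi]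
  induction k generalizing a b with
  | zero =>
    rw [stringCoef_zero, primCoef]
    split_ifs with h h' h'
    · have := primSeq_imag (n := n) hi hm hp a (by omega)
      rwa [if_pos h'.1] at this
    · have := primSeq_imag (n := n) hi hm hp a (by omega)
      rwa [if_neg (by omega)] at this
    · omega
    · exact hasVal_zero
  | succ k ih =>
    have hma : 0 < m - D.a i i * a := by
      have : 0 ≤ -D.a i i * a := mul_nonneg (by omega) (by omega)
      linarith
    rw [stringCoef_succ, h1 (k + 1), if_neg (Nat.succ_ne_zero k), div_one, div_one, h1 a, h1 b]
    have v : ∀ j : ℕ, HasVal (if j = 0 then 0 else 1) (if j = 0 then 0 else 1) := fun j => by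
      split_ifs
      · exact hasVal_zero
      · exact hasVal_one
    refine (((v a).mul (ih (a - 1) b)).add
      (((qi_zpow_hasVal D i hma).mul (v b)).mul (ih a (b - 1)))).of_eq ?_
    rw [zero_mul, zero_mul, add_zero]
    rcases a with _ | a
    · simp
    · simp

/-! #### The real case -/

theorem strA_real (hi : D.a i i = 2) (j : ℕ) : strA D i j = zInt (D.qi i) j := by
  rw [strA, if_pos hi, zInt_natCast]

theorem strG_real (hi : D.a i i = 2) (j : ℕ) : strG D i m (j + 1) = zInt (D.qi i) (m - j) := by
  rw [strG, if_pos hi]; congr 1; push_cast; ring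

/-- A quotient `t ^ c [x] / [y]` of quantum integers with its order and leading coefficient. -/
theorem zInt_div_hasVal (D : BorcherdsCartanDatum I Pv) (i : I) {c x y : ℤ} (hx : 0 < x)
    (hy : 0 < y) (hc : 0 ≤ c - x + y) :
    HasVal (D.qi i ^ c * zInt (D.qi i) x / zInt (D.qi i) y)
      (if c - x + y = 0 then 1 else 0) := by
  have h0 := (generic_qi D i).1
  have hy0 := (generic_qi D i).zInt_ne_zero hy.ne'
  have e : D.qi i ^ c * zInt (D.qi i) x / zInt (D.qi i) y = D.qi i ^ (c - x + y) *
      ((D.qi i ^ (x - 1) * zInt (D.qi i) x) / (D.qi i ^ (y - 1) * zInt (D.qi i) y)) := by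
    have h1 : D.qi i ^ (y - 1) ≠ 0 := zpow_ne_zero _ h0
    have h2 : D.qi i ^ c * D.qi i ^ (y - 1) = D.qi i ^ (c - x + y) * D.qi i ^ (x - 1) := by
      rw [← zpow_add₀ h0, ← zpow_add₀ h0]; congr 1; ring
    rw [div_eq_iff hy0]
    field_simp
    linear_combination (zInt (D.qi i) x) * h2
  rw [e]
  refine ((qi_zpow_hasVal' D i hc).mul ((zInt_hasVal D i hx).div (zInt_hasVal D i hy)
    one_ne_zero)).of_eq (by simp)

/-- The coefficient functions are not cut off at `a ≤ m`, `b ≤ n`, and the commutation relation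
holds for all of them. The position in the string is minus the level. -/
theorem isString_coef (hi : D.a i i = 2) : IsString (D.qi i) 2 (m + n)
    (fun k => levelSub (-k)) (coefE D i m n) (coefF D i m) where
  e_mem k c hc a b hab := by
    rw [coefE_apply, hc _ _ (by push_cast; omega), hc _ _ (by push_cast; omega), mul_zero,
      mul_zero, add_zero]
  f_mem k c hc a b hab := by
    rw [coefF_apply]
    have h1 : strA D i a * c (a - 1) b = 0 := by
      rcases a with _ | a
      · rw [strA_zero, zero_mul]
      · rw [hc _ _ (by push_cast at *; omega), mul_zero]
    have h2 : D.qi i ^ (m - D.a i i * a) * strA D i b * c a (b - 1) = 0 := by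
      rcases b with _ | b
      · rw [strA_zero, mul_zero, zero_mul]
      · rw [hc _ _ (by push_cast at *; omega), mul_zero]
    rw [h1, h2, add_zero]
  comm k c hc := by
    have ht := generic_qi D i
    have h0 := ht.1
    funext a b
    rw [Pi.sub_apply, Pi.sub_apply, Pi.smul_apply, Pi.smul_apply, smul_eq_mul]
    -- On the level `-k` the weight is split between the two factors, so that `zInt_add` produces
    -- the powers of `q_i` by which `K_i` acts on the first factor and `K_i⁻¹` on the second.
    have e1 : zInt (D.qi i) (m + n + 2 * k) * c a b =
        zInt (D.qi i) ((n - 2 * b) + (m - 2 * a)) * c a b := by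
      by_cases hab : (a + b : ℤ) = -k
      · congr 2; omega
      · rw [hc a b hab, mul_zero, mul_zero]
    have id1 := ht.zInt_mul_add m a
    have id2 := ht.zInt_mul_add n b
    have e2 : coefE D i m n (coefF D i m c) a b = D.qi i ^ (-(n - 2 * b)) * zInt (D.qi i) (m - a) *
        (zInt (D.qi i) (a + 1) * c a b +
          D.qi i ^ (m - 2 * (a + 1)) * zInt (D.qi i) b * c (a + 1) (b - 1)) +
        zInt (D.qi i) (n - b) * (zInt (D.qi i) a * c (a - 1) (b + 1) +
          D.qi i ^ (m - 2 * a) * zInt (D.qi i) (b + 1) * c a b) := by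
      simp only [coefE_apply, coefF_apply, strA_real hi, strG_real hi, hi, Nat.add_sub_cancel]
      push_cast
      rfl
    have e3 : zInt (D.qi i) a * coefE D i m n c (a - 1) b = zInt (D.qi i) a *
        (D.qi i ^ (-(n - 2 * b)) * zInt (D.qi i) (m - a + 1) * c a b +
          zInt (D.qi i) (n - b) * c (a - 1) (b + 1)) := by
      rcases a with _ | a
      · simp [zInt_zero]
      · simp only [coefE_apply, strG_real hi, hi, Nat.add_sub_cancel]
        congr 5
        push_cast; ring
    have e4 : zInt (D.qi i) b * coefE D i m n c a (b - 1) = zInt (D.qi i) b *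
        (D.qi i ^ (-(n - 2 * (b - 1))) * zInt (D.qi i) (m - a) * c (a + 1) (b - 1) +
          zInt (D.qi i) (n - b + 1) * c a b) := by
      rcases b with _ | b
      · simp [zInt_zero]
      · simp only [coefE_apply, strG_real hi, hi, Nat.add_sub_cancel]
        congr 3
        · congr 3; push_cast; ring
        · congr 2; push_cast; ring
    have e5 : D.qi i ^ (-(n - 2 * b)) * D.qi i ^ (m - 2 * (a + 1)) =
        D.qi i ^ (m - 2 * a) * D.qi i ^ (-(n - 2 * (b - 1) : ℤ)) := by
      rw [← zpow_add₀ h0, ← zpow_add₀ h0]; congr 1; ring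
    rw [e1, ht.zInt_add, e2, coefF_apply, strA_real hi, strA_real hi, e3, mul_assoc _ _
      (coefE D i m n c a (b - 1)), e4, hi]
    linear_combination (zInt (D.qi i) (m - a) * zInt (D.qi i) b * c (a + 1) (b - 1)) * e5 -
      (D.qi i ^ (-(n - 2 * b)) * c a b) * id1 - (D.qi i ^ (m - 2 * a) * c a b) * id2

theorem coefE_stringCoef (hi : D.a i i = 2) {p : ℕ} (hp : Adm D i m p) (k : ℕ) :
    coefE D i m n (stringCoef D i m n p (k + 1)) =
      zInt (D.qi i) (m + n - 2 * p - k) • stringCoef D i m n p k := by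
  have h1 := strA_succ_ne_zero (D := D) i k
  have h2 := divFac_ne_zero (D := D) i k
  have := (isString_coef (m := m) (n := n) hi).e_f_pow (k := -(p : ℤ)) (w := primCoef D i m n p)
    (by simpa using primCoef_mem p) (coefE_primCoef hp) k
  rw [stringCoef, stringCoef, map_smul, this, (generic_qi D i).sumInt_two, ← strA_real hi,
    divFac_succ, smul_smul, smul_smul, show m + n + 2 * -(p : ℤ) - (k + 1 : ℕ) + 1 =
    m + n - 2 * p - k by push_cast; ring]
  congr 1
  field_simp

theorem stringCoef_mem (hi : D.a i i = 2) (p k : ℕ) :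
    stringCoef D i m n p k ∈ levelSub ((p : ℤ) + k) := by
  have := (isString_coef (m := m) (n := n) hi).f_pow_mem (k := -(p : ℤ)) (v := primCoef D i m n p)
    (by simpa using primCoef_mem p) k
  rw [show -(-(p : ℤ) - k) = p + k by ring] at this
  exact Submodule.smul_mem _ _ this

/-! ### The bilinear form on a tensor product of two real strings -/

variable (D i m) in
/-- The norm of the `x`-th vector of a string. -/
def strNorm (x : ℕ) : K :=
  ∏ j ∈ Finset.range x, (D.qi i ^ (m - 2 * j - 1) * zInt (D.qi i) (m - j) / zInt (D.qi i) (j + 1))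

theorem strNorm_succ (x : ℕ) : strNorm D i m (x + 1) * zInt (D.qi i) (x + 1) =
    strNorm D i m x * (D.qi i ^ (m - 2 * x - 1) * zInt (D.qi i) (m - x)) := by
  have h1 : zInt (D.qi i) (x + 1) ≠ 0 := (generic_qi D i).zInt_ne_zero (by omega)
  rw [strNorm, Finset.prod_range_succ, ← strNorm]
  field_simp

/-- The exponent `m - 2 j - 1` is the one that cancels the orders of `[m - j]` and `[j + 1]`. -/
theorem strNorm_hasVal {x : ℕ} (hx : (x : ℤ) ≤ m) : HasVal (strNorm D i m x) 1 := by
  induction x with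
  | zero => simpa [strNorm] using hasVal_one
  | succ x ih =>
    rw [strNorm, Finset.prod_range_succ, ← strNorm]
    have := (ih (by push_cast at hx; omega)).mul (zInt_div_hasVal D i (c := m - 2 * x - 1)
      (x := m - x) (y := x + 1) (by push_cast at hx; omega) (by omega) (by omega))
    refine this.of_eq ?_
    rw [if_pos (by ring), mul_one]

/-- The bilinear form on coefficient functions for `m n : ℕ`. -/
def coefForm (D : BorcherdsCartanDatum I Pv) (i : I) (m n : ℕ) (c c' : ℕ → ℕ → K) : K :=
  ∑ a ∈ Finset.range (m + 1), ∑ b ∈ Finset.range (n + 1),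
    strNorm D i m a * strNorm D i n b * c a b * c' a b

/-- Adjointness is a shift of the summation index in each factor. The term at index `0` drops out
because `[0] = 0`, and the one past the upper end because `[m - m] = [n - n] = 0`; so the finite
rectangle causes no boundary terms. -/
theorem coefForm_coefF (hi : D.a i i = 2) (m n : ℕ) (c c' : ℕ → ℕ → K) :
    coefForm D i m n (coefF D i m c) c' = coefForm D i m n c
      fun a b => D.qi i ^ ((m : ℤ) + n - 2 * a - 2 * b - 1) * coefE D i m n c' a b := by
  have h0 := (generic_qi D i).1
  have e1 : ∀ b : ℕ, ∑ a ∈ Finset.range (m + 1),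
      strNorm D i m a * strNorm D i n b * (zInt (D.qi i) a * c (a - 1) b) * c' a b =
      ∑ a ∈ Finset.range (m + 1), strNorm D i m a * strNorm D i n b * c a b *
        (D.qi i ^ ((m : ℤ) - 2 * a - 1) * zInt (D.qi i) (m - a) * c' (a + 1) b) := by
    intro b
    rw [Finset.sum_range_succ', Finset.sum_range_succ _ m]
    simp only [Nat.cast_zero, zInt_zero, zero_mul, mul_zero, add_zero, sub_self]
    refine Finset.sum_congr rfl fun a _ => ?_
    have := strNorm_succ (D := D) (i := i) (m := m) a
    rw [Nat.add_sub_cancel]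
    push_cast
    linear_combination (strNorm D i n b * c a b * c' (a + 1) b) * this
  have e2 : ∀ a : ℕ, ∑ b ∈ Finset.range (n + 1),
      strNorm D i m a * strNorm D i n b * (D.qi i ^ ((m : ℤ) - 2 * a) * zInt (D.qi i) b *
        c a (b - 1)) * c' a b =
      ∑ b ∈ Finset.range (n + 1), strNorm D i m a * strNorm D i n b * c a b *
        (D.qi i ^ ((m : ℤ) - 2 * a) * D.qi i ^ ((n : ℤ) - 2 * b - 1) *
          zInt (D.qi i) (n - b) * c' a (b + 1)) := by
    intro a
    rw [Finset.sum_range_succ', Finset.sum_range_succ _ n]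
    simp only [Nat.cast_zero, zInt_zero, zero_mul, mul_zero, add_zero, sub_self]
    refine Finset.sum_congr rfl fun b _ => ?_
    have := strNorm_succ (D := D) (i := i) (m := n) b
    rw [Nat.add_sub_cancel]
    push_cast
    linear_combination (strNorm D i m a * D.qi i ^ ((m : ℤ) - 2 * a) * c a b * c' a (b + 1)) * this
  have l1 : coefForm D i m n (coefF D i m c) c' =
      ∑ b ∈ Finset.range (n + 1), ∑ a ∈ Finset.range (m + 1),
        strNorm D i m a * strNorm D i n b * (zInt (D.qi i) a * c (a - 1) b) * c' a b +
      ∑ a ∈ Finset.range (m + 1), ∑ b ∈ Finset.range (n + 1),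
        strNorm D i m a * strNorm D i n b * (D.qi i ^ ((m : ℤ) - 2 * a) * zInt (D.qi i) b *
          c a (b - 1)) * c' a b := by
    rw [Finset.sum_comm, coefForm, ← Finset.sum_add_distrib]
    refine Finset.sum_congr rfl fun a _ => ?_
    rw [← Finset.sum_add_distrib]
    refine Finset.sum_congr rfl fun b _ => ?_
    rw [coefF_apply, strA_real hi, strA_real hi, hi]
    ring
  rw [l1, Finset.sum_congr rfl fun b _ => e1 b, Finset.sum_congr rfl fun a _ => e2 a,
    Finset.sum_comm, coefForm, ← Finset.sum_add_distrib]
  refine Finset.sum_congr rfl fun a _ => ?_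
  rw [← Finset.sum_add_distrib]
  refine Finset.sum_congr rfl fun b _ => ?_
  have p1 : D.qi i ^ ((m : ℤ) - 2 * a - 1) =
      D.qi i ^ ((m : ℤ) + n - 2 * a - 2 * b - 1) * D.qi i ^ (-((n : ℤ) - 2 * b)) := by
    rw [← zpow_add₀ h0]; congr 1; ring
  have p2 : D.qi i ^ ((m : ℤ) - 2 * a) * D.qi i ^ ((n : ℤ) - 2 * b - 1) =
      D.qi i ^ ((m : ℤ) + n - 2 * a - 2 * b - 1) := by
    rw [← zpow_add₀ h0]; congr 1; ring
  rw [coefE_apply, strG_real hi, strG_real hi, p2, p1, hi]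
  ring

theorem coefForm_smul_left (m n : ℕ) (r : K) (c c' : ℕ → ℕ → K) :
    coefForm D i m n (r • c) c' = r * coefForm D i m n c c' := by
  simp only [coefForm, Finset.mul_sum, Pi.smul_apply, smul_eq_mul]
  exact Finset.sum_congr rfl fun a _ => Finset.sum_congr rfl fun b _ => by ring

theorem coefForm_smul_right (m n : ℕ) (r : K) (c c' : ℕ → ℕ → K) :
    coefForm D i m n c (r • c') = r * coefForm D i m n c c' := by
  simp only [coefForm, Finset.mul_sum, Pi.smul_apply, smul_eq_mul]
  exact Finset.sum_congr rfl fun a _ => Finset.sum_congr rfl fun b _ => by ring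

/-- With `b = p - 1 - j`, the factor `t ^ (n - 2 b) [n - b] / [m - j]` has order `m - p + 1 > 0`. -/
theorem primSeq_real (hi : D.a i i = 2) {m n p : ℕ} (hpm : p ≤ m) (hpn : p ≤ n) (j : ℕ)
    (hj : j ≤ p) : HasVal (primSeq D i m n p j) (if j = 0 then 1 else 0) := by
  have h0 := (generic_qi D i).1
  induction j with
  | zero => simpa [primSeq] using hasVal_one
  | succ j ih =>
    obtain ⟨b, hb⟩ : ∃ b, p - j = b + 1 := ⟨p - j - 1, by omega⟩
    rw [primSeq, hb, strG_real hi, strG_real hi, show p - 1 - j = b by omega, hi,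
      mul_comm (zInt _ _)]
    have := ((ih (by omega)).mul (zInt_div_hasVal D i (c := n - 2 * b) (x := n - b) (y := m - j)
      (by omega) (by omega) (by omega))).neg
    refine this.of_eq ?_
    rw [if_neg (by omega : (n : ℤ) - 2 * b - (n - b) + (m - j) ≠ 0), mul_zero, neg_zero,
      if_neg (Nat.succ_ne_zero j)]

/-- By adjointness the norm for `k + 1` is `t ^ (m + n - 2 p - 2 k - 1) [m + n - 2 p - k] / [k + 1]`
times the norm for `k`, and this factor has order `0` and value `1`. For `k = 0` only the
coefficient of `u ⊗ f^{(p)} v` survives at `q = 0`. -/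
theorem stringCoef_norm (hi : D.a i i = 2) {m n p : ℕ} (hpm : p ≤ m) (hpn : p ≤ n) (k : ℕ)
    (hk : k + 2 * p ≤ m + n) :
    HasVal (coefForm D i m n (stringCoef D i m n p k) (stringCoef D i m n p k)) 1 := by
  have hp : Adm D i m p := by rw [Adm, if_pos hi]; exact_mod_cast hpm
  induction k with
  | zero =>
    rw [stringCoef_zero]
    have h1 : ∀ a ∈ Finset.range (m + 1), ∀ b ∈ Finset.range (n + 1),
        HasVal (strNorm D i m a * strNorm D i n b * primCoef D i m n p a b *
          primCoef D i m n p a b) (if a = 0 then (if b = p then 1 else 0) else 0) := by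
      intro a ha b hb
      rw [Finset.mem_range] at ha hb
      have hN := (strNorm_hasVal (D := D) (i := i) (m := m) (x := a) (by omega)).mul
        (strNorm_hasVal (D := D) (i := i) (m := n) (x := b) (by omega))
      rw [primCoef]
      split_ifs
      all_goals first
        | omega
        | (rw [mul_zero]; exact hasVal_zero)
        | (have := primSeq_real (D := D) hi hpm hpn a (by omega)
           refine ((hN.mul this).mul this).of_eq ?_
           first
             | (rw [if_pos (by omega)]; norm_num)
             | (rw [if_neg (by omega)]; norm_num))
    have := HasVal.sum _ fun a ha => HasVal.sum _ (h1 a ha)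
    refine this.of_eq ?_
    rw [Finset.sum_eq_single 0]
    · rw [Finset.sum_eq_single p]
      · simp
      · intro b _ hb; simp [hb]
      · intro h; exact absurd (Finset.mem_range.mpr (by omega)) h
    · intro a _ ha; simp [ha]
    · simp
  | succ k ih =>
    have hA := strA_succ_ne_zero (D := D) i k
    have e1 : stringCoef D i m n p (k + 1) =
        (strA D i (k + 1))⁻¹ • coefF D i m (stringCoef D i m n p k) := by
      rw [coefF_stringCoef, smul_smul, inv_mul_cancel₀ hA, one_smul]
    -- The string vector is supported on the level `p + k`, so the power of `q_i` in the adjoint is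
    -- constant there.
    have e2 : (fun a b : ℕ => D.qi i ^ ((m : ℤ) + n - 2 * a - 2 * b - 1) *
        coefE D i m n (stringCoef D i m n p (k + 1)) a b) =
        (D.qi i ^ ((m : ℤ) + n - 2 * p - 2 * k - 1) * zInt (D.qi i) ((m : ℤ) + n - 2 * p - k)) •
          stringCoef D i m n p k := by
      funext a b
      rw [coefE_stringCoef hi hp, Pi.smul_apply, Pi.smul_apply, Pi.smul_apply, Pi.smul_apply,
        smul_eq_mul, smul_eq_mul]
      by_cases hab : (a + b : ℤ) = p + k
      · rw [← mul_assoc]; congr 3; omega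
      · rw [stringCoef_mem hi p k a b hab]; simp
    have e3 : coefForm D i m n (stringCoef D i m n p (k + 1)) (stringCoef D i m n p (k + 1)) =
        D.qi i ^ ((m : ℤ) + n - 2 * p - 2 * k - 1) * zInt (D.qi i) ((m : ℤ) + n - 2 * p - k) /
          zInt (D.qi i) (k + 1) *
          coefForm D i m n (stringCoef D i m n p k) (stringCoef D i m n p k) := by
      nth_rewrite 1 [e1]
      rw [coefForm_smul_left, coefForm_coefF hi, e2, coefForm_smul_right, strA_real hi]
      push_cast
      ring
    rw [e3]
    refine ((zInt_div_hasVal D i (by omega) (by omega) (by omega)).mul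
      (ih (by omega))).of_eq ?_
    rw [if_pos (by ring), one_mul]

/-- If a weighted sum of squares takes the value `1` at `0`, and so does one of the squares, then
the others vanish at `0`. -/
theorem hasVal_of_sum_sq {ι : Type*} [DecidableEq ι] (s : Finset ι) (N c : ι → K)
    (hN : ∀ i ∈ s, HasVal (N i) 1) (h : HasVal (∑ i ∈ s, N i * c i ^ 2) 1) {j : ι} (hj : j ∈ s)
    (hc : HasVal (c j) 1) : ∀ i ∈ s, HasVal (c i) (if i = j then 1 else 0) := by
  have hmem := mem_A0sub_of_sum_sq s N c hN h.mem
  have hr : ∀ i, ∃ r, i ∈ s → HasVal (c i) r := fun i => by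
    by_cases hi : i ∈ s
    · obtain ⟨r, h⟩ := mem_A0sub_iff.mp (hmem i hi); exact ⟨r, fun _ => h⟩
    · exact ⟨0, fun h => absurd h hi⟩
  choose r hr using hr
  have h1 : HasVal (∑ i ∈ s, N i * c i ^ 2) (∑ i ∈ s, 1 * r i ^ 2) :=
    HasVal.sum s fun i hi => (hN i hi).mul ((hr i hi).pow 2)
  have h2 := h1.unique h
  have h3 : r j = 1 := (hr j hj).unique hc
  simp only [one_mul] at h2
  -- The squares of the rational values add up to `1`, and the square at `j` is already `1`.
  rw [← Finset.add_sum_erase _ _ hj, h3, one_pow, add_eq_left,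
    Finset.sum_eq_zero_iff_of_nonneg fun i _ => by positivity] at h2
  intro i hi
  split_ifs with hij
  · rw [hij]; exact hc
  · have := hr i hi
    rwa [show r i = 0 by simpa using h2 i (Finset.mem_erase.mpr ⟨hij, hi⟩)] at this

theorem stringCoef_sum_sq (m n p k : ℕ) :
    coefForm D i m n (stringCoef D i m n p k) (stringCoef D i m n p k) =
      ∑ x ∈ Finset.range (m + 1) ×ˢ Finset.range (n + 1),
        (strNorm D i m x.1 * strNorm D i n x.2) * stringCoef D i m n p k x.1 x.2 ^ 2 := by
  rw [coefForm, Finset.sum_product]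
  exact Finset.sum_congr rfl fun a _ => Finset.sum_congr rfl fun b _ => by ring

theorem strNorm_mul_hasVal {m n : ℕ} {x : ℕ × ℕ}
    (hx : x ∈ Finset.range (m + 1) ×ˢ Finset.range (n + 1)) :
    HasVal (strNorm D i m x.1 * strNorm D i n x.2) 1 := by
  rw [Finset.mem_product, Finset.mem_range, Finset.mem_range] at hx
  simpa using (strNorm_hasVal (D := D) (i := i) (m := m) (x := x.1) (by omega)).mul
    (strNorm_hasVal (D := D) (i := i) (m := n) (x := x.2) (by omega))

/-- The factors in the recursion `stringCoef_succ` can have poles; regularity comes from the norm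
instead. -/
theorem stringCoef_mem_A0sub (hi : D.a i i = 2) {m n p : ℕ} (hpm : p ≤ m) (hpn : p ≤ n) {k : ℕ}
    (hk : k + 2 * p ≤ m + n) {a b : ℕ} (ha : a ≤ m) (hb : b ≤ n) :
    stringCoef D i m n p k a b ∈ A0sub := by
  have h := (stringCoef_norm hi hpm hpn k hk).mem
  rw [stringCoef_sum_sq] at h
  exact mem_A0sub_of_sum_sq _ _ (fun x : ℕ × ℕ => stringCoef D i m n p k x.1 x.2)
    (fun x hx => strNorm_mul_hasVal hx) h (a, b) (by simp; omega)

/-- Modulo `q`, the vector `f_i^{(k)} w` for the primitive vector `w` of level `p` is a single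
tensor product of string vectors. -/
theorem stringCoef_real (hi : D.a i i = 2) {m n p : ℕ} (hpm : p ≤ m) (hpn : p ≤ n) (k : ℕ)
    (hk : k + 2 * p ≤ m + n) (a b : ℕ) (ha : a ≤ m) (hb : b ≤ n) :
    HasVal (stringCoef D i m n p k a b)
      (if (a, b) = (min k (m - p), p + k - min k (m - p)) then 1 else 0) := by
  -- Since the norm has value `1`, one coefficient with value `1` forces all others to vanish at `q
  -- = 0`. Only the leading coefficient has to be followed.
  suffices lead : HasVal (stringCoef D i m n p k (min k (m - p)) (p + k - min k (m - p))) 1 by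
    have h := stringCoef_norm (D := D) hi hpm hpn k hk
    rw [stringCoef_sum_sq] at h
    exact hasVal_of_sum_sq _ _ (fun x : ℕ × ℕ => stringCoef D i m n p k x.1 x.2)
      (fun x hx => strNorm_mul_hasVal hx) h (j := (min k (m - p), p + k - min k (m - p)))
      (by simp; omega) lead (a, b) (by simp; omega)
  clear ha hb a b
  induction k with
  | zero =>
    rw [stringCoef_zero, Nat.zero_min, primCoef, if_pos (by omega)]
    exact primSeq_real (D := D) hi hpm hpn 0 (Nat.zero_le p)
  | succ k ih =>
    have ih := ih (by omega)
    have full : ∀ a b : ℕ, a ≤ m → b ≤ n → HasVal (stringCoef D i m n p k a b)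
        (if (a, b) = (min k (m - p), p + k - min k (m - p)) then 1 else 0) := by
      intro a b ha hb
      have h := stringCoef_norm (D := D) hi hpm hpn k (by omega)
      rw [stringCoef_sum_sq] at h
      exact hasVal_of_sum_sq _ _ (fun x : ℕ × ℕ => stringCoef D i m n p k x.1 x.2)
        (fun x hx => strNorm_mul_hasVal hx) h (j := (min k (m - p), p + k - min k (m - p)))
        (by simp; omega) ih (a, b) (by simp; omega)
    rw [stringCoef_succ, strA_real hi, strA_real hi, strA_real hi, hi]
    -- Up to `k + 1 = m - p` the first factor moves: the competing term is a scalar regular at `0`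
    -- times a coefficient that is not leading.
    by_cases hkm : k + 1 ≤ m - p
    · rw [min_eq_left hkm, show p + (k + 1) - (k + 1) = p by omega,
        div_self ((generic_qi D i).zInt_ne_zero (by push_cast; omega)), one_mul,
        Nat.add_sub_cancel]
      rw [min_eq_left (by omega), Nat.add_sub_cancel] at ih
      have h2 : HasVal (D.qi i ^ ((m : ℤ) - 2 * (k + 1 : ℕ)) * zInt (D.qi i) p /
          zInt (D.qi i) (k + 1 : ℕ) * stringCoef D i m n p k (k + 1) (p - 1)) 0 := by
        rcases p with _ | p
        · simpa [zInt_zero] using hasVal_zero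
        · have h3 := full (k + 1) p (by omega) (by omega)
          rw [if_neg (by simp only [Prod.mk.injEq]; omega)] at h3
          refine ((zInt_div_hasVal D i (by omega) (by omega)
            (by push_cast; omega)).mul h3).of_eq (mul_zero _)
      simpa using ih.add h2
    -- From here on the second factor moves: `[m - p] / [k + 1]` vanishes at `0` and multiplies a
    -- regular coefficient, while `t ^ (m - 2 (m - p)) [y + 1] / [k + 1]` has value `1`.
    · obtain ⟨y, hy⟩ : ∃ y, p + k - min k (m - p) = y := ⟨_, rfl⟩
      rw [hy] at ih
      rw [min_eq_right (by omega)] at ih hy ⊢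
      rw [show p + (k + 1) - (m - p) = y + 1 by omega, Nat.add_sub_cancel]
      have h2 : HasVal (zInt (D.qi i) (m - p : ℕ) / zInt (D.qi i) (k + 1 : ℕ) *
          stringCoef D i m n p k (m - p - 1) (y + 1)) 0 := by
        rcases hx : m - p with _ | x
        · simpa [zInt_zero] using hasVal_zero
        · obtain ⟨r, h3⟩ := mem_A0sub_iff.mp (stringCoef_mem_A0sub (D := D) (i := i) hi hpm hpn
            (k := k) (by omega) (a := x) (b := y + 1) (by omega) (by omega))
          have h4 := zInt_div_hasVal D i (c := 0) (x := (x + 1 : ℕ)) (y := (k + 1 : ℕ))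
            (by omega) (by omega) (by omega)
          rw [zpow_zero, one_mul, if_neg (by omega)] at h4
          simpa using h4.mul h3
      have h3 := zInt_div_hasVal D i (c := (m : ℤ) - 2 * (m - p : ℕ)) (x := (y + 1 : ℕ))
        (y := (k + 1 : ℕ)) (by omega) (by omega) (by omega)
      rw [if_pos (by omega)] at h3
      simpa using h2.add (h3.mul ih)

end model

/-! ### Tensor products of two strings -/

section tensorStrings
variable {I Pv : Type*} [AddCommGroup Pv] {D : BorcherdsCartanDatum I Pv}
  {M₁ M₂ M : Type*} [AddCommGroup M₁] [Module K M₁] [AddCommGroup M₂] [Module K M₂]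
  [AddCommGroup M] [Module K M]

/-- `U_q(𝔤)` acts on the values of the bilinear map `τ` through the comultiplication. -/
structure IsTensorAction (ρ₁ : Rep D M₁) (ρ₂ : Rep D M₂) (ρ : Rep D M)
    (τ : M₁ →ₗ[K] M₂ →ₗ[K] M) : Prop where
  e : ∀ i x y, ρ (uE D i) (τ x y) = τ (ρ₁ (uE D i) x) (ρ₂ (uKinv D i) y) + τ x (ρ₂ (uE D i) y)
  f : ∀ i x y, ρ (uF D i) (τ x y) = τ (ρ₁ (uF D i) x) y + τ (ρ₁ (uK D i) x) (ρ₂ (uF D i) y)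
  q : ∀ h x y, ρ (uQ D h) (τ x y) = τ (ρ₁ (uQ D h) x) (ρ₂ (uQ D h) y)

variable {ρ₁ : Rep D M₁} {ρ₂ : Rep D M₂} {ρ : Rep D M} {τ : M₁ →ₗ[K] M₂ →ₗ[K] M}

theorem IsTensorAction.mem_weightSpace (hτ : IsTensorAction ρ₁ ρ₂ ρ τ)
    {μ ν : Module.Dual ℤ Pv} {x : M₁} {y : M₂} (hx : x ∈ weightSpace ρ₁ μ)
    (hy : y ∈ weightSpace ρ₂ ν) : τ x y ∈ weightSpace ρ (μ + ν) := by
  rw [QGKM.mem_weightSpace] at *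
  intro h
  rw [hτ.q, hx, hy, map_smul, map_smul, LinearMap.smul_apply, smul_smul, ← zpow_add₀ q_ne_zero,
    LinearMap.add_apply, add_comm]

variable (ρ₁ ρ₂ τ) in
/-- The tensor product of members of two strings. -/
def strTensor (i : I) (u : M₁) (v : M₂) (a b : ℕ) : M := τ (fDiv ρ₁ i a u) (fDiv ρ₂ i b v)

variable (ρ₁ ρ₂ τ) in
/-- The combination of tensor products of members of two strings of level `l` with given
coefficients. -/
def strVec (i : I) (u : M₁) (v : M₂) (c : ℕ → ℕ → K) (l : ℕ) : M :=
  ∑ x ∈ Finset.HasAntidiagonal.antidiagonal l, c x.1 x.2 • strTensor ρ₁ ρ₂ τ i u v x.1 x.2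

variable {i : I} {μ ν : Module.Dual ℤ Pv} {u : M₁} {v : M₂}

theorem apply_fDiv_h (i : I) (μ : Module.Dual ℤ Pv) (n : ℕ) :
    (μ - n • D.α i) (D.h i) = μ (D.h i) - D.a i i * n := by
  simp [D.α_h, mul_comm]

theorem f_strTensor (hτ : IsTensorAction ρ₁ ρ₂ ρ τ) (hu : u ∈ prim ρ₁ i μ) (a b : ℕ) :
    ρ (uF D i) (strTensor ρ₁ ρ₂ τ i u v a b) =
      strA D i (a + 1) • strTensor ρ₁ ρ₂ τ i u v (a + 1) b +
      (D.qi i ^ (μ (D.h i) - D.a i i * a) * strA D i (b + 1)) •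
        strTensor ρ₁ ρ₂ τ i u v a (b + 1) := by
  rw [strTensor, hτ.f, f_fDiv, f_fDiv, uK_apply (fDiv_mem_weightSpace hu.2 a), apply_fDiv_h]
  simp only [map_smul, LinearMap.smul_apply, smul_smul, strTensor, mul_comm]

/-- Links the coefficient model with the module. Shifting the antidiagonal produces no boundary
terms, because `strA` vanishes at `0`. -/
theorem f_strVec (hτ : IsTensorAction ρ₁ ρ₂ ρ τ) (hu : u ∈ prim ρ₁ i μ) (c : ℕ → ℕ → K) (l : ℕ) :
    ρ (uF D i) (strVec ρ₁ ρ₂ τ i u v c l) =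
      strVec ρ₁ ρ₂ τ i u v (coefF D i (μ (D.h i)) c) (l + 1) := by
  have h1 : strVec ρ₁ ρ₂ τ i u v (coefF D i (μ (D.h i)) c) (l + 1) =
      ∑ x ∈ Finset.HasAntidiagonal.antidiagonal (l + 1), (strA D i x.1 * c (x.1 - 1) x.2) •
        strTensor ρ₁ ρ₂ τ i u v x.1 x.2 +
      ∑ x ∈ Finset.HasAntidiagonal.antidiagonal (l + 1), (D.qi i ^ (μ (D.h i) - D.a i i * x.1) *
        strA D i x.2 * c x.1 (x.2 - 1)) • strTensor ρ₁ ρ₂ τ i u v x.1 x.2 := by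
    rw [strVec, ← Finset.sum_add_distrib]
    exact Finset.sum_congr rfl fun x _ => by rw [coefF_apply, add_smul]
  rw [h1, Finset.Nat.sum_antidiagonal_succ, Finset.Nat.sum_antidiagonal_succ', strA_zero,
    strVec, map_sum]
  simp only [zero_mul, mul_zero, zero_smul, zero_add, Nat.add_sub_cancel]
  rw [← Finset.sum_add_distrib]
  refine Finset.sum_congr rfl fun x _ => ?_
  rw [map_smul, f_strTensor hτ hu, smul_add, smul_smul, smul_smul, mul_comm, mul_comm (c _ _)]

/-- Here the boundary terms of the antidiagonal vanish because `u` and `v` are primitive. -/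
theorem e_strVec (hτ : IsTensorAction ρ₁ ρ₂ ρ τ) (hu : u ∈ prim ρ₁ i μ) (hv : v ∈ prim ρ₂ i ν)
    (c : ℕ → ℕ → K) (l : ℕ) :
    ρ (uE D i) (strVec ρ₁ ρ₂ τ i u v c (l + 1)) =
      strVec ρ₁ ρ₂ τ i u v (coefE D i (μ (D.h i)) (ν (D.h i)) c) l := by
  have h1 : ∀ x : ℕ × ℕ, ρ (uE D i) (c x.1 x.2 • strTensor ρ₁ ρ₂ τ i u v x.1 x.2) =
      c x.1 x.2 • τ (ρ₁ (uE D i) (fDiv ρ₁ i x.1 u))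
        (ρ₂ (uKinv D i) (fDiv ρ₂ i x.2 v)) +
      c x.1 x.2 • τ (fDiv ρ₁ i x.1 u) (ρ₂ (uE D i) (fDiv ρ₂ i x.2 v)) := fun x => by
    rw [map_smul, strTensor, hτ.e, smul_add]
  rw [strVec, map_sum, Finset.sum_congr rfl fun x _ => h1 x, Finset.sum_add_distrib,
    Finset.Nat.sum_antidiagonal_succ, Finset.Nat.sum_antidiagonal_succ', fDiv_zero, fDiv_zero,
    (mem_prim.mp hu).1, (mem_prim.mp hv).1, map_zero, map_zero, LinearMap.zero_apply, smul_zero,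
    smul_zero, zero_add, zero_add, ← Finset.sum_add_distrib, strVec]
  refine Finset.sum_congr rfl fun x _ => ?_
  rw [e_fDiv hu, e_fDiv hv, uKinv_apply (fDiv_mem_weightSpace hv.2 x.2), apply_fDiv_h,
    coefE_apply, add_smul]
  simp only [map_smul, LinearMap.smul_apply, smul_smul, strTensor]
  congr 2 <;> ring

variable (ρ₁ ρ₂ τ) in
/-- The primitive vector of level `p` in the tensor product of two strings. -/
def primVec (i : I) (μ ν : Module.Dual ℤ Pv) (u : M₁) (v : M₂) (p : ℕ) : M :=
  strVec ρ₁ ρ₂ τ i u v (primCoef D i (μ (D.h i)) (ν (D.h i)) p) p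

theorem primVec_mem (hτ : IsTensorAction ρ₁ ρ₂ ρ τ) (hu : u ∈ prim ρ₁ i μ)
    (hv : v ∈ prim ρ₂ i ν) {p : ℕ} (hp : Adm D i (μ (D.h i)) p) :
    primVec ρ₁ ρ₂ τ i μ ν u v p ∈ prim ρ i (μ + ν - p • D.α i) := by
  refine mem_prim.mpr ⟨?_, ?_⟩
  · rcases p with _ | p
    · simp [primVec, strVec, strTensor, fDiv_zero, hτ.e, (mem_prim.mp hu).1, (mem_prim.mp hv).1]
    · rw [primVec, e_strVec hτ hu hv, coefE_primCoef hp]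
      simp [strVec]
  · rw [primVec, strVec]
    refine Submodule.sum_mem _ fun x hx => Submodule.smul_mem _ _ ?_
    have := hτ.mem_weightSpace (fDiv_mem_weightSpace (i := i) hu.2 x.1)
      (fDiv_mem_weightSpace (i := i) hv.2 x.2)
    rwa [show μ - x.1 • D.α i + (ν - x.2 • D.α i) = μ + ν - p • D.α i by
      rw [← Finset.HasAntidiagonal.mem_antidiagonal.mp hx, add_smul]; abel] at this

theorem strVec_smul (c : ℕ → ℕ → K) (r : K) (l : ℕ) :
    strVec ρ₁ ρ₂ τ i u v (r • c) l = r • strVec ρ₁ ρ₂ τ i u v c l := by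
  simp [strVec, Finset.smul_sum, smul_smul]

theorem fDiv_primVec (hτ : IsTensorAction ρ₁ ρ₂ ρ τ) (hu : u ∈ prim ρ₁ i μ) (p k : ℕ) :
    fDiv ρ i k (primVec ρ₁ ρ₂ τ i μ ν u v p) =
      strVec ρ₁ ρ₂ τ i u v (stringCoef D i (μ (D.h i)) (ν (D.h i)) p k) (p + k) := by
  induction k with
  | zero => rw [fDiv_zero, stringCoef_zero, primVec, add_zero]
  | succ k ih =>
    have h1 := strA_succ_ne_zero (D := D) i k
    have h2 := f_fDiv (ρ := ρ) i k (primVec ρ₁ ρ₂ τ i μ ν u v p)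
    rw [ih, f_strVec hτ hu, coefF_stringCoef, strVec_smul] at h2
    exact (smul_right_injective M h1 h2).symm

variable (D) in
/-- The indices of the non-zero tensor products of level `l`. -/
def LevelIdx (i : I) (m n : ℤ) (l : ℕ) : Type :=
  {x : ℕ × ℕ // x.1 + x.2 = l ∧ Adm D i m x.1 ∧ Adm D i n x.2}

/-- The finiteness needed for Nakayama's lemma in `kash_strTensor`. -/
instance (i : I) (m n : ℤ) (l : ℕ) : Finite (LevelIdx D i m n l) :=
  Set.Finite.to_subtype ((Finset.HasAntidiagonal.antidiagonal l).finite_toSet.subset fun _ hx =>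
    Finset.mem_coe.mpr (Finset.HasAntidiagonal.mem_antidiagonal.mpr hx.1))

variable (ρ₁ ρ₂ τ) in
/-- The lattice generated by the tensor products of level `l` of members of two strings. -/
def levelLattice (i : I) (μ ν : Module.Dual ℤ Pv) (u : M₁) (v : M₂) (l : ℕ) : QLattice M :=
  Submodule.span A0 (Set.range fun x : LevelIdx D i (μ (D.h i)) (ν (D.h i)) l =>
    strTensor ρ₁ ρ₂ τ i u v x.1.1 x.1.2)

theorem strTensor_mem_levelLattice (h₁ : IsOInt ρ₁) (h₂ : IsOInt ρ₂) (hu : u ∈ prim ρ₁ i μ)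
    (hv : v ∈ prim ρ₂ i ν) {a b l : ℕ} (hl : a + b = l) :
    strTensor ρ₁ ρ₂ τ i u v a b ∈ levelLattice ρ₁ ρ₂ τ i μ ν u v l := by
  by_cases ha : Adm D i (μ (D.h i)) a
  · by_cases hb : Adm D i (ν (D.h i)) b
    · exact Submodule.subset_span ⟨⟨(a, b), hl, ha, hb⟩, rfl⟩
    · rw [strTensor, fDiv_eq_zero h₂ hv hb, map_zero]; exact Submodule.zero_mem _
  · rw [strTensor, fDiv_eq_zero h₁ hu ha, map_zero]; exact Submodule.zero_mem _

/-- Outside the admissible positions the tensor products are zero, so nothing is required of their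
coefficients. -/
theorem strVec_sub_mem (h₁ : IsOInt ρ₁) (h₂ : IsOInt ρ₂) (hu : u ∈ prim ρ₁ i μ)
    (hv : v ∈ prim ρ₂ i ν) {c : ℕ → ℕ → K} {l a b : ℕ} (hl : a + b = l)
    (hc : ∀ a' b', a' + b' = l → Adm D i (μ (D.h i)) a' → Adm D i (ν (D.h i)) b' →
      HasVal (c a' b') (if (a', b') = (a, b) then 1 else 0)) :
    strVec ρ₁ ρ₂ τ i u v c l - strTensor ρ₁ ρ₂ τ i u v a b ∈
      qMul (levelLattice ρ₁ ρ₂ τ i μ ν u v l) := by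
  classical
  have h1 : strTensor ρ₁ ρ₂ τ i u v a b = ∑ x ∈ Finset.HasAntidiagonal.antidiagonal l,
      (if x = (a, b) then (1 : K) else 0) • strTensor ρ₁ ρ₂ τ i u v x.1 x.2 := by
    rw [Finset.sum_eq_single (a, b)]
    · rw [if_pos rfl, one_smul]
    · intro x _ hx; rw [if_neg hx, zero_smul]
    · intro h; exact absurd (Finset.HasAntidiagonal.mem_antidiagonal.mpr hl) h
  rw [h1, strVec, ← Finset.sum_sub_distrib]
  refine Submodule.sum_mem _ fun x hx => ?_
  rw [← sub_smul]
  have hx := Finset.HasAntidiagonal.mem_antidiagonal.mp hx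
  by_cases ha : Adm D i (μ (D.h i)) x.1
  · by_cases hb : Adm D i (ν (D.h i)) x.2
    · refine HasVal.smul_mem_qMul ?_ (strTensor_mem_levelLattice h₁ h₂ hu hv hx)
      have h2 := hc x.1 x.2 hx ha hb
      have h3 : HasVal (if x = (a, b) then (1 : K) else 0) (if x = (a, b) then 1 else 0) := by
        split_ifs
        · exact hasVal_one
        · exact hasVal_zero
      exact (h2.sub h3).of_eq (sub_self _)
    · rw [strTensor, fDiv_eq_zero h₂ hv hb, map_zero, smul_zero]; exact Submodule.zero_mem _
  · rw [strTensor, fDiv_eq_zero h₁ hu ha, map_zero, LinearMap.zero_apply, smul_zero]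
    exact Submodule.zero_mem _

/-! ### The tensor product rule for two strings -/

variable (D) in
/-- The condition `φ_i > b` for the `a`-th member of a string of highest weight `m`. -/
def PhiGt (i : I) (m : ℤ) (a b : ℕ) : Prop := if D.a i i = 2 then (a + b : ℤ) < m else 0 < m

variable (D) in
/-- The condition `φ_i ≥ b` for the `a`-th member of a string of highest weight `m`. -/
def PhiGe (i : I) (m : ℤ) (a b : ℕ) : Prop :=
  if D.a i i = 2 then (a + b : ℤ) ≤ m else b = 0 ∨ 0 < m

open Classical in
variable (ρ₁ ρ₂ τ) in
/-- The expected value of `f̃_i` on a tensor product of members of two strings. -/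
def tensorF (i : I) (m : ℤ) (u : M₁) (v : M₂) (a b : ℕ) : M :=
  if PhiGt D i m a b then strTensor ρ₁ ρ₂ τ i u v (a + 1) b
  else strTensor ρ₁ ρ₂ τ i u v a (b + 1)

open Classical in
variable (ρ₁ ρ₂ τ) in
/-- The expected value of `ẽ_i` on a tensor product of members of two strings. -/
def tensorE (i : I) (m : ℤ) (u : M₁) (v : M₂) (a b : ℕ) : M :=
  if PhiGe D i m a b then (if a = 0 then 0 else strTensor ρ₁ ρ₂ τ i u v (a - 1) b)
  else strTensor ρ₁ ρ₂ τ i u v a (b - 1)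

/-- In the real case the strings in a tensor product of two strings are congruent to explicit
tensor products modulo `q`. -/
theorem fDiv_primVec_real (h₁ : IsOInt ρ₁) (h₂ : IsOInt ρ₂) (hτ : IsTensorAction ρ₁ ρ₂ ρ τ)
    (hu : u ∈ prim ρ₁ i μ) (hv : v ∈ prim ρ₂ i ν) (hi : D.a i i = 2) {m n : ℕ}
    (hm : μ (D.h i) = m) (hn : ν (D.h i) = n) {p k : ℕ} (hpm : p ≤ m) (hpn : p ≤ n)
    (hk : k + 2 * p ≤ m + n) {a b : ℕ} (ha : min k (m - p) = a) (hab : a + b = p + k) :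
    fDiv ρ i k (primVec ρ₁ ρ₂ τ i μ ν u v p) - strTensor ρ₁ ρ₂ τ i u v a b ∈
      qMul (levelLattice ρ₁ ρ₂ τ i μ ν u v (p + k)) := by
  rw [fDiv_primVec hτ hu]
  refine strVec_sub_mem h₁ h₂ hu hv hab fun a' b' _ ha' hb' => ?_
  rw [Adm, if_pos hi] at ha' hb'
  rw [hm, hn]
  have := stringCoef_real (D := D) hi hpm hpn k hk a' b' (by omega) (by omega)
  rwa [ha, show p + k - a = b by omega] at this

theorem fDiv_primVec_imag (h₁ : IsOInt ρ₁) (h₂ : IsOInt ρ₂) (hτ : IsTensorAction ρ₁ ρ₂ ρ τ)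
    (hu : u ∈ prim ρ₁ i μ) (hv : v ∈ prim ρ₂ i ν) (hi : D.a i i ≠ 2) (hm : 0 < μ (D.h i))
    {p : ℕ} (hp : Adm D i (ν (D.h i)) p) (k : ℕ) :
    fDiv ρ i k (primVec ρ₁ ρ₂ τ i μ ν u v p) - strTensor ρ₁ ρ₂ τ i u v k p ∈
      qMul (levelLattice ρ₁ ρ₂ τ i μ ν u v (p + k)) := by
  rw [fDiv_primVec hτ hu]
  refine strVec_sub_mem h₁ h₂ hu hv (add_comm k p) fun a' b' _ _ _ => ?_
  simpa using stringCoef_imag hi hm hp k a' b'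

theorem levelLattice_le {L : QLattice M}
    (hL : ∀ a b, strTensor ρ₁ ρ₂ τ i u v a b ∈ L) (l : ℕ) :
    levelLattice ρ₁ ρ₂ τ i μ ν u v l ≤ L := by
  rw [levelLattice, Submodule.span_le]
  rintro _ ⟨x, rfl⟩
  exact hL _ _

theorem prim_nonneg {M : Type*} [AddCommGroup M] [Module K M] {ρ : Rep D M} (hO : IsOInt ρ)
    {w : M} (hw : w ∈ prim ρ i μ) (hw0 : w ≠ 0) (hi : D.a i i ≠ 2) : 0 ≤ μ (D.h i) :=
  hO.nonneg i (diag_nonpos hi) μ fun hb => hw0 (by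
    have := hw.2; rw [hb] at this; simpa using this)

/-- At weight `0` the operator `f_i` kills `u` and `K_i` fixes it, so `f_i` acts on the second
factor alone, exactly and not only modulo `q`. -/
theorem fDiv_tmul_imag (h₁ : IsOInt ρ₁) (hτ : IsTensorAction ρ₁ ρ₂ ρ τ) (hu : u ∈ prim ρ₁ i μ)
    (hi : D.a i i ≠ 2) (hμ : μ (D.h i) = 0) (k : ℕ) :
    fDiv ρ i k (τ u v) = strTensor ρ₁ ρ₂ τ i u v 0 k := by
  have h : ∀ k, (ρ (uF D i) ^ k) (τ u v) = τ u ((ρ₂ (uF D i) ^ k) v) := fun k => by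
    induction k with
    | zero => simp
    | succ k ih =>
      rw [pow_succ', Module.End.mul_apply, ih, hτ.f, h₁.f_zero i (diag_nonpos hi) μ hμ u hu.2,
        uK_apply hu.2, hμ, pow_succ', Module.End.mul_apply]
      simp
  rw [strTensor, fDiv_zero, fDiv_eq, fDiv_eq, LinearMap.smul_apply, LinearMap.smul_apply, map_smul,
    h]

/-- Each tensor product of members of two strings is congruent modulo `q` to a member of a string,
with the expected neighbours. -/
theorem exists_string (h₁ : IsOInt ρ₁) (h₂ : IsOInt ρ₂) (hO : IsOInt ρ)
    (hτ : IsTensorAction ρ₁ ρ₂ ρ τ) (hu : u ∈ prim ρ₁ i μ) (hv : v ∈ prim ρ₂ i ν) {L : QLattice M}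
    (hL : ∀ a b, strTensor ρ₁ ρ₂ τ i u v a b ∈ L) {a b : ℕ} (ha : Adm D i (μ (D.h i)) a)
    (hb : Adm D i (ν (D.h i)) b) (hu0 : u ≠ 0) (hv0 : v ≠ 0) :
    ∃ (l : Module.Dual ℤ Pv) (w : M) (k : ℕ), w ∈ prim ρ i l ∧ Adm D i (l (D.h i)) k ∧
      fDiv ρ i k w - strTensor ρ₁ ρ₂ τ i u v a b ∈
        qMul (levelLattice ρ₁ ρ₂ τ i μ ν u v (a + b)) ∧
      fDiv ρ i (k + 1) w - tensorF ρ₁ ρ₂ τ i (μ (D.h i)) u v a b ∈ qMul L ∧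
      (if k = 0 then 0 else fDiv ρ i (k - 1) w) - tensorE ρ₁ ρ₂ τ i (μ (D.h i)) u v a b ∈
        qMul L := by
  have up := fun l => qMul_mono (levelLattice_le (μ := μ) (ν := ν) hL l)
  by_cases hi : D.a i i = 2
  · have ha' := ha
    have hb' := hb
    rw [Adm, if_pos hi] at ha' hb'
    obtain ⟨m, hm⟩ : ∃ m : ℕ, μ (D.h i) = m := ⟨(μ (D.h i)).toNat, by omega⟩
    obtain ⟨n, hn⟩ : ∃ n : ℕ, ν (D.h i) = n := ⟨(ν (D.h i)).toNat, by omega⟩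
    have wt : ∀ p : ℕ, (μ + ν - p • D.α i) (D.h i) = m + n - 2 * p := fun p => by
      rw [apply_fDiv_h, LinearMap.add_apply, hm, hn, hi]
    have real := fun {p k a b : ℕ} => fDiv_primVec_real h₁ h₂ hτ hu hv hi hm hn (p := p) (k := k)
      (a := a) (b := b)
    have zero : ∀ {p k : ℕ}, p ≤ m → m + n < k + 2 * p →
        fDiv ρ i k (primVec ρ₁ ρ₂ τ i μ ν u v p) = 0 := fun {p k} hp hk =>
      fDiv_eq_zero hO (primVec_mem hτ hu hv (by rw [Adm, if_pos hi]; omega)) (by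
        rw [Adm, if_pos hi, wt]; omega)
    have zero' : ∀ a : ℕ, strTensor ρ₁ ρ₂ τ i u v a (n + 1) = 0 := fun a => by
      rw [strTensor, fDiv_eq_zero h₂ hv (by rw [Adm, if_pos hi]; push_cast; omega), map_zero]
    -- The position `k` on the string of level `p` has to satisfy `p + k = a + b` and `min k (m - p)
    -- = a`. This gives `p = b`, `k = a` if `a + b ≤ m`, and `p = m - a`, `k = 2 a + b - m`
    -- otherwise.
    by_cases hab : a + b ≤ m
    · refine ⟨_, primVec ρ₁ ρ₂ τ i μ ν u v b, a, primVec_mem hτ hu hv (by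
        rw [Adm, if_pos hi]; omega), by rw [Adm, if_pos hi, wt]; omega, ?_, ?_, ?_⟩
      · rw [add_comm a b]
        exact real (by omega) (by omega) (by omega) (by omega) (by omega)
      · rw [tensorF, PhiGt, if_pos hi]
        split_ifs with hc
        · exact up _ (real (by omega) (by omega) (by omega) (by omega) (by omega))
        -- At `b = n` the second string ends, and so does the string of the primitive vector: both
        -- sides are zero.
        · by_cases hbn : b = n
          · rw [hbn, zero' a, zero (by omega) (by omega), sub_zero]; exact Submodule.zero_mem _
          · exact up _ (real (by omega) (by omega) (by omega) (by omega) (by omega))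
      · rw [tensorE, PhiGe, if_pos hi, if_pos (show (a + b : ℤ) ≤ μ (D.h i) by omega)]
        split_ifs with hc
        · rw [sub_zero]; exact Submodule.zero_mem _
        · exact up _ (real (by omega) (by omega) (by omega) (by omega) (by omega))
    · refine ⟨_, primVec ρ₁ ρ₂ τ i μ ν u v (m - a), 2 * a + b - m, primVec_mem hτ hu hv (by
        rw [Adm, if_pos hi]; omega), by rw [Adm, if_pos hi, wt]; omega, ?_, ?_, ?_⟩
      · rw [show a + b = (m - a) + (2 * a + b - m) by omega]
        exact real (by omega) (by omega) (by omega) (by omega) (by omega)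
      · rw [tensorF, PhiGt, if_pos hi, if_neg (by omega)]
        by_cases hbn : b = n
        · rw [hbn, zero' a, zero (by omega) (by omega), sub_zero]; exact Submodule.zero_mem _
        · exact up _ (real (by omega) (by omega) (by omega) (by omega) (by omega))
      · rw [tensorE, PhiGe, if_pos hi, if_neg (show ¬ (a + b : ℤ) ≤ μ (D.h i) by omega),
          if_neg (show ¬ 2 * a + b - m = 0 by omega)]
        exact up _ (real (by omega) (by omega) (by omega) (by omega) (by omega))
  · have hμ := prim_nonneg h₁ hu hu0 hi
    have hν := prim_nonneg h₂ hv hv0 hi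
    by_cases hm : 0 < μ (D.h i)
    -- For positive weight the first string never ends, so `b` is the level and `a` the position.
    · have imag := fun {p : ℕ} => fDiv_primVec_imag h₁ h₂ hτ hu hv hi hm (p := p)
      refine ⟨_, primVec ρ₁ ρ₂ τ i μ ν u v b, a, primVec_mem hτ hu hv (by
        rw [Adm, if_neg hi]; exact Or.inr hm), ?_, ?_, ?_, ?_⟩
      · rw [Adm, if_neg hi, apply_fDiv_h, LinearMap.add_apply]
        have hA := diag_nonpos hi
        right
        have : 0 ≤ -D.a i i * b := mul_nonneg (by omega) (by omega)
        linarith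
      · rw [add_comm a b]
        exact imag hb a
      · rw [tensorF, PhiGt, if_neg hi, if_pos hm]
        exact up _ (imag hb (a + 1))
      · rw [tensorE, PhiGe, if_neg hi, if_pos (Or.inr hm)]
        split_ifs with hc
        · rw [sub_zero]; exact Submodule.zero_mem _
        · exact up _ (imag hb (a - 1))
    -- At weight `0` the string of `u` is reduced to `u`; hence `a = 0`, and the string through `u ⊗
    -- v` is that of `v`.
    · have ha' := ha
      rw [Adm, if_neg hi] at ha'
      have ha0 : a = 0 := ha'.resolve_right hm
      subst ha0
      have hμ0 : μ (D.h i) = 0 := by omega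
      have hf := fDiv_tmul_imag h₁ hτ hu hi hμ0 (v := v)
      refine ⟨μ + ν, τ u v, b, ?_, ?_, ?_, ?_, ?_⟩
      · have := primVec_mem hτ hu hv (p := 0) ha
        simpa [primVec, strVec, strTensor, fDiv_zero, primCoef, primSeq] using this
      · rwa [LinearMap.add_apply, hμ0, zero_add]
      · rw [hf, sub_self]; exact Submodule.zero_mem _
      · rw [tensorF, PhiGt, if_neg hi, if_neg hm, hf, sub_self]; exact Submodule.zero_mem _
      · rw [tensorE, PhiGe, if_neg hi]
        by_cases hb0 : b = 0
        · simp [hb0]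
        · rw [if_neg hb0, if_neg (by omega), hf, sub_self]; exact Submodule.zero_mem _

/-- The action of `f̃_i` and `ẽ_i` on tensor products of members of two strings, modulo `q`. -/
theorem kash_strTensor (h₁ : IsOInt ρ₁) (h₂ : IsOInt ρ₂) (hO : IsOInt ρ)
    (hτ : IsTensorAction ρ₁ ρ₂ ρ τ) (hu : u ∈ prim ρ₁ i μ) (hv : v ∈ prim ρ₂ i ν) {L : QLattice M}
    (hL : ∀ a b, strTensor ρ₁ ρ₂ τ i u v a b ∈ L) {a b : ℕ} (ha : Adm D i (μ (D.h i)) a)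
    (hb : Adm D i (ν (D.h i)) b) (hu0 : u ≠ 0) (hv0 : v ≠ 0) :
    kashF ρ i (strTensor ρ₁ ρ₂ τ i u v a b) - tensorF ρ₁ ρ₂ τ i (μ (D.h i)) u v a b ∈ qMul L ∧
    kashE ρ i (strTensor ρ₁ ρ₂ τ i u v a b) - tensorE ρ₁ ρ₂ τ i (μ (D.h i)) u v a b ∈ qMul L := by
  -- String vectors are chosen for all pairs of the level `a + b`, as the Nakayama argument treats a
  -- whole level at once.
  choose l w k hw hk h0 hF hE using fun x : LevelIdx D i (μ (D.h i)) (ν (D.h i)) (a + b) =>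
    exists_string h₁ h₂ hO hτ hu hv hL x.2.2.1 x.2.2.2 hu0 hv0
  have h0' : ∀ x, fDiv ρ i (k x) (w x) - strTensor ρ₁ ρ₂ τ i u v x.1.1 x.1.2 ∈
      qMul (levelLattice ρ₁ ρ₂ τ i μ ν u v (a + b)) := fun x => by
    have := h0 x; rwa [x.2.1] at this
  constructor
  · refine apply_sub_mem_qMul (fun x : LevelIdx D i (μ (D.h i)) (ν (D.h i)) (a + b) =>
      strTensor ρ₁ ρ₂ τ i u v x.1.1 x.1.2) (fun x => fDiv ρ i (k x) (w x))
      (fun x => tensorF ρ₁ ρ₂ τ i (μ (D.h i)) u v x.1.1 x.1.2) (kashF ρ i) L (fun x => ?_) h0'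
      (fun x => ?_) ⟨(a, b), rfl, ha, hb⟩
    · rw [tensorF]; split_ifs <;> exact hL _ _
    · rw [kashF_fDiv hO (hw x)]; exact hF x
  · refine apply_sub_mem_qMul (fun x : LevelIdx D i (μ (D.h i)) (ν (D.h i)) (a + b) =>
      strTensor ρ₁ ρ₂ τ i u v x.1.1 x.1.2) (fun x => fDiv ρ i (k x) (w x))
      (fun x => tensorE ρ₁ ρ₂ τ i (μ (D.h i)) u v x.1.1 x.1.2) (kashE ρ i) L (fun x => ?_) h0'
      (fun x => ?_) ⟨(a, b), rfl, ha, hb⟩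
    · rw [tensorE]
      split_ifs
      · exact L.zero_mem
      · exact hL _ _
      · exact hL _ _
    · have h1 := hE x
      have h2 := hw x
      have h3 := hk x
      rcases hkx : k x with _ | r
      · rw [hkx] at h1
        rw [fDiv_zero, kashE_prim hO h2]; exact h1
      · rw [hkx] at h1 h3
        rw [kashE_fDiv_succ hO h2 h3]; exact h1

end tensorStrings

/-! ### Strings in crystal lattices and crystal bases -/

section crystal
variable {I Pv : Type*} [AddCommGroup Pv] {D : BorcherdsCartanDatum I Pv}
  {M : Type*} [AddCommGroup M] [Module K M] {ρ : Rep D M}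

/-- Removes the bottom member of a decomposition; inductions on its length proceed this way. -/
theorem IsDec.kashE (hO : IsOInt ρ) {i : I} {μ : Module.Dual ℤ Pv} {u : M} {N : ℕ} {w : ℕ → M}
    (h : IsDec ρ i μ u (N + 1) w) :
    IsDec ρ i (μ + D.α i) (kashE ρ i u) N fun n => w (n + 1) := by
  have wt : ∀ n : ℕ, μ + D.α i + n • D.α i = μ + (n + 1) • D.α i := fun n => by
    rw [succ_nsmul']; abel
  refine ⟨fun n => ?_, fun n hn => ?_, fun n hn => h.zero _ (by omega), ?_⟩
  · rw [wt]; exact h.mem (n + 1)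
  · rw [wt]; exact (h.adm (n + 1) hn).mono (Nat.le_succ n)
  · rw [h.sum, map_sum, Finset.sum_range_succ', fDiv_zero, kashE_prim hO (h.mem 0), add_zero]
    refine Finset.sum_congr rfl fun n _ => ?_
    by_cases hn : w (n + 1) = 0
    · rw [hn, map_zero, map_zero, map_zero]
    · rw [kashE_fDiv_succ hO (h.mem (n + 1)) (h.adm (n + 1) hn)]

theorem fDiv_mem (hO : IsOInt ρ) {i : I} {L : QLattice M} (hF : ∀ x ∈ L, kashF ρ i x ∈ L)
    {μ : Module.Dual ℤ Pv} {w : M} (hw : w ∈ prim ρ i μ) (hwL : w ∈ L) (n : ℕ) :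
    fDiv ρ i n w ∈ L := by
  induction n with
  | zero => rwa [fDiv_zero]
  | succ n ih => rw [← kashF_fDiv hO hw]; exact hF _ ih

/-- The members of the string decomposition of a vector of a lattice belong to the lattice. -/
theorem IsDec.mem_lattice (hO : IsOInt ρ) {i : I} {L : QLattice M}
    (hE : ∀ x ∈ L, QGKM.kashE ρ i x ∈ L) (hF : ∀ x ∈ L, kashF ρ i x ∈ L) {N : ℕ} :
    ∀ {μ : Module.Dual ℤ Pv} {u : M} {w : ℕ → M}, IsDec ρ i μ u N w → u ∈ L → ∀ n, w n ∈ L := by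
  induction N with
  | zero => exact fun h _ n => by rw [h.zero n (Nat.zero_le n)]; exact L.zero_mem
  | succ N ih =>
    intro μ u w h hu
    -- `ẽ_i u` has the shifted decomposition, so induction applies to it. What remains, `w 0`, is
    -- `u` minus vectors obtained from the others by `f̃_i`.
    have h1 : ∀ n, w (n + 1) ∈ L := ih (h.kashE hO) (hE u hu)
    have h2 := h.sum
    rw [Finset.sum_range_succ', fDiv_zero] at h2
    have h3 : w 0 ∈ L := by
      rw [eq_sub_of_add_eq' h2.symm]
      exact L.sub_mem hu (L.sum_mem fun n _ => fDiv_mem hO hF (h.mem (n + 1)) (h1 n) _)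
    intro n
    rcases n with _ | n
    · exact h3
    · exact h1 n

theorem qMul_stable {L : QLattice M} (T : M →ₗ[K] M) (hT : ∀ x ∈ L, T x ∈ L) :
    ∀ x ∈ qMul L, T x ∈ qMul L := by
  rintro _ ⟨y, hy, rfl⟩
  exact ⟨T y, hT y hy, map_smul _ _ _⟩

variable (ρ) in
/-- The members of the `i`-strings in a lattice. -/
def stringSet (i : I) (L : QLattice M) : Set M :=
  {x | ∃ (μ : Module.Dual ℤ Pv) (w : M) (n : ℕ), w ∈ prim ρ i μ ∧ w ∈ L ∧ w ≠ 0 ∧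
    Adm D i (μ (D.h i)) n ∧ x = fDiv ρ i n w}

theorem le_span_stringSet (hO : IsOInt ρ) {L : QLattice M} (hL : IsCrystalLattice ρ L) (i : I) :
    L ≤ Submodule.span A0 (stringSet ρ i L) := by
  refine hL.weight.2.symm.le.trans (iSup_le fun μ x hx => ?_)
  obtain ⟨N, w, h⟩ := exists_isDec hO i hx.2
  have hw := h.mem_lattice hO (hL.kashE_mem i) (hL.kashF_mem i) hx.1
  rw [h.sum]
  refine Submodule.sum_mem _ fun n _ => ?_
  by_cases hn : w n = 0
  · rw [hn, map_zero]; exact Submodule.zero_mem _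
  · exact Submodule.subset_span ⟨_, w n, n, h.mem n, hw n, hn, h.adm n hn, rfl⟩

theorem toLimit_eq_iff {L : QLattice M} {x y : L} :
    toLimit L x = toLimit L y ↔ (x : M) - y ∈ qMul L := by
  rw [← sub_eq_zero, ← map_sub, ← Submodule.coe_sub, ← mem_qSub_iff]
  exact Submodule.Quotient.mk_eq_zero _

theorem toLimit_eq_zero_iff {L : QLattice M} {x : L} : toLimit L x = 0 ↔ (x : M) ∈ qMul L := by
  rw [← mem_qSub_iff]
  exact Submodule.Quotient.mk_eq_zero _

theorem limE_toLimit {L : QLattice M} (hL : IsCrystalLattice ρ L) (i : I) (x : L) :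
    limE hL i (toLimit L x) = toLimit L ⟨kashE ρ i x, hL.kashE_mem i x x.2⟩ := rfl

theorem limF_toLimit {L : QLattice M} (hL : IsCrystalLattice ρ L) (i : I) (x : L) :
    limF hL i (toLimit L x) = toLimit L ⟨kashF ρ i x, hL.kashF_mem i x x.2⟩ := rfl

/-- The class of a member of a string in a lattice. -/
def stringClass (hO : IsOInt ρ) {L : QLattice M} (hL : IsCrystalLattice ρ L) {i : I}
    {μ : Module.Dual ℤ Pv} {u : M} (hu : u ∈ prim ρ i μ) (huL : u ∈ L) (n : ℕ) :
    CrystalLimit L :=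
  toLimit L ⟨fDiv ρ i n u, fDiv_mem hO (hL.kashF_mem i) hu huL n⟩

variable {L : QLattice M}

theorem limF_stringClass (hO : IsOInt ρ) (hL : IsCrystalLattice ρ L) {i : I}
    {μ : Module.Dual ℤ Pv} {u : M} (hu : u ∈ prim ρ i μ) (huL : u ∈ L) (n : ℕ) :
    limF hL i (stringClass hO hL hu huL n) = stringClass hO hL hu huL (n + 1) := by
  rw [stringClass, limF_toLimit]
  exact congrArg (toLimit L) (Subtype.ext (kashF_fDiv hO hu n))

theorem limE_stringClass_zero (hO : IsOInt ρ) (hL : IsCrystalLattice ρ L) {i : I}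
    {μ : Module.Dual ℤ Pv} {u : M} (hu : u ∈ prim ρ i μ) (huL : u ∈ L) :
    limE hL i (stringClass hO hL hu huL 0) = 0 := by
  rw [stringClass, limE_toLimit, toLimit_eq_zero_iff]
  simp only [fDiv_zero]
  rw [kashE_prim hO hu]
  exact Submodule.zero_mem _

theorem limE_stringClass_succ (hO : IsOInt ρ) (hL : IsCrystalLattice ρ L) {i : I}
    {μ : Module.Dual ℤ Pv} {u : M} (hu : u ∈ prim ρ i μ) (huL : u ∈ L) {n : ℕ}
    (hn : Adm D i (μ (D.h i)) (n + 1)) :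
    limE hL i (stringClass hO hL hu huL (n + 1)) = stringClass hO hL hu huL n := by
  rw [stringClass, limE_toLimit]
  exact congrArg (toLimit L) (Subtype.ext (kashE_fDiv_succ hO hu hn))

/-- From an admissible position `ẽ_i` leads back to the class of `u`, which is not zero. -/
theorem stringClass_eq_zero_iff (hO : IsOInt ρ) (hL : IsCrystalLattice ρ L) {i : I}
    {μ : Module.Dual ℤ Pv} {u : M} (hu : u ∈ prim ρ i μ) (huL : u ∈ L) (hq : u ∉ qMul L) (n : ℕ) :
    stringClass hO hL hu huL n = 0 ↔ ¬ Adm D i (μ (D.h i)) n := by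
  constructor
  · intro h ha
    induction n with
    | zero =>
      rw [stringClass, toLimit_eq_zero_iff] at h
      simp only [fDiv_zero] at h
      exact hq h
    | succ n ih =>
      refine ih ?_ (ha.mono (Nat.le_succ n))
      rw [← limE_stringClass_succ hO hL hu huL ha, h, map_zero]
  · intro h
    rw [stringClass, toLimit_eq_zero_iff]
    simp only [fDiv_eq_zero hO hu h]
    exact Submodule.zero_mem _

variable {B : Set (CrystalLimit L)}

theorem IsCrystalBasis.ne_zero (h : IsCrystalBasis ρ L B) {b : CrystalLimit L} (hb : b ∈ B) :
    b ≠ 0 := h.linearIndependent.ne_zero (⟨b, hb⟩ : B)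

/-- Each member of a crystal basis is the class of a member of a string in the lattice. -/
theorem IsCrystalBasis.exists_stringClass (hO : IsOInt ρ) (h : IsCrystalBasis ρ L B) (i : I)
    {b : CrystalLimit L} (hb : b ∈ B) :
    ∃ (μ : Module.Dual ℤ Pv) (u : M) (hu : u ∈ prim ρ i μ) (huL : u ∈ L) (n : ℕ),
      u ∉ qMul L ∧ Adm D i (μ (D.h i)) n ∧ b = stringClass hO h.lattice hu huL n := by
  classical
  have hL := h.lattice
  have hE := hL.kashE_mem i
  have hF := hL.kashF_mem i
  have rep : ∀ b ∈ B, ∃ (μ : Module.Dual ℤ Pv) (x : L), (x : M) ∈ weightSpace ρ μ ∧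
      toLimit L x = b := fun b hb => by
    obtain ⟨μ, ⟨x, hx, rfl⟩, -⟩ := h.weight b hb
    exact ⟨μ, x, hx.2, rfl⟩
  -- A weight representative has a finite string decomposition, which `ẽ_i` shortens each time.
  have nilp : ∃ l, (limE hL i ^ (l + 1)) b = 0 := by
    obtain ⟨μ, x, hx, rfl⟩ := rep b hb
    obtain ⟨N, w, hd⟩ := exists_isDec hO i hx
    have key : ∀ N, ∀ (μ : Module.Dual ℤ Pv) (x : L) w, IsDec ρ i μ (x : M) N w →
        (limE hL i ^ N) (toLimit L x) = 0 := by
      intro N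
      induction N with
      | zero =>
        intro μ x w hd
        have : x = 0 := Subtype.ext (by rw [hd.sum]; simp)
        rw [this, map_zero, map_zero]
      | succ N ih =>
        intro μ x w hd
        rw [pow_succ, Module.End.mul_apply, limE_toLimit]
        exact ih _ _ _ (hd.kashE hO)
    exact ⟨N, by rw [pow_succ', Module.End.mul_apply, key N μ x w hd, map_zero]⟩
  -- As long as they are non-zero, the iterates stay in `B` and are undone by `f̃_i`, by the axiom
  -- `limF_iff`.
  have iter : ∀ l, (limE hL i ^ l) b ≠ 0 →
      (limE hL i ^ l) b ∈ B ∧ b = (limF hL i ^ l) ((limE hL i ^ l) b) := by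
    intro l
    induction l with
    | zero => exact fun _ => ⟨hb, rfl⟩
    | succ l ih =>
      intro hne
      have hne' : (limE hL i ^ l) b ≠ 0 := fun h0 => hne (by
        rw [pow_succ', Module.End.mul_apply, h0, map_zero])
      obtain ⟨h1, h2⟩ := ih hne'
      have h3 := (h.limE_mem i _ h1).resolve_right (by
        rwa [pow_succ', Module.End.mul_apply] at hne)
      rw [pow_succ', Module.End.mul_apply]
      refine ⟨h3, ?_⟩
      rw [pow_succ, Module.End.mul_apply, (h.limF_iff i _ h3 _ h1).mpr rfl]
      exact h2
  have hl := Nat.find_spec nilp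
  have hne : (limE hL i ^ (Nat.find nilp)) b ≠ 0 := by
    rcases hn : Nat.find nilp with _ | l
    · simpa using h.ne_zero hb
    · exact Nat.find_min nilp (by omega)
  generalize Nat.find nilp = l at hl hne
  obtain ⟨h1, h2⟩ := iter l hne
  obtain ⟨μ, x, hx, e⟩ := rep _ h1
  obtain ⟨N, w, hd⟩ := exists_isDec hO i hx
  have hd := hd.mono (Nat.le_succ N)
  rw [pow_succ', Module.End.mul_apply, ← e, limE_toLimit, toLimit_eq_zero_iff] at hl
  -- The last non-zero iterate is represented by `x` with `ẽ_i x ∈ qL`. As `qL` is itself stable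
  -- under the Kashiwara operators, the higher members of `x` lie in `qL`, and `x ≡ w 0`.
  have hw : ∀ n, w (n + 1) ∈ qMul L :=
    (hd.kashE hO).mem_lattice hO (qMul_stable _ hE) (qMul_stable _ hF) hl
  have hwL := hd.mem_lattice hO hE hF x.2
  have hx0 : (x : M) - w 0 ∈ qMul L := by
    rw [hd.sum, Finset.sum_range_succ', fDiv_zero, add_sub_cancel_right]
    exact Submodule.sum_mem _ fun n _ =>
      fDiv_mem hO (qMul_stable _ hF) (hd.mem (n + 1)) (hw n) _
  have hw0 := hd.mem 0
  rw [zero_smul, add_zero] at hw0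
  have e' : (limE hL i ^ l) b = stringClass hO hL hw0 (hwL 0) 0 := by
    rw [← e, stringClass, toLimit_eq_iff]
    simpa [fDiv_zero] using hx0
  have hq : w 0 ∉ qMul L := fun hq => hne (by
    rw [e', stringClass, toLimit_eq_zero_iff]
    simpa [fDiv_zero] using hq)
  have hb' : b = stringClass hO hL hw0 (hwL 0) l := by
    rw [h2, e']
    clear h2 e' hl hne h1 e
    induction l with
    | zero => simp
    | succ l ih => rw [pow_succ', Module.End.mul_apply, ih, limF_stringClass]
  refine ⟨μ, w 0, hw0, hwL 0, l, hq, ?_, hb'⟩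
  by_contra ha
  exact h.ne_zero hb (by rw [hb', stringClass_eq_zero_iff hO hL hw0 (hwL 0) hq]; exact ha)

/-! ### The functions `ε_i` and `φ_i` on string members -/

section values
variable (hO : IsOInt ρ) (h : IsCrystalBasis ρ L B) {i : I} {μ : Module.Dual ℤ Pv} {u : M}
  (hu : u ∈ prim ρ i μ) (huL : u ∈ L)

theorem stringClass_mem_of_mem (hq : u ∉ qMul L) {n n' : ℕ} (hn : stringClass hO h.lattice hu huL n ∈ B)
    (ha : Adm D i (μ (D.h i)) n') (hnn : n ≤ n') : stringClass hO h.lattice hu huL n' ∈ B := by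
  induction n', hnn using Nat.le_induction with
  | base => exact hn
  | succ n' _ ih =>
    have h1 := h.limF_mem i _ (ih (ha.mono (Nat.le_succ n')))
    rw [limF_stringClass] at h1
    exact h1.resolve_right fun h0 =>
      (stringClass_eq_zero_iff hO h.lattice hu huL hq _).mp h0 ha

theorem limF_pow_stringClass (n l : ℕ) : (limF h.lattice i ^ l)
    (stringClass hO h.lattice hu huL n) = stringClass hO h.lattice hu huL (n + l) := by
  induction l with
  | zero => rfl
  | succ l ih => rw [pow_succ', Module.End.mul_apply, ih, limF_stringClass, add_assoc]

theorem limF_pow_mem_iff (hq : u ∉ qMul L) {n : ℕ} (hn : stringClass hO h.lattice hu huL n ∈ B) (l : ℕ) :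
    (limF h.lattice i ^ l) (stringClass hO h.lattice hu huL n) ∈ B ↔
      Adm D i (μ (D.h i)) (n + l) := by
  rw [limF_pow_stringClass hO h hu huL]
  constructor
  · intro hm
    by_contra ha
    exact h.ne_zero hm ((stringClass_eq_zero_iff hO h.lattice hu huL hq _).mpr ha)
  · exact fun ha => stringClass_mem_of_mem hO h hu huL hq hn ha (Nat.le_add_right n l)

theorem adm_of_mem (hq : u ∉ qMul L) {n : ℕ} (hn : stringClass hO h.lattice hu huL n ∈ B) :
    Adm D i (μ (D.h i)) n := by
  by_contra ha
  exact h.ne_zero hn ((stringClass_eq_zero_iff hO h.lattice hu huL hq _).mpr ha)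

/-- `φ_i` counts the admissible positions beyond `n`. For imaginary `i` it is `∞` if the weight of
`u` is positive and `0` otherwise. -/
theorem lt_phi_iff (hq : u ∉ qMul L) {n : ℕ} (hn : stringClass hO h.lattice hu huL n ∈ B) (b : ℕ) :
    (b : ℕ∞) < phi h.lattice i B (stringClass hO h.lattice hu huL n) ↔
      PhiGt D i (μ (D.h i)) n b := by
  have ha := adm_of_mem hO h hu huL hq hn
  have e : PhiGt D i (μ (D.h i)) n b ↔ Adm D i (μ (D.h i)) (n + (b + 1)) := by
    unfold PhiGt Adm
    split_ifs
    · push_cast; omega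
    · simp
  rw [e, phi, lt_iSup_iff]
  simp only [lt_iSup_iff, Set.mem_ofPred_eq, limF_pow_mem_iff hO h hu huL hq hn, exists_prop,
    Nat.cast_lt]
  exact ⟨fun ⟨l, h1, h2⟩ => h1.mono (by omega), fun h1 => ⟨b + 1, h1, by omega⟩⟩

theorem le_phi_iff (hq : u ∉ qMul L) {n : ℕ} (hn : stringClass hO h.lattice hu huL n ∈ B) (b : ℕ) :
    (b : ℕ∞) ≤ phi h.lattice i B (stringClass hO h.lattice hu huL n) ↔
      PhiGe D i (μ (D.h i)) n b := by
  have ha := adm_of_mem hO h hu huL hq hn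
  rcases b with _ | b
  · simp only [Nat.cast_zero, zero_le, true_iff]
    unfold PhiGe
    unfold Adm at ha
    split_ifs at *
    · push_cast; omega
    · exact Or.inl rfl
  · rw [Nat.cast_succ, ENat.add_one_le_iff (ENat.natCast_ne_top b), lt_phi_iff hO h hu huL hq hn]
    unfold PhiGt PhiGe
    split_ifs
    · push_cast; omega
    · simp

theorem eps_stringClass (hq : u ∉ qMul L) {n : ℕ} (hn : stringClass hO h.lattice hu huL n ∈ B) :
    eps h.lattice i B (stringClass hO h.lattice hu huL n) = n := by
  have ha := adm_of_mem hO h hu huL hq hn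
  have down : ∀ l ≤ n, (limE h.lattice i ^ l) (stringClass hO h.lattice hu huL n) =
      stringClass hO h.lattice hu huL (n - l) := fun l hl => by
    induction l with
    | zero => rfl
    | succ l ih =>
      obtain ⟨r, rfl⟩ : ∃ r, n = r + l + 1 := ⟨n - l - 1, by omega⟩
      rw [pow_succ', Module.End.mul_apply, ih (by omega), show r + l + 1 - l = r + 1 by omega,
        limE_stringClass_succ hO h.lattice hu huL (ha.mono (by omega))]
      congr 1; omega
  refine le_antisymm (iSup₂_le fun l hl => ?_) ?_
  · by_contra hlt
    have hlt : n + 1 ≤ l := by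
      rw [not_le, Nat.cast_lt] at hlt; exact hlt
    obtain ⟨r, rfl⟩ := Nat.exists_eq_add_of_le' hlt
    refine h.ne_zero hl ?_
    rw [pow_add, Module.End.mul_apply, pow_succ', Module.End.mul_apply, down n le_rfl,
      Nat.sub_self, limE_stringClass_zero, map_zero]
  · refine le_iSup₂_of_le n ?_ le_rfl
    have key : ∀ l ≤ n, (limE h.lattice i ^ l) (stringClass hO h.lattice hu huL n) ∈ B := by
      intro l hl
      induction l with
      | zero => exact hn
      | succ l ih =>
        have h1 := h.limE_mem i _ (ih (by omega))
        rw [← Module.End.mul_apply, ← pow_succ'] at h1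
        refine h1.resolve_right fun h0 => ?_
        rw [Set.mem_singleton_iff, down _ hl,
          stringClass_eq_zero_iff hO h.lattice hu huL hq] at h0
        exact h0 (ha.mono (Nat.sub_le _ _))
    exact key n le_rfl

end values

/-- The weight of a non-zero element of `L / qL` is unique. -/
theorem limitWeight_unique (hL : IsDirectSum L (latticeWeight ρ L)) {b : CrystalLimit L}
    (hb : b ≠ 0) {μ ν : Module.Dual ℤ Pv} (hμ : b ∈ limitWeight ρ L μ)
    (hν : b ∈ limitWeight ρ L ν) : μ = ν := by
  by_contra hne
  obtain ⟨x, hx, rfl⟩ := hμ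
  obtain ⟨y, hy, e⟩ := hν
  rw [eq_comm, toLimit_eq_iff] at e
  obtain ⟨z, hz, e⟩ := e
  rw [← hL.2, iSup_split_single (latticeWeight ρ L) μ] at hz
  -- With `z = z₁ + z₂` split into its part of weight `μ` and the rest, comparing the `μ`-parts of
  -- `x = y + q z` gives `x = q z₁`.
  obtain ⟨z₁, hz₁, z₂, hz₂, rfl⟩ := Submodule.mem_sup.mp hz
  have e' : (x : M) - q0 • z₁ = y + q0 • z₂ := by
    rw [sub_eq_iff_eq_add, add_assoc, add_comm (q0 • z₂), ← smul_add, q0_smul_def, ← e]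
    abel
  have h1 : (x : M) - q0 • z₁ ∈ latticeWeight ρ L μ :=
    Submodule.sub_mem _ hx (Submodule.smul_mem _ _ hz₁)
  have h2 : (x : M) - q0 • z₁ ∈ ⨆ j, ⨆ (_ : j ≠ μ), latticeWeight ρ L j := by
    rw [e']
    exact Submodule.add_mem _ (Submodule.mem_iSup_of_mem ν
      (Submodule.mem_iSup_of_mem (Ne.symm hne) hy)) (Submodule.smul_mem _ _ hz₂)
  have h3 := Submodule.disjoint_def.mp (hL.1 μ) _ h1 h2
  exact hb (toLimit_eq_zero_iff.mpr ⟨z₁, hz₁.1, (sub_eq_zero.mp h3).trans (q0_smul_def z₁)⟩)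

end crystal

/-! ### Tensor products in the category `O_int` -/

section tensorOInt
variable {I Pv : Type*} [AddCommGroup Pv] {D : BorcherdsCartanDatum I Pv}
  {M₁ M₂ M : Type*} [AddCommGroup M₁] [Module K M₁] [AddCommGroup M₂] [Module K M₂]
  [AddCommGroup M] [Module K M]
  {ρ₁ : Rep D M₁} {ρ₂ : Rep D M₂} {ρ : Rep D M} {τ : M₁ →ₗ[K] M₂ →ₗ[K] M}

/-- By the modular law: a spanning family inside an independent one leaves no room for proper
inclusions. -/
theorem eq_of_iSupIndep_of_le {R V ι : Type*} [Ring R] [AddCommGroup V] [Module R V]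
    {N W : ι → Submodule R V} (hW : iSupIndep W) (hN : ∀ j, N j ≤ W j) (h : ⨆ j, N j = ⊤) (j : ι) :
    N j = W j := by
  refine le_antisymm (hN j) ?_
  have h1 : N j ⊔ ⨆ k, ⨆ (_ : k ≠ j), N k = ⊤ := by rw [← h, iSup_split_single N j]
  have h2 : (⨆ k, ⨆ (_ : k ≠ j), N k) ⊓ W j = ⊥ :=
    ((hW j).symm.mono_left (iSup₂_mono fun k _ => hN k)).eq_bot
  calc W j = (N j ⊔ ⨆ k, ⨆ (_ : k ≠ j), N k) ⊓ W j := by rw [h1, top_inf_eq]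
    _ = N j ⊔ (⨆ k, ⨆ (_ : k ≠ j), N k) ⊓ W j := sup_inf_assoc_of_le _ (hN j)
    _ ≤ N j := by rw [h2, sup_bot_eq]

theorem IsTensorAction.iSup_weightSpace_eq (hτ : IsTensorAction ρ₁ ρ₂ ρ τ)
    (hs : Submodule.map₂ τ ⊤ ⊤ = ⊤) (h₁ : IsOInt ρ₁) (h₂ : IsOInt ρ₂) (l : Module.Dual ℤ Pv) :
    ⨆ μ, Submodule.map₂ τ (weightSpace ρ₁ μ) (weightSpace ρ₂ (l - μ)) = weightSpace ρ l := by
  refine eq_of_iSupIndep_of_le (N := fun l => ⨆ μ, Submodule.map₂ τ (weightSpace ρ₁ μ)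
    (weightSpace ρ₂ (l - μ))) (weightSpace_indep ρ)
    (fun l => iSup_le fun μ => Submodule.map₂_le.mpr fun x hx y hy => ?_) ?_ l
  · have := hτ.mem_weightSpace hx hy
    rwa [add_sub_cancel] at this
  · rw [eq_top_iff, ← hs, ← h₁.weight.2, ← h₂.weight.2, Submodule.map₂_iSup_left]
    refine iSup_le fun μ => ?_
    rw [Submodule.map₂_iSup_right]
    refine iSup_le fun ν => ?_
    refine le_iSup_of_le (μ + ν) (le_iSup_of_le μ ?_)
    rw [add_sub_cancel_left]

/-- Reduces a claim about a weight space of the tensor product to non-zero products of weight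
vectors, to whose weights the axioms of `O_int` apply. -/
theorem IsTensorAction.weightSpace_le (hτ : IsTensorAction ρ₁ ρ₂ ρ τ)
    (hs : Submodule.map₂ τ ⊤ ⊤ = ⊤) (h₁ : IsOInt ρ₁) (h₂ : IsOInt ρ₂) {l : Module.Dual ℤ Pv}
    {N : Submodule K M} (h : ∀ μ ν, μ + ν = l → ∀ x ∈ weightSpace ρ₁ μ, ∀ y ∈ weightSpace ρ₂ ν,
      x ≠ 0 → y ≠ 0 → τ x y ∈ N) : weightSpace ρ l ≤ N := by
  rw [← hτ.iSup_weightSpace_eq hs h₁ h₂]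
  refine iSup_le fun μ => Submodule.map₂_le.mpr fun x hx y hy => ?_
  by_cases hx0 : x = 0
  · rw [hx0, map_zero]; exact N.zero_mem
  by_cases hy0 : y = 0
  · rw [hy0, map_zero]; exact N.zero_mem
  exact h μ (l - μ) (add_sub_cancel _ _) x hx y hy hx0 hy0

theorem IsTensorAction.exists_weights (hτ : IsTensorAction ρ₁ ρ₂ ρ τ)
    (hs : Submodule.map₂ τ ⊤ ⊤ = ⊤) (h₁ : IsOInt ρ₁) (h₂ : IsOInt ρ₂) {l : Module.Dual ℤ Pv}
    (hl : weightSpace ρ l ≠ ⊥) :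
    ∃ μ ν, μ + ν = l ∧ weightSpace ρ₁ μ ≠ ⊥ ∧ weightSpace ρ₂ ν ≠ ⊥ := by
  by_contra hne
  refine hl (eq_bot_iff.mpr (hτ.weightSpace_le hs h₁ h₂ fun μ ν e x hx y hy hx0 hy0 => ?_))
  exact absurd ⟨μ, ν, e, (Submodule.ne_bot_iff _).mpr ⟨x, hx, hx0⟩,
    (Submodule.ne_bot_iff _).mpr ⟨y, hy, hy0⟩⟩ hne

/-- There are finitely many ways to write a weight as `l₁ - x = l - (l₂ - y)` with `x, y ∈ Q₊`. -/
theorem finite_setOf_sub_mem_Qplus (l₁ l₂ : Module.Dual ℤ Pv) :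
    {μ : Module.Dual ℤ Pv | l₁ - μ ∈ D.Qplus ∧ l₂ + μ ∈ D.Qplus}.Finite := by
  classical
  by_cases hc : ∃ c : I →₀ ℕ, Finsupp.linearCombination ℕ D.α c = l₁ + l₂
  · obtain ⟨c, hc⟩ := hc
    refine ((Set.finite_Icc 0 c).image
      fun d => l₁ - Finsupp.linearCombination ℕ D.α d).subset ?_
    rintro μ ⟨h1, h2⟩
    obtain ⟨d, hd⟩ := mem_Qplus_iff.mp h1
    obtain ⟨d', hd'⟩ := mem_Qplus_iff.mp h2
    refine ⟨d, ⟨zero_le, ?_⟩, by simp only [hd]; abel⟩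
    -- The two coefficient vectors are non-negative with sum `c`, so `d` ranges over the finite
    -- interval from `0` to `c`.
    have : d + d' = c := (α_indep_nat D) (by rw [map_add, hd, hd', hc]; abel)
    rw [← this]
    exact le_self_add
  · convert Set.finite_empty
    refine Set.eq_empty_of_forall_notMem fun μ ⟨h1, h2⟩ => hc (mem_Qplus_iff.mp ?_)
    have := D.Qplus.add_mem h1 h2
    rwa [show l₁ - μ + (l₂ + μ) = l₁ + l₂ by abel] at this

theorem finite_weights (h₁ : IsOInt ρ₁) (h₂ : IsOInt ρ₂) (l : Module.Dual ℤ Pv) :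
    {μ | weightSpace ρ₁ μ ≠ ⊥ ∧ weightSpace ρ₂ (l - μ) ≠ ⊥}.Finite := by
  obtain ⟨S₁, hS₁⟩ := h₁.bounded
  obtain ⟨S₂, hS₂⟩ := h₂.bounded
  refine ((S₁ ×ˢ S₂).finite_toSet.biUnion fun p _ =>
    finite_setOf_sub_mem_Qplus (D := D) p.1 (p.2 - l)).subset ?_
  rintro μ ⟨h1, h2⟩
  obtain ⟨l₁, hl₁, k1⟩ := hS₁ _ h1
  obtain ⟨l₂, hl₂, k2⟩ := hS₂ _ h2
  refine Set.mem_biUnion (x := (l₁, l₂)) (by simp [hl₁, hl₂]) ⟨k1, ?_⟩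
  rwa [show l₂ - (l - μ) = l₂ - l + μ by abel] at k2

theorem IsTensorAction.finite_weightSpace (hτ : IsTensorAction ρ₁ ρ₂ ρ τ)
    (hs : Submodule.map₂ τ ⊤ ⊤ = ⊤) (h₁ : IsOInt ρ₁) (h₂ : IsOInt ρ₂) (l : Module.Dual ℤ Pv) :
    Module.Finite K (weightSpace ρ l) := by
  have hF := finite_weights h₁ h₂ l
  rw [Module.Finite.iff_fg]
  have e : weightSpace ρ l = ⨆ μ ∈ hF.toFinset,
      Submodule.map₂ τ (weightSpace ρ₁ μ) (weightSpace ρ₂ (l - μ)) := by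
    refine le_antisymm (hτ.weightSpace_le hs h₁ h₂ ?_) ?_
    · rintro μ ν rfl x hx y hy hx0 hy0
      refine Submodule.mem_iSup_of_mem μ (Submodule.mem_iSup_of_mem ?_
        (Submodule.apply_mem_map₂ _ hx (by rwa [add_sub_cancel_left])))
      rw [Set.Finite.mem_toFinset]
      exact ⟨(Submodule.ne_bot_iff _).mpr ⟨x, hx, hx0⟩,
        (Submodule.ne_bot_iff _).mpr ⟨y, by rwa [add_sub_cancel_left], hy0⟩⟩
    · rw [← hτ.iSup_weightSpace_eq hs h₁ h₂]
      exact iSup₂_le fun μ _ => le_iSup (fun μ => Submodule.map₂ τ (weightSpace ρ₁ μ)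
        (weightSpace ρ₂ (l - μ))) μ
  rw [e]
  have := h₁.finite
  have := h₂.finite
  exact Submodule.fg_biSup _ _ fun μ _ => Submodule.FG.map₂ _
    (Module.Finite.iff_fg.mp inferInstance) (Module.Finite.iff_fg.mp inferInstance)

/-- `f_i` acts either on the first factor, or on the second while `K_i` rescales the first. Either
way one of the two nilpotency bounds drops by one. -/
theorem IsTensorAction.f_pow_eq_zero (hτ : IsTensorAction ρ₁ ρ₂ ρ τ) (i : I) (s : ℕ) :
    ∀ (a b : ℕ), a + b = s → ∀ (μ : Module.Dual ℤ Pv), ∀ x ∈ weightSpace ρ₁ μ, ∀ y,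
      (ρ₁ (uF D i) ^ a) x = 0 → (ρ₂ (uF D i) ^ b) y = 0 → (ρ (uF D i) ^ s) (τ x y) = 0 := by
  induction s with
  | zero =>
    rintro a b e μ x - y h1 -
    obtain rfl : a = 0 := by omega
    simp [show x = 0 from h1]
  | succ s ih =>
    intro a b e μ x hx y h1 h2
    rcases a with _ | a
    · simp [show x = 0 from h1]
    rcases b with _ | b
    · simp [show y = 0 from h2]
    rw [pow_succ, Module.End.mul_apply] at *
    rw [hτ.f, map_add, uK_apply hx, map_smul, LinearMap.smul_apply, map_smul,
      ih a (b + 1) (by omega) _ _ (uF_mem hx i) y h1 (by rwa [pow_succ, Module.End.mul_apply]),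
      ih (a + 1) b (by omega) μ x hx _ (by rwa [pow_succ, Module.End.mul_apply]) h2,
      smul_zero, add_zero]

/-- Below `-a_ii` the vector `e_i x` would have negative weight at `h_i`. The inequality is what a
tensor product requires: two non-negative weights adding up to `-a_ii` are each at most `-a_ii`. -/
theorem IsOInt.e_eq_zero (hρ : IsOInt ρ) {i : I} (hi : D.a i i ≤ 0) {μ : Module.Dual ℤ Pv}
    (hμ : μ (D.h i) ≤ -D.a i i) {x : M} (hx : x ∈ weightSpace ρ μ) : ρ (uE D i) x = 0 := by
  rcases hμ.eq_or_lt with hμ | hμ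
  · exact hρ.e_zero i hi μ hμ x hx
  by_contra h0
  have := hρ.nonneg i hi _ ((Submodule.ne_bot_iff _).mpr ⟨_, uE_mem hx i, h0⟩)
  rw [LinearMap.add_apply, D.α_h] at this
  omega

/-- The category `O_int` is closed under tensor products. -/
theorem IsTensorAction.isOInt (hτ : IsTensorAction ρ₁ ρ₂ ρ τ)
    (hs : Submodule.map₂ τ ⊤ ⊤ = ⊤) (h₁ : IsOInt ρ₁) (h₂ : IsOInt ρ₂) : IsOInt ρ where
  weight := by
    refine ⟨weightSpace_indep ρ, ?_⟩
    rw [eq_top_iff, ← hs, ← h₁.weight.2, ← h₂.weight.2, Submodule.map₂_iSup_left]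
    refine iSup_le fun μ => ?_
    rw [Submodule.map₂_iSup_right]
    exact iSup_le fun ν => Submodule.map₂_le.mpr fun x hx y hy =>
      Submodule.mem_iSup_of_mem (μ + ν) (hτ.mem_weightSpace hx hy)
  finite := hτ.finite_weightSpace hs h₁ h₂
  bounded := by
    classical
    obtain ⟨S₁, hS₁⟩ := h₁.bounded
    obtain ⟨S₂, hS₂⟩ := h₂.bounded
    refine ⟨Finset.image₂ (· + ·) S₁ S₂, fun l hl => ?_⟩
    obtain ⟨μ, ν, rfl, hμ, hν⟩ := hτ.exists_weights hs h₁ h₂ hl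
    obtain ⟨l₁, hl₁, k1⟩ := hS₁ _ hμ
    obtain ⟨l₂, hl₂, k2⟩ := hS₂ _ hν
    exact ⟨l₁ + l₂, Finset.mem_image₂_of_mem hl₁ hl₂, by
      rw [add_sub_add_comm]; exact D.Qplus.add_mem k1 k2⟩
  nilp i hi v := by
    -- The generalized eigenspace for `0` consists of the vectors on which `f_i` is nilpotent; being
    -- a submodule, it need only contain the products.
    have key : (⊤ : Submodule K M) ≤ Module.End.maxGenEigenspace (ρ (uF D i)) 0 := by
      rw [← hs, ← h₁.weight.2, Submodule.map₂_iSup_left]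
      refine iSup_le fun μ => Submodule.map₂_le.mpr fun x hx y _ => ?_
      obtain ⟨a, ha⟩ := h₁.nilp i hi x
      obtain ⟨b, hb⟩ := h₂.nilp i hi y
      rw [Module.End.mem_maxGenEigenspace]
      exact ⟨a + b, by
        rw [zero_smul, sub_zero]; exact hτ.f_pow_eq_zero i _ a b rfl μ x hx y ha hb⟩
    obtain ⟨n, hn⟩ := (Module.End.mem_maxGenEigenspace _ _ _).mp (key (Submodule.mem_top (x := v)))
    exact ⟨n, by rwa [zero_smul, sub_zero] at hn⟩
  nonneg i hi l hl := by
    obtain ⟨μ, ν, rfl, hμ, hν⟩ := hτ.exists_weights hs h₁ h₂ hl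
    exact add_nonneg (h₁.nonneg i hi μ hμ) (h₂.nonneg i hi ν hν)
  f_zero i hi l hl v hv := by
    suffices weightSpace ρ l ≤ LinearMap.ker (ρ (uF D i)) from LinearMap.mem_ker.mp (this hv)
    refine hτ.weightSpace_le hs h₁ h₂ fun μ ν e x hx y hy hx0 hy0 => ?_
    have k1 := h₁.nonneg i hi μ ((Submodule.ne_bot_iff _).mpr ⟨x, hx, hx0⟩)
    have k2 := h₂.nonneg i hi ν ((Submodule.ne_bot_iff _).mpr ⟨y, hy, hy0⟩)
    rw [← e, LinearMap.add_apply] at hl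
    rw [LinearMap.mem_ker, hτ.f, h₁.f_zero i hi μ (by omega) x hx,
      h₂.f_zero i hi ν (by omega) y hy, map_zero, map_zero, LinearMap.zero_apply, add_zero]
  e_zero i hi l hl v hv := by
    suffices weightSpace ρ l ≤ LinearMap.ker (ρ (uE D i)) from LinearMap.mem_ker.mp (this hv)
    refine hτ.weightSpace_le hs h₁ h₂ fun μ ν e x hx y hy hx0 hy0 => ?_
    have k1 := h₁.nonneg i hi μ ((Submodule.ne_bot_iff _).mpr ⟨x, hx, hx0⟩)
    have k2 := h₂.nonneg i hi ν ((Submodule.ne_bot_iff _).mpr ⟨y, hy, hy0⟩)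
    rw [← e, LinearMap.add_apply] at hl
    rw [LinearMap.mem_ker, hτ.e, h₁.e_eq_zero hi (by omega) hx,
      h₂.e_eq_zero hi (by omega) hy, map_zero, map_zero, LinearMap.zero_apply, add_zero]

end tensorOInt

/-- The comultiplication makes `tensorRep` a tensor product action. -/
theorem isTensorAction_tensorRep {I Pv : Type*} [AddCommGroup Pv] {D : BorcherdsCartanDatum I Pv}
    {M₁ M₂ : Type*} [AddCommGroup M₁] [Module K M₁] [AddCommGroup M₂] [Module K M₂]
    (ρ₁ : Rep D M₁) (ρ₂ : Rep D M₂) :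
    IsTensorAction ρ₁ ρ₂ (tensorRep ρ₁ ρ₂) (TensorProduct.mk K M₁ M₂) where
  e i x y := by
    simp [tensorRep, show comul D (uE D i) = _ from comul_uGen D (.e i), comulGen, Module.endTensorEndAlgHom_apply]
  f i x y := by
    simp [tensorRep, show comul D (uF D i) = _ from comul_uGen D (.f i), comulGen, Module.endTensorEndAlgHom_apply]
  q h x y := by
    simp [tensorRep, show comul D (uQ D h) = _ from comul_uGen D (.k h), comulGen, Module.endTensorEndAlgHom_apply]

/-! ### Bases of lattices -/

section latticeBasis
variable {M : Type*} [AddCommGroup M] [Module K M]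

/-- A free lattice that spans `M` is spanned by a basis of `M`. -/
theorem exists_basis_of_lattice {L : QLattice M} (hf : Module.Free A0 L)
    (hs : Submodule.span K (L : Set M) = ⊤) :
    ∃ b : Module.Basis (Module.Free.ChooseBasisIndex A0 L) K M,
      L = Submodule.span A0 (Set.range b) := by
  let c := Module.Free.chooseBasis A0 L
  have h1 : LinearIndependent A0 fun j => (c j : M) :=
    c.linearIndependent.map' L.subtype L.ker_subtype
  have h2 : LinearIndependent K fun j => (c j : M) :=
    (LinearIndependent.iff_fractionRing A0 K).mp h1
  have h3 : L = Submodule.span A0 (Set.range fun j => (c j : M)) := by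
    rw [show (fun j => (c j : M)) = L.subtype ∘ c from rfl, Set.range_comp, ← Submodule.map_span, c.span_eq, Submodule.map_subtype_top]
  refine ⟨Module.Basis.mk h2 ?_, by rw [Module.Basis.coe_mk]; exact h3⟩
  rw [← hs, Submodule.span_le]
  intro x hx
  rw [h3] at hx
  exact Submodule.span_le_restrictScalars A0 K _ hx

theorem exists_basis_span {ι : Type*} (b : Module.Basis ι K M) {L : QLattice M}
    (hL : L = Submodule.span A0 (Set.range b)) :
    ∃ c : Module.Basis ι A0 L, ∀ j, (c j : M) = b j := by
  subst hL
  exact ⟨.span ((LinearIndependent.iff_fractionRing A0 K).mpr b.linearIndependent),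
    fun j => Module.Basis.coe_span_apply _ j⟩

theorem span_lattice_eq_top {ι : Type*} (b : Module.Basis ι K M) {L : QLattice M}
    (hL : L = Submodule.span A0 (Set.range b)) : Submodule.span K (L : Set M) = ⊤ := by
  rw [eq_top_iff, ← b.span_eq, hL]
  exact Submodule.span_mono Submodule.subset_span

theorem limit_q0_smul {L : QLattice M} (z : CrystalLimit L) : q0 • z = 0 := by
  obtain ⟨x, rfl⟩ := Submodule.mkQ_surjective _ z
  rw [← map_smul]
  exact (Submodule.Quotient.mk_eq_zero _).mpr ⟨x, rfl⟩

theorem limit_rat_smul {L : QLattice M} (r : ℚ) (z : CrystalLimit L) :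
    r • z = algebraMap ℚ A0 r • z := rfl

/-- `A₀` acts on `L / qL` through the evaluation at `q = 0`. -/
theorem limit_smul {L : QLattice M} (c : A0) (z : CrystalLimit L) : c • z = ev0 c • z := by
  obtain ⟨y, hy⟩ := exists_eq_add_q0_mul c
  rw [limit_rat_smul]
  nth_rewrite 1 [hy]
  rw [add_smul, mul_smul, limit_q0_smul, add_zero]

/-- The `ℚ`-basis of `L / qL` given by an `A₀`-basis of `L`. -/
def limitBasis {ι : Type*} {L : QLattice M} (c : Module.Basis ι A0 L) :
    Module.Basis ι ℚ (CrystalLimit L) :=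
  Module.Basis.mk (v := fun j => toLimit L (c j))
    (by
      rw [linearIndependent_iff']
      intro s g h j hj
      have h1 : toLimit L (∑ k ∈ s, algebraMap ℚ A0 (g k) • c k) = 0 := by
        rw [map_sum, ← h]
        exact Finset.sum_congr rfl fun k _ => map_smul _ _ _
      obtain ⟨y, hy⟩ := (Submodule.Quotient.mk_eq_zero _).mp h1
      -- The coordinates of an element of `qL` vanish at `q = 0`, while those of the lifted relation
      -- are the constants `g k`.
      have h2 := congrArg (fun x => ev0 (c.repr x j)) hy
      simp only [map_smul, map_sum, Finsupp.smul_apply, smul_eq_mul, map_mul, ev0_q0, zero_mul,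
        Finsupp.finsetSum_apply, Module.Basis.repr_self, ev0_algebraMap] at h2
      rw [Finset.sum_eq_single_of_mem j hj fun k _ hk => by
        rw [Finsupp.single_eq_of_ne hk.symm, map_zero, mul_zero], Finsupp.single_eq_same,
        map_one, mul_one] at h2
      exact h2.symm)
    (by
      rintro z -
      obtain ⟨x, rfl⟩ := Submodule.mkQ_surjective _ z
      rw [← c.linearCombination_repr x, Finsupp.linearCombination_apply, Finsupp.sum, map_sum]
      refine Submodule.sum_mem _ fun j _ => ?_
      rw [map_smul, limit_smul]
      exact Submodule.smul_mem _ _ (Submodule.subset_span ⟨j, rfl⟩))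

theorem limitBasis_apply {ι : Type*} {L : QLattice M} (c : Module.Basis ι A0 L) (j : ι) :
    limitBasis c j = toLimit L (c j) := by rw [limitBasis, Module.Basis.mk_apply]

end latticeBasis

/-- If a bilinear map sends a pair of bases to a basis, then it does so for each pair of bases. -/
theorem exists_basis_of_bilin {R V₁ V₂ V ι₁ ι₂ κ₁ κ₂ : Type*} [CommRing R] [AddCommGroup V₁]
    [Module R V₁] [AddCommGroup V₂] [Module R V₂] [AddCommGroup V] [Module R V]
    (β : V₁ →ₗ[R] V₂ →ₗ[R] V) (c₁ : Module.Basis ι₁ R V₁) (c₂ : Module.Basis ι₂ R V₂)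
    (c : Module.Basis (ι₁ × ι₂) R V) (hc : ∀ j k, c (j, k) = β (c₁ j) (c₂ k))
    (b₁ : Module.Basis κ₁ R V₁) (b₂ : Module.Basis κ₂ R V₂) :
    ∃ b : Module.Basis (κ₁ × κ₂) R V, ∀ j k, b (j, k) = β (b₁ j) (b₂ k) := by
  -- The hypothesis says that `β` induces an isomorphism from the tensor product, a condition
  -- independent of the bases.
  let e := (c₁.tensorProduct c₂).equiv c (Equiv.refl _)
  have he : e.toLinearMap = TensorProduct.lift β := by
    refine (c₁.tensorProduct c₂).ext fun ⟨j, k⟩ => ?_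
    rw [LinearEquiv.coe_coe, Module.Basis.equiv_apply, Equiv.refl_apply, hc,
      Module.Basis.tensorProduct_apply, TensorProduct.lift.tmul]
  refine ⟨(b₁.tensorProduct b₂).map e, fun j k => ?_⟩
  rw [Module.Basis.map_apply, Module.Basis.tensorProduct_apply, ← LinearEquiv.coe_coe, he,
    TensorProduct.lift.tmul]

/-! ### The tensor product of two lattices -/

section tensorLattice
variable {I Pv : Type*} [AddCommGroup Pv] {D : BorcherdsCartanDatum I Pv}
  {M₁ M₂ M : Type*} [AddCommGroup M₁] [Module K M₁] [AddCommGroup M₂] [Module K M₂]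
  [AddCommGroup M] [Module K M]

theorem apply_mem_span_image2 (τ : M₁ →ₗ[K] M₂ →ₗ[K] M) {S₁ : Set M₁} {S₂ : Set M₂} {x : M₁}
    {y : M₂} (hx : x ∈ Submodule.span A0 S₁) (hy : y ∈ Submodule.span A0 S₂) :
    τ x y ∈ Submodule.span A0 (Set.image2 (fun x y => τ x y) S₁ S₂) := by
  induction hx using Submodule.span_induction with
  | mem x hx =>
    induction hy using Submodule.span_induction with
    | mem y hy => exact Submodule.subset_span ⟨x, hx, y, hy, rfl⟩
    | zero => rw [map_zero]; exact Submodule.zero_mem _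
    | add y z _ _ h h' => rw [map_add]; exact Submodule.add_mem _ h h'
    | smul c y _ h => rw [A0_smul_def, map_smul, ← A0_smul_def]; exact Submodule.smul_mem _ _ h
  | zero => rw [map_zero]; exact Submodule.zero_mem _
  | add y z _ _ h h' => rw [map_add]; exact Submodule.add_mem _ h h'
  | smul c y _ h =>
    rw [A0_smul_def, map_smul, LinearMap.smul_apply, ← A0_smul_def]
    exact Submodule.smul_mem _ _ h

theorem span_image2_eq (τ : M₁ →ₗ[K] M₂ →ₗ[K] M) {L₁ : QLattice M₁} {L₂ : QLattice M₂}
    {S₁ : Set M₁} {S₂ : Set M₂} (h₁ : L₁ = Submodule.span A0 S₁) (h₂ : L₂ = Submodule.span A0 S₂) :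
    Submodule.span A0 (Set.image2 (fun x y => τ x y) (L₁ : Set M₁) (L₂ : Set M₂)) =
      Submodule.span A0 (Set.image2 (fun x y => τ x y) S₁ S₂) := by
  refine le_antisymm (Submodule.span_le.mpr ?_) (Submodule.span_mono (Set.image2_subset ?_ ?_))
  · rintro _ ⟨x, hx, y, hy, rfl⟩
    rw [h₁] at hx
    rw [h₂] at hy
    exact apply_mem_span_image2 τ hx hy
  · rw [h₁]; exact Submodule.subset_span
  · rw [h₂]; exact Submodule.subset_span

variable {ρ₁ : Rep D M₁} {ρ₂ : Rep D M₂} {ρ : Rep D M} {τ : M₁ →ₗ[K] M₂ →ₗ[K] M}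
  {L₁ : QLattice M₁} {L₂ : QLattice M₂} {L : QLattice M}

theorem latticeWeight_indep (ρ : Rep D M) (L : QLattice M) : iSupIndep (latticeWeight ρ L) := by
  intro μ
  rw [Submodule.disjoint_def]
  intro x hx hx'
  refine Submodule.disjoint_def.mp (weightSpace_indep ρ μ) x hx.2 ?_
  have : ⨆ j, ⨆ (_ : j ≠ μ), latticeWeight ρ L j ≤
      (⨆ j, ⨆ (_ : j ≠ μ), weightSpace ρ j).restrictScalars A0 :=
    iSup₂_le fun j hj y hy => Submodule.mem_iSup_of_mem j (Submodule.mem_iSup_of_mem hj hy.2)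
  exact this hx'

theorem IsCrystalLattice.eq_span_stringSet (hO : IsOInt ρ) (hL : IsCrystalLattice ρ L) (i : I) :
    L = Submodule.span A0 (stringSet ρ i L) := by
  refine le_antisymm (le_span_stringSet hO hL i) (Submodule.span_le.mpr ?_)
  rintro _ ⟨μ, w, n, hw, hwL, -, -, rfl⟩
  exact fDiv_mem hO (hL.kashF_mem i) hw hwL n

/-- Each factor lattice is the sum of its weight parts, so products of weight vectors generate the
tensor lattice. -/
theorem IsTensorAction.isDirectSum_lattice (hτ : IsTensorAction ρ₁ ρ₂ ρ τ)
    (hL₁ : IsCrystalLattice ρ₁ L₁) (hL₂ : IsCrystalLattice ρ₂ L₂)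
    (hL : L = Submodule.span A0 (Set.image2 (fun x y => τ x y) (L₁ : Set M₁) (L₂ : Set M₂))) :
    IsDirectSum L (latticeWeight ρ L) := by
  refine ⟨latticeWeight_indep ρ L, le_antisymm (iSup_le fun μ => inf_le_left) ?_⟩
  have e := hL
  rw [span_image2_eq τ (hL₁.weight.2.symm.trans (Submodule.iSup_eq_span _))
    (hL₂.weight.2.symm.trans (Submodule.iSup_eq_span _))] at e
  nth_rewrite 1 [e]
  rw [Submodule.span_le]
  rintro _ ⟨x, hx, y, hy, rfl⟩
  obtain ⟨μ, hx⟩ := Set.mem_iUnion.mp hx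
  obtain ⟨ν, hy⟩ := Set.mem_iUnion.mp hy
  refine Submodule.mem_iSup_of_mem (μ + ν) ⟨?_, hτ.mem_weightSpace hx.2 hy.2⟩
  rw [hL]
  exact Submodule.subset_span ⟨x, hx.1, y, hy.1, rfl⟩

theorem strTensor_mem (h₁ : IsOInt ρ₁) (h₂ : IsOInt ρ₂) (hL₁ : IsCrystalLattice ρ₁ L₁)
    (hL₂ : IsCrystalLattice ρ₂ L₂)
    (hL : L = Submodule.span A0 (Set.image2 (fun x y => τ x y) (L₁ : Set M₁) (L₂ : Set M₂)))
    {i : I} {μ ν : Module.Dual ℤ Pv} {u : M₁} {v : M₂} (hu : u ∈ prim ρ₁ i μ)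
    (hv : v ∈ prim ρ₂ i ν) (huL : u ∈ L₁) (hvL : v ∈ L₂) (a b : ℕ) :
    strTensor ρ₁ ρ₂ τ i u v a b ∈ L := by
  rw [hL]
  exact Submodule.subset_span ⟨_, fDiv_mem h₁ (hL₁.kashF_mem i) hu huL a, _,
    fDiv_mem h₂ (hL₂.kashF_mem i) hv hvL b, rfl⟩

/-- The tensor product of two crystal lattices is stable under the Kashiwara operators. -/
theorem IsTensorAction.kash_mem_lattice (hτ : IsTensorAction ρ₁ ρ₂ ρ τ) (h₁ : IsOInt ρ₁)
    (h₂ : IsOInt ρ₂) (hO : IsOInt ρ) (hL₁ : IsCrystalLattice ρ₁ L₁) (hL₂ : IsCrystalLattice ρ₂ L₂)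
    (hL : L = Submodule.span A0 (Set.image2 (fun x y => τ x y) (L₁ : Set M₁) (L₂ : Set M₂)))
    (i : I) {x : M} (hx : x ∈ L) : kashE ρ i x ∈ L ∧ kashF ρ i x ∈ L := by
  have e := hL
  -- For fixed `i` both lattices are spanned by string members, so stability has to be checked only
  -- on their products.
  rw [span_image2_eq τ (hL₁.eq_span_stringSet h₁ i) (hL₂.eq_span_stringSet h₂ i)] at e
  have key : L ≤ L.comap ((kashE ρ i).restrictScalars A0) ⊓
      L.comap ((kashF ρ i).restrictScalars A0) := by
    nth_rewrite 1 [e]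
    rw [Submodule.span_le]
    rintro _ ⟨_, ⟨μ, u, a, hu, huL, hu0, ha, rfl⟩, _, ⟨ν, v, b, hv, hvL, hv0, hb, rfl⟩, rfl⟩
    have hs := strTensor_mem (τ := τ) h₁ h₂ hL₁ hL₂ hL hu hv huL hvL
    obtain ⟨kF, kE⟩ := kash_strTensor h₁ h₂ hO hτ hu hv hs ha hb hu0 hv0
    constructor
    · refine (Submodule.sub_mem_iff_left L ?_).mp (qMul_le L kE)
      unfold tensorE
      split_ifs
      · exact L.zero_mem
      · exact hs _ _
      · exact hs _ _
    · refine (Submodule.sub_mem_iff_left L ?_).mp (qMul_le L kF)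
      unfold tensorF
      split_ifs <;> exact hs _ _
  exact key hx

end tensorLattice

/-! ### Crystal bases of tensor products -/

section tensorCrystal
variable {I Pv : Type*} [AddCommGroup Pv] {D : BorcherdsCartanDatum I Pv}
  {M₁ M₂ : Type*} [AddCommGroup M₁] [Module K M₁] [AddCommGroup M₂] [Module K M₂]
  {ρ₁ : Rep D M₁} {ρ₂ : Rep D M₂} {L₁ : QLattice M₁} {L₂ : QLattice M₂}

theorem isOInt_tensorRep (h₁ : IsOInt ρ₁) (h₂ : IsOInt ρ₂) : IsOInt (tensorRep ρ₁ ρ₂) :=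
  (isTensorAction_tensorRep ρ₁ ρ₂).isOInt (TensorProduct.map₂_mk_top_top_eq_top K M₁ M₂) h₁ h₂

/-- The lattice spanned by a set. -/
abbrev latticeSpan {M : Type*} [AddCommGroup M] [Module K M] (S : Set M) : QLattice M :=
  Submodule.span A0 S

theorem tensorLattice_eq_span {ι₁ ι₂ : Type*} (b₁ : Module.Basis ι₁ K M₁)
    (b₂ : Module.Basis ι₂ K M₂) (h₁ : L₁ = Submodule.span A0 (Set.range b₁))
    (h₂ : L₂ = Submodule.span A0 (Set.range b₂)) :
    tensorLattice L₁ L₂ = latticeSpan (Set.range (b₁.tensorProduct b₂)) := by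
  refine Eq.trans (span_image2_eq (TensorProduct.mk K M₁ M₂) h₁ h₂) (congrArg latticeSpan ?_)
  ext x
  constructor
  · rintro ⟨_, ⟨j, rfl⟩, _, ⟨k, rfl⟩, rfl⟩
    exact ⟨(j, k), Module.Basis.tensorProduct_apply _ _ _ _⟩
  · rintro ⟨⟨j, k⟩, rfl⟩
    exact ⟨_, ⟨j, rfl⟩, _, ⟨k, rfl⟩, (Module.Basis.tensorProduct_apply _ _ _ _).symm⟩

/-- The tensor product of two crystal lattices is a crystal lattice. -/
theorem isCrystalLattice_tensorLattice (h₁ : IsOInt ρ₁) (h₂ : IsOInt ρ₂)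
    (hL₁ : IsCrystalLattice ρ₁ L₁) (hL₂ : IsCrystalLattice ρ₂ L₂) :
    IsCrystalLattice (tensorRep ρ₁ ρ₂) (tensorLattice L₁ L₂) := by
  obtain ⟨b₁, hb₁⟩ := exists_basis_of_lattice hL₁.free hL₁.span
  obtain ⟨b₂, hb₂⟩ := exists_basis_of_lattice hL₂.free hL₂.span
  have e := tensorLattice_eq_span b₁ b₂ hb₁ hb₂
  obtain ⟨c, -⟩ := exists_basis_span _ e
  have hτ := isTensorAction_tensorRep ρ₁ ρ₂
  have hO := isOInt_tensorRep h₁ h₂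
  exact ⟨.of_basis c, span_lattice_eq_top _ e, hτ.isDirectSum_lattice hL₁ hL₂ rfl,
    fun i x hx => (hτ.kash_mem_lattice h₁ h₂ hO hL₁ hL₂ rfl i hx).1,
    fun i x hx => (hτ.kash_mem_lattice h₁ h₂ hO hL₁ hL₂ rfl i hx).2⟩

variable (L₁ L₂) in
/-- `limitTmul` as a bilinear map over `ℚ`. -/
def limitTmulRat :
    CrystalLimit L₁ →ₗ[ℚ] CrystalLimit L₂ →ₗ[ℚ] CrystalLimit (tensorLattice L₁ L₂) :=
  LinearMap.mk₂ ℚ (fun x y => limitTmul L₁ L₂ x y)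
    (fun _ _ _ => by rw [map_add, LinearMap.add_apply])
    (fun r x y => by rw [limit_rat_smul, map_smul, LinearMap.smul_apply, limit_rat_smul])
    (fun _ _ _ => map_add _ _ _)
    (fun r x y => by rw [limit_rat_smul, map_smul, limit_rat_smul])

/-- The tensor products of the members of two bases of the crystal limits form a basis. -/
theorem exists_basis_tensorLimit {κ₁ κ₂ : Type*} (hL₁ : IsCrystalLattice ρ₁ L₁)
    (hL₂ : IsCrystalLattice ρ₂ L₂) (β₁ : Module.Basis κ₁ ℚ (CrystalLimit L₁))
    (β₂ : Module.Basis κ₂ ℚ (CrystalLimit L₂)) :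
    ∃ β : Module.Basis (κ₁ × κ₂) ℚ (CrystalLimit (tensorLattice L₁ L₂)),
      ∀ j k, β (j, k) = limitTmul L₁ L₂ (β₁ j) (β₂ k) := by
  obtain ⟨b₁, hb₁⟩ := exists_basis_of_lattice hL₁.free hL₁.span
  obtain ⟨b₂, hb₂⟩ := exists_basis_of_lattice hL₂.free hL₂.span
  obtain ⟨c₁, hc₁⟩ := exists_basis_span _ hb₁
  obtain ⟨c₂, hc₂⟩ := exists_basis_span _ hb₂
  obtain ⟨c, hc⟩ := exists_basis_span _ (tensorLattice_eq_span b₁ b₂ hb₁ hb₂)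
  -- Reductions of `A₀`-bases of the lattices provide one pair of bases whose products form a basis;
  -- this transfers to `β₁`, `β₂`.
  refine exists_basis_of_bilin (limitTmulRat L₁ L₂) (limitBasis c₁) (limitBasis c₂)
    (limitBasis c) (fun j k => ?_) β₁ β₂
  rw [limitBasis_apply, limitBasis_apply, limitBasis_apply]
  refine congrArg (toLimit _) (Subtype.ext ?_)
  rw [hc, Module.Basis.tensorProduct_apply, ← hc₁, ← hc₂]
  rfl

theorem strTensor_mem_tensorLattice (h₁ : IsOInt ρ₁) (h₂ : IsOInt ρ₂)
    (hL₁ : IsCrystalLattice ρ₁ L₁) (hL₂ : IsCrystalLattice ρ₂ L₂) {i : I} {μ ν : Module.Dual ℤ Pv}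
    {u : M₁} {v : M₂} (hu : u ∈ prim ρ₁ i μ) (hv : v ∈ prim ρ₂ i ν) (huL : u ∈ L₁) (hvL : v ∈ L₂)
    (a b : ℕ) : strTensor ρ₁ ρ₂ (TensorProduct.mk K M₁ M₂) i u v a b ∈ tensorLattice L₁ L₂ :=
  strTensor_mem (τ := TensorProduct.mk K M₁ M₂) (L := tensorLattice L₁ L₂) h₁ h₂ hL₁ hL₂ rfl hu hv
    huL hvL a b

section strings
variable (h₁ : IsOInt ρ₁) (h₂ : IsOInt ρ₂) (hL₁ : IsCrystalLattice ρ₁ L₁)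
  (hL₂ : IsCrystalLattice ρ₂ L₂) (hL : IsCrystalLattice (tensorRep ρ₁ ρ₂) (tensorLattice L₁ L₂))
  {i : I} {μ ν : Module.Dual ℤ Pv} {u : M₁} {v : M₂} (hu : u ∈ prim ρ₁ i μ) (hv : v ∈ prim ρ₂ i ν)
  (huL : u ∈ L₁) (hvL : v ∈ L₂)

theorem limitTmul_stringClass (a b : ℕ) :
    limitTmul L₁ L₂ (stringClass h₁ hL₁ hu huL a) (stringClass h₂ hL₂ hv hvL b) =
      toLimit (tensorLattice L₁ L₂) ⟨strTensor ρ₁ ρ₂ (TensorProduct.mk K M₁ M₂) i u v a b,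
        strTensor_mem_tensorLattice h₁ h₂ hL₁ hL₂ hu hv huL hvL a b⟩ :=
  limitTmul_mk L₁ L₂ _ _

open Classical in
/-- The action of `f̃_i` on tensor products of classes of members of strings. -/
theorem limF_limitTmul_stringClass (hu0 : u ≠ 0) (hv0 : v ≠ 0) {a b : ℕ}
    (ha : Adm D i (μ (D.h i)) a) (hb : Adm D i (ν (D.h i)) b) :
    limF hL i (limitTmul L₁ L₂ (stringClass h₁ hL₁ hu huL a) (stringClass h₂ hL₂ hv hvL b)) =
      if PhiGt D i (μ (D.h i)) a b then
        limitTmul L₁ L₂ (stringClass h₁ hL₁ hu huL (a + 1)) (stringClass h₂ hL₂ hv hvL b)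
      else limitTmul L₁ L₂ (stringClass h₁ hL₁ hu huL a) (stringClass h₂ hL₂ hv hvL (b + 1)) := by
  have key := (kash_strTensor h₁ h₂ (isOInt_tensorRep h₁ h₂) (isTensorAction_tensorRep ρ₁ ρ₂) hu hv
    (strTensor_mem_tensorLattice h₁ h₂ hL₁ hL₂ hu hv huL hvL) ha hb hu0 hv0).1
  unfold tensorF at key
  split_ifs at key ⊢
  all_goals
    simp only [limitTmul_stringClass, limF_toLimit]
    exact toLimit_eq_iff.mpr key

open Classical in
/-- The action of `ẽ_i` on tensor products of classes of members of strings. -/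
theorem limE_limitTmul_stringClass (hu0 : u ≠ 0) (hv0 : v ≠ 0) {a b : ℕ}
    (ha : Adm D i (μ (D.h i)) a) (hb : Adm D i (ν (D.h i)) b) :
    limE hL i (limitTmul L₁ L₂ (stringClass h₁ hL₁ hu huL a) (stringClass h₂ hL₂ hv hvL b)) =
      if PhiGe D i (μ (D.h i)) a b then
        limitTmul L₁ L₂ (limE hL₁ i (stringClass h₁ hL₁ hu huL a)) (stringClass h₂ hL₂ hv hvL b)
      else
        limitTmul L₁ L₂ (stringClass h₁ hL₁ hu huL a) (limE hL₂ i (stringClass h₂ hL₂ hv hvL b)) := by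
  have key := (kash_strTensor h₁ h₂ (isOInt_tensorRep h₁ h₂) (isTensorAction_tensorRep ρ₁ ρ₂) hu hv
    (strTensor_mem_tensorLattice h₁ h₂ hL₁ hL₂ hu hv huL hvL) ha hb hu0 hv0).2
  unfold tensorE at key
  split_ifs at key ⊢ with hp ha0
  · subst ha0
    rw [limE_stringClass_zero, map_zero, LinearMap.zero_apply, limitTmul_stringClass, limE_toLimit,
      toLimit_eq_zero_iff]
    rwa [sub_zero] at key
  · obtain ⟨a, rfl⟩ := Nat.exists_eq_succ_of_ne_zero ha0
    rw [limE_stringClass_succ h₁ hL₁ hu huL ha, limitTmul_stringClass, limitTmul_stringClass,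
      limE_toLimit]
    exact toLimit_eq_iff.mpr key
  -- At `b = 0` the condition `PhiGe` holds automatically, so this case does not occur.
  · rcases b with _ | b
    · unfold PhiGe at hp
      unfold Adm at ha
      split_ifs at hp ha
      · omega
      · exact absurd (Or.inl rfl) hp
    · rw [limE_stringClass_succ h₂ hL₂ hv hvL hb, limitTmul_stringClass, limitTmul_stringClass,
        limE_toLimit]
      exact toLimit_eq_iff.mpr key

end strings

/-- After `f̃_i` has moved the first factor, `ẽ_i` selects the first factor too;
`phiGe_succ_right_iff` is the counterpart for the second. Hence the two operators undo each other.
-/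
theorem phiGe_succ_iff {i : I} {m : ℤ} {a b : ℕ} (ha : Adm D i m (a + 1)) :
    PhiGe D i m (a + 1) b ↔ PhiGt D i m a b := by
  unfold PhiGe PhiGt Adm at *
  split_ifs at *
  · push_cast; omega
  · exact ⟨fun _ => by simpa using ha, Or.inr⟩

theorem phiGe_succ_right_iff {i : I} {m : ℤ} {a b : ℕ} :
    PhiGe D i m a (b + 1) ↔ PhiGt D i m a b := by
  unfold PhiGe PhiGt
  split_ifs
  · push_cast; omega
  · simp

theorem PhiGt.adm {i : I} {m : ℤ} {a b : ℕ} (h : PhiGt D i m a b) : Adm D i m (a + 1) := by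
  unfold PhiGt Adm at *
  split_ifs at *
  · push_cast; omega
  · exact Or.inr h

theorem ne_zero_of_notMem_qMul {M : Type*} [AddCommGroup M] [Module K M] {L : QLattice M} {u : M}
    (hu : u ∉ qMul L) : u ≠ 0 := fun h => hu (h ▸ Submodule.zero_mem _)

variable {B₁ : Set (CrystalLimit L₁)} {B₂ : Set (CrystalLimit L₂)}

/-- The tensor product rule for `f̃_i`. -/
theorem limF_limitTmul (h₁ : IsOInt ρ₁) (h₂ : IsOInt ρ₂) (hB₁ : IsCrystalBasis ρ₁ L₁ B₁)
    (hB₂ : IsCrystalBasis ρ₂ L₂ B₂)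
    (hL : IsCrystalLattice (tensorRep ρ₁ ρ₂) (tensorLattice L₁ L₂)) (i : I)
    {b₁ : CrystalLimit L₁} {b₂ : CrystalLimit L₂} (hb₁ : b₁ ∈ B₁) (hb₂ : b₂ ∈ B₂) :
    limF hL i (limitTmul L₁ L₂ b₁ b₂) =
      if eps hB₂.lattice i B₂ b₂ < phi hB₁.lattice i B₁ b₁ then
        limitTmul L₁ L₂ (limF hB₁.lattice i b₁) b₂
      else limitTmul L₁ L₂ b₁ (limF hB₂.lattice i b₂) := by
  obtain ⟨μ, u, hu, huL, a, hqu, ha, rfl⟩ := hB₁.exists_stringClass h₁ i hb₁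
  obtain ⟨ν, v, hv, hvL, b, hqv, hb, rfl⟩ := hB₂.exists_stringClass h₂ i hb₂
  rw [eps_stringClass h₂ hB₂ hv hvL hqv hb₂, limF_stringClass, limF_stringClass,
    limF_limitTmul_stringClass h₁ h₂ hB₁.lattice hB₂.lattice hL hu hv huL hvL
      (ne_zero_of_notMem_qMul hqu) (ne_zero_of_notMem_qMul hqv) ha hb]
  have key := lt_phi_iff h₁ hB₁ hu huL hqu hb₁ b
  by_cases hp : PhiGt D i (μ (D.h i)) a b
  · rw [if_pos hp, if_pos (key.mpr hp)]
  · rw [if_neg hp, if_neg (key.not.mpr hp)]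

/-- The tensor product rule for `ẽ_i`. -/
theorem limE_limitTmul (h₁ : IsOInt ρ₁) (h₂ : IsOInt ρ₂) (hB₁ : IsCrystalBasis ρ₁ L₁ B₁)
    (hB₂ : IsCrystalBasis ρ₂ L₂ B₂)
    (hL : IsCrystalLattice (tensorRep ρ₁ ρ₂) (tensorLattice L₁ L₂)) (i : I)
    {b₁ : CrystalLimit L₁} {b₂ : CrystalLimit L₂} (hb₁ : b₁ ∈ B₁) (hb₂ : b₂ ∈ B₂) :
    limE hL i (limitTmul L₁ L₂ b₁ b₂) =
      if eps hB₂.lattice i B₂ b₂ ≤ phi hB₁.lattice i B₁ b₁ then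
        limitTmul L₁ L₂ (limE hB₁.lattice i b₁) b₂
      else limitTmul L₁ L₂ b₁ (limE hB₂.lattice i b₂) := by
  obtain ⟨μ, u, hu, huL, a, hqu, ha, rfl⟩ := hB₁.exists_stringClass h₁ i hb₁
  obtain ⟨ν, v, hv, hvL, b, hqv, hb, rfl⟩ := hB₂.exists_stringClass h₂ i hb₂
  rw [eps_stringClass h₂ hB₂ hv hvL hqv hb₂,
    limE_limitTmul_stringClass h₁ h₂ hB₁.lattice hB₂.lattice hL hu hv huL hvL
      (ne_zero_of_notMem_qMul hqu) (ne_zero_of_notMem_qMul hqv) ha hb]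
  have key := le_phi_iff h₁ hB₁ hu huL hqu hb₁ b
  by_cases hp : PhiGe D i (μ (D.h i)) a b
  · rw [if_pos hp, if_pos (key.mpr hp)]
  · rw [if_neg hp, if_neg (key.not.mpr hp)]

theorem limitTmul_mem_tensorBasis {b₁ : CrystalLimit L₁} {b₂ : CrystalLimit L₂}
    (hb₁ : b₁ ∈ B₁ ∪ {0}) (hb₂ : b₂ ∈ B₂ ∪ {0}) :
    limitTmul L₁ L₂ b₁ b₂ ∈ tensorBasis B₁ B₂ ∪ {0} := by
  rcases hb₁ with hb₁ | rfl
  · rcases hb₂ with hb₂ | rfl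
    · exact Or.inl ⟨b₁, hb₁, b₂, hb₂, rfl⟩
    · exact Or.inr (map_zero _)
  · exact Or.inr (by rw [map_zero]; rfl)

theorem limitTmul_mem_limitWeight {μ ν : Module.Dual ℤ Pv} {b₁ : CrystalLimit L₁}
    {b₂ : CrystalLimit L₂} (hb₁ : b₁ ∈ limitWeight ρ₁ L₁ μ) (hb₂ : b₂ ∈ limitWeight ρ₂ L₂ ν) :
    limitTmul L₁ L₂ b₁ b₂ ∈ limitWeight (tensorRep ρ₁ ρ₂) (tensorLattice L₁ L₂) (μ + ν) := by
  obtain ⟨x, hx, rfl⟩ := hb₁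
  obtain ⟨y, hy, rfl⟩ := hb₂
  exact ⟨latticeTmul L₁ L₂ x y, ⟨(latticeTmul L₁ L₂ x y).2,
    (isTensorAction_tensorRep ρ₁ ρ₂).mem_weightSpace hx.2 hy.2⟩, rfl⟩

/-- On a tensor product of crystal bases `f̃_i b = b'` if and only if `b = ẽ_i b'`. -/
theorem limF_eq_iff_tensorBasis (h₁ : IsOInt ρ₁) (h₂ : IsOInt ρ₂) (hB₁ : IsCrystalBasis ρ₁ L₁ B₁)
    (hB₂ : IsCrystalBasis ρ₂ L₂ B₂)
    (hL : IsCrystalLattice (tensorRep ρ₁ ρ₂) (tensorLattice L₁ L₂))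
    (h0 : ∀ b ∈ tensorBasis B₁ B₂, b ≠ 0) (i : I) {b b' : CrystalLimit (tensorLattice L₁ L₂)}
    (hb : b ∈ tensorBasis B₁ B₂) (hb' : b' ∈ tensorBasis B₁ B₂) :
    limF hL i b = b' ↔ b = limE hL i b' := by
  have hF := fun {μ ν : Module.Dual ℤ Pv} {u : M₁} {v : M₂} (hu : u ∈ prim ρ₁ i μ)
    (hv : v ∈ prim ρ₂ i ν) (huL : u ∈ L₁) (hvL : v ∈ L₂) =>
    limF_limitTmul_stringClass h₁ h₂ hB₁.lattice hB₂.lattice hL hu hv huL hvL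
  have hE := fun {μ ν : Module.Dual ℤ Pv} {u : M₁} {v : M₂} (hu : u ∈ prim ρ₁ i μ)
    (hv : v ∈ prim ρ₂ i ν) (huL : u ∈ L₁) (hvL : v ∈ L₂) =>
    limE_limitTmul_stringClass h₁ h₂ hB₁.lattice hB₂.lattice hL hu hv huL hvL
  constructor
  · rintro rfl
    obtain ⟨b₁, hb₁, b₂, hb₂, rfl⟩ := hb
    obtain ⟨μ, u, hu, huL, m, hqu, hm, rfl⟩ := hB₁.exists_stringClass h₁ i hb₁
    obtain ⟨ν, v, hv, hvL, n, hqv, hn, rfl⟩ := hB₂.exists_stringClass h₂ i hb₂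
    have hu0 := ne_zero_of_notMem_qMul hqu
    have hv0 := ne_zero_of_notMem_qMul hqv
    -- The image belongs to the basis and is non-zero, which keeps the new position in the second
    -- string admissible when that factor moves.
    have hne := h0 _ hb'
    simp only at hne ⊢
    rw [hF hu hv huL hvL hu0 hv0 hm hn] at hne ⊢
    split_ifs at hne ⊢ with hp
    · rw [hE hu hv huL hvL hu0 hv0 hp.adm hn, if_pos ((phiGe_succ_iff hp.adm).mpr hp),
        limE_stringClass_succ h₁ hB₁.lattice hu huL hp.adm]
    · have hn' : Adm D i (ν (D.h i)) (n + 1) := by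
        by_contra hn'
        rw [(stringClass_eq_zero_iff h₂ hB₂.lattice hv hvL hqv _).mpr hn', map_zero] at hne
        exact hne rfl
      rw [hE hu hv huL hvL hu0 hv0 hm hn', if_neg (phiGe_succ_right_iff.not.mpr hp),
        limE_stringClass_succ h₂ hB₂.lattice hv hvL hn']
  · rintro rfl
    obtain ⟨b₁, hb₁, b₂, hb₂, rfl⟩ := hb'
    obtain ⟨μ, u, hu, huL, m, hqu, hm, rfl⟩ := hB₁.exists_stringClass h₁ i hb₁
    obtain ⟨ν, v, hv, hvL, n, hqv, hn, rfl⟩ := hB₂.exists_stringClass h₂ i hb₂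
    have hu0 := ne_zero_of_notMem_qMul hqu
    have hv0 := ne_zero_of_notMem_qMul hqv
    have hne := h0 _ hb
    simp only at hne ⊢
    rw [hE hu hv huL hvL hu0 hv0 hm hn] at hne ⊢
    split_ifs at hne ⊢ with hp
    · rcases m with _ | m
      · rw [limE_stringClass_zero, map_zero] at hne
        exact absurd rfl hne
      rw [limE_stringClass_succ h₁ hB₁.lattice hu huL hm,
        hF hu hv huL hvL hu0 hv0 (hm.mono (Nat.le_succ m)) hn,
        if_pos ((phiGe_succ_iff hm).mp hp)]
    · rcases n with _ | n
      · rw [limE_stringClass_zero, map_zero] at hne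
        exact absurd rfl hne
      rw [limE_stringClass_succ h₂ hB₂.lattice hv hvL hn,
        hF hu hv huL hvL hu0 hv0 hm (hn.mono (Nat.le_succ n)),
        if_neg (phiGe_succ_right_iff.not.mp hp)]

/-- The tensor product of two crystal bases is a crystal basis. -/
theorem isCrystalBasis_tensorBasis (h₁ : IsOInt ρ₁) (h₂ : IsOInt ρ₂)
    (hB₁ : IsCrystalBasis ρ₁ L₁ B₁) (hB₂ : IsCrystalBasis ρ₂ L₂ B₂) :
    IsCrystalBasis (tensorRep ρ₁ ρ₂) (tensorLattice L₁ L₂) (tensorBasis B₁ B₂) := by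
  have hL := isCrystalLattice_tensorLattice h₁ h₂ hB₁.lattice hB₂.lattice
  obtain ⟨β, hβ⟩ := exists_basis_tensorLimit hB₁.lattice hB₂.lattice
    (Module.Basis.mk hB₁.linearIndependent (by rw [Subtype.range_coe, hB₁.span]))
    (Module.Basis.mk hB₂.linearIndependent (by rw [Subtype.range_coe, hB₂.span]))
  simp only [Module.Basis.mk_apply] at hβ
  have hr : tensorBasis B₁ B₂ = Set.range β := by
    ext b
    constructor
    · rintro ⟨b₁, hb₁, b₂, hb₂, rfl⟩
      exact ⟨(⟨b₁, hb₁⟩, ⟨b₂, hb₂⟩), hβ _ _⟩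
    · rintro ⟨⟨b₁, b₂⟩, rfl⟩
      exact ⟨b₁, b₁.2, b₂, b₂.2, (hβ b₁ b₂).symm⟩
  have hli : LinearIndependent ℚ (Subtype.val : tensorBasis B₁ B₂ → _) := by
    rw [hr]; exact β.linearIndependent.linearIndepOn_id
  have h0 : ∀ b ∈ tensorBasis B₁ B₂, b ≠ 0 := fun b hb => hli.ne_zero (⟨b, hb⟩ : tensorBasis B₁ B₂)
  refine ⟨hL, hli, by rw [hr, β.span_eq], ?_, ?_, ?_,
    fun i b hb b' hb' => limF_eq_iff_tensorBasis h₁ h₂ hB₁ hB₂ hL h0 i hb hb'⟩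
  · intro b hb
    have hb0 := h0 b hb
    obtain ⟨b₁, hb₁, b₂, hb₂, rfl⟩ := hb
    obtain ⟨μ, hμ, -⟩ := hB₁.weight b₁ hb₁
    obtain ⟨ν, hν, -⟩ := hB₂.weight b₂ hb₂
    have hw := limitTmul_mem_limitWeight hμ hν
    exact ⟨μ + ν, hw, fun l hl => limitWeight_unique hL.weight hb0 hl hw⟩
  · rintro i _ ⟨b₁, hb₁, b₂, hb₂, rfl⟩
    simp only
    rw [limE_limitTmul h₁ h₂ hB₁ hB₂ hL i hb₁ hb₂]
    split_ifs
    · exact limitTmul_mem_tensorBasis (hB₁.limE_mem i b₁ hb₁) (Or.inl hb₂)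
    · exact limitTmul_mem_tensorBasis (Or.inl hb₁) (hB₂.limE_mem i b₂ hb₂)
  · rintro i _ ⟨b₁, hb₁, b₂, hb₂, rfl⟩
    simp only
    rw [limF_limitTmul h₁ h₂ hB₁ hB₂ hL i hb₁ hb₂]
    split_ifs
    · exact limitTmul_mem_tensorBasis (hB₁.limF_mem i b₁ hb₁) (Or.inl hb₂)
    · exact limitTmul_mem_tensorBasis (Or.inl hb₁) (hB₂.limF_mem i b₂ hb₂)

end tensorCrystal

end QGKM

end

open QGKM in
open scoped TensorProduct in
theorem mainTheorem3 {I Pv : Type*} [Countable I] [AddCommGroup Pv] [Module.Free ℤ Pv]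
    (D : BorcherdsCartanDatum I Pv)
    {M₁ M₂ : Type*} [AddCommGroup M₁] [Module K M₁] [AddCommGroup M₂] [Module K M₂]
    (ρ₁ : Rep D M₁) (ρ₂ : Rep D M₂) (hρ₁ : IsOInt ρ₁) (hρ₂ : IsOInt ρ₂)
    (L₁ : QLattice M₁) (L₂ : QLattice M₂)
    (B₁ : Set (CrystalLimit L₁)) (B₂ : Set (CrystalLimit L₂))
    (h₁ : IsCrystalBasis ρ₁ L₁ B₁) (h₂ : IsCrystalBasis ρ₂ L₂ B₂) :
    IsOInt (tensorRep ρ₁ ρ₂) ∧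
    ∃ h : IsCrystalBasis (tensorRep ρ₁ ρ₂) (tensorLattice L₁ L₂) (tensorBasis B₁ B₂),
      ∀ i : I, ∀ b₁ ∈ B₁, ∀ b₂ ∈ B₂,
        (phi h₁.lattice i B₁ b₁ ≥ eps h₂.lattice i B₂ b₂ →
          limE h.lattice i (limitTmul L₁ L₂ b₁ b₂) =
            limitTmul L₁ L₂ (limE h₁.lattice i b₁) b₂) ∧
        (phi h₁.lattice i B₁ b₁ < eps h₂.lattice i B₂ b₂ →
          limE h.lattice i (limitTmul L₁ L₂ b₁ b₂) =
            limitTmul L₁ L₂ b₁ (limE h₂.lattice i b₂)) ∧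
        (phi h₁.lattice i B₁ b₁ > eps h₂.lattice i B₂ b₂ →
          limF h.lattice i (limitTmul L₁ L₂ b₁ b₂) =
            limitTmul L₁ L₂ (limF h₁.lattice i b₁) b₂) ∧
        (phi h₁.lattice i B₁ b₁ ≤ eps h₂.lattice i B₂ b₂ →
          limF h.lattice i (limitTmul L₁ L₂ b₁ b₂) =
            limitTmul L₁ L₂ b₁ (limF h₂.lattice i b₂)) := by
  have hB := isCrystalBasis_tensorBasis hρ₁ hρ₂ h₁ h₂
  refine ⟨isOInt_tensorRep hρ₁ hρ₂, hB, fun i b₁ hb₁ b₂ hb₂ => ⟨fun h => ?_, fun h => ?_,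
    fun h => ?_, fun h => ?_⟩⟩
  · rw [limE_limitTmul hρ₁ hρ₂ h₁ h₂ hB.lattice i hb₁ hb₂, if_pos h]
  · rw [limE_limitTmul hρ₁ hρ₂ h₁ h₂ hB.lattice i hb₁ hb₂, if_neg h.not_ge]
  · rw [limF_limitTmul hρ₁ hρ₂ h₁ h₂ hB.lattice i hb₁ hb₂, if_pos h]
  · rw [limF_limitTmul hρ₁ hρ₂ h₁ h₂ hB.lattice i hb₁ hb₂, if_neg h.not_gt]
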